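/- **Setting.** Let $M=G/H$ be a Hermitian symmetric space of complex dimension $2$, of the following kind. $G$ is a closed matrix group whose Lie algebra $\mathfrak g$ is a real form of $\mathfrak g^{\mathbb C}=\mathfrak g\oplus i\mathfrak g$ (a space of complex matrices); $\tau$ is an automorphism of $G$ with $\tau^4=1$ (its differential on $\mathfrak g$ and the complex linear extension to $\mathfrak g^{\mathbb C}$ are also denoted $\tau$), $\sigma=\tau^2$, and $(G^\sigma)_0\subset H\subset G^\sigma$. Write $\mathfrak g=\mathfrak h\oplus\mathfrak m$ for the $(\pm1)$-eigenspaces of $\sigma$, so that $\mathfrak m\simeq T_{p_0}M$ at the base point $p_0$, $\dim_{\mathbb R}\mathfrak m=4$. The metric of $M$ comes from an inner product on $\mathfrak m$ invariant under $\mathrm{Ad}\,H$ and $\tau$. There is an element $Y$ with $\{X\in\mathfrak g:\tau X=-X\}=\mathbb R Y$ such that $J=\mathrm{ad}\,Y|_{\mathfrak m}$ is an $\mathrm{Ad}\,H$-invariant complex structure ($J^2=-1$), which defines the complex structure of $M$; the Kähler form is $\omega(u,v)=\langle Ju,v\rangle$. (The spaces $\mathbb C^2$, $\mathbb{CP}^2$,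 $\mathbb{CP}^1\times\mathbb{CP}^1$ and the noncompact duals of the last two are of this kind.) Fix a unitary frame $(\epsilon_1,\epsilon_2)$ of $\mathfrak m$ with $\tau\epsilon_1=-\epsilon_2$. Let $\mathfrak g^{\mathbb C}_a$ be the $i^a$-eigenspace of $\tau$ in $\mathfrak g^{\mathbb C}$, $a\in\{0,2,-1,1\}$. For a $\mathfrak g$-valued $1$-form $\alpha$ on a domain of $\mathbb C$ let $\alpha_a$ be its $\mathfrak g^{\mathbb C}_a$-component, $\alpha_{\mathfrak m}$ its $\mathfrak m$-component, and let $'$ and $''$ denote $(1,0)$- and $(0,1)$-parts. A $\mathfrak g^{\mathbb C}$-valued form $\varphi$ is flat if $d\varphi+\frac12[\varphi\wedge\varphi]=0$. Let $L\subset\mathbb C$ be a simply connected domain with coordinate $z=x+iy$. A smooth map $f:L\to M$ is weakly conformal if $|f_x|=|f_y|$ and $\langle f_x,f_y\rangle=0$ ($df$ may vanish), and Lagrangian if $f^*\omega=0$. For such an $f$, a Lagrangian lift is a smooth $F:L\to G$ with $f=F\cdot p_0$ whose Maurer–Cartan form $\alpha=F^{-1}dF$ satisfies, at each point, $\alpha_{\mathfrak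 m}=r\,k(\epsilon_1dx+\epsilon_2dy)$ with $r\ge 0$ and $k\in SU(\mathfrak m)$; where $f$ is an immersion, this says that the frame $F(\epsilon_1,\epsilon_2)$ equals the oriented orthonormal tangent frame $(f_x/|f_x|,f_y/|f_y|)$ modulo $SU(2)$. Let $L^*\subset L$ be the open set where $f$ is an immersion. The map $f$ is minimal if its area is critical for all smooth variations supported in compact subsets of $L^*$, and Hamiltonian stationary if this holds for those variations whose variation field $V$ is Hamiltonian, i.e. $\omega(V,df\,\cdot)=d\eta$ for some $\eta\in C_c^\infty(L)$. **Statement.** Let $\alpha$ be a smooth $\mathfrak g$-valued $1$-form on $L$. 1. $\alpha$ is the Maurer–Cartan form of a Lagrangian lift of a weakly conformal Lagrangian map $f:L\to M$ if and only if $\alpha$ is flat and partially primitive, i.e. $\alpha''_{-1}=\alpha'_1=0$. Likewise, $\alpha$ is the Maurer–Cartan form of a Lagrangian lift of a conformal Lagrangian immersion if and only if $\alpha$ is flat, partially primitive, and $\alpha'_{-1}$ vanishes nowhere. 2. Let $\alpha$ be the Maurer–Cartan form of a Lagrangian lift of a weakly conformal Lagrangian map $f$ which is an immersion on a dense subset of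 $L$ (for instance a conformal Lagrangian immersion). Then $f$ is Hamiltonian stationary if and only if the extended form $$\alpha_\lambda=\lambda^{-2}\alpha'_2+\lambda^{-1}\alpha'_{-1}+\alpha_0+\lambda\alpha''_1+\lambda^2\alpha''_2$$ is flat for all $\lambda\in S^1$; equivalently, if and only if it is flat for all $\lambda\in\mathbb C^*$. Moreover $f$ is minimal if and only if $\alpha_2=0$. -/

import Mathlib

open scoped ContDiff Topology Matrix
open MeasureTheory

-- A norm on complex matrices, used only to speak of smooth matrix-valued maps (every norm gives
-- the same topology and the same derivatives).
attribute [local instance] Matrix.linftyOpNormedAddCommGroup Matrix.linftyOpNormedSpace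
  Matrix.linftyOpNormedRing Matrix.linftyOpNormedAlgebra

noncomputable section

/-! ### Matrix Lie groups -/

/-- A closed group `G` of invertible complex matrices, with its (real) Lie algebra
`𝔤 = {X | exp (t X) ∈ G for all real t}`. -/
structure MatrixLieGroup (n : Type*) [Fintype n] [DecidableEq n] where
  G : Subgroup (GL n ℂ)
  isClosed_G : IsClosed (G : Set (GL n ℂ))
  𝔤 : Submodule ℝ (Matrix n n ℂ)
  mem_𝔤 : ∀ X : Matrix n n ℂ, X ∈ 𝔤 ↔
    ∀ t : ℝ, ∃ g ∈ G, (g : Matrix n n ℂ) = NormedSpace.exp (t • X)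
  lie_mem : ∀ X ∈ 𝔤, ∀ Y ∈ 𝔤, X * Y - Y * X ∈ 𝔤

namespace MatrixLieGroup

variable {n : Type*} [Fintype n] [DecidableEq n] (L : MatrixLieGroup n)

/-- The matrix of an element of `G`. -/
def mat (g : L.G) : Matrix n n ℂ := ((g : GL n ℂ) : Matrix n n ℂ)

/-- The Lie bracket of `𝔤`, the commutator of matrices. -/
def lie (X Y : L.𝔤) : L.𝔤 :=
  ⟨(X : Matrix n n ℂ) * Y - Y * X, L.lie_mem X X.2 Y Y.2⟩

theorem conj_mem (g : L.G) (X : L.𝔤) :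
    L.mat g * (X : Matrix n n ℂ) * L.mat g⁻¹ ∈ L.𝔤 := by
  rw [L.mem_𝔤]
  intro t
  obtain ⟨k, hk, hkX⟩ := (L.mem_𝔤 X).1 X.2 t
  refine ⟨(g : GL n ℂ) * k * (g : GL n ℂ)⁻¹, L.G.mul_mem (L.G.mul_mem g.2 hk) (L.G.inv_mem g.2), ?_⟩
  have h1 : t • (L.mat g * (X : Matrix n n ℂ) * L.mat g⁻¹)
      = ((g : GL n ℂ) : Matrix n n ℂ) * (t • (X : Matrix n n ℂ)) * ((g : GL n ℂ) : Matrix n n ℂ)⁻¹ := by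
    simp [mat]
  rw [h1, Matrix.exp_conj _ _ (Units.isUnit _), ← hkX]
  simp

/-- The adjoint action `Ad g X = g X g⁻¹` of `G` on `𝔤`. -/
def Ad (g : L.G) (X : L.𝔤) : L.𝔤 := ⟨L.mat g * (X : Matrix n n ℂ) * L.mat g⁻¹, L.conj_mem g X⟩

end MatrixLieGroup

/-! ### Hermitian symmetric spaces of complex dimension two -/

/-- A Hermitian symmetric space `M = G/H` of complex dimension two, with the order four
automorphism `τ` whose square is the symmetry `σ`. The tangent space of `M` at the base point is
`𝔪 = {X ∈ 𝔤 | σ X = -X}`, and the `G`-invariant Riemannian metric of `M` is given by an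
`Ad H`-invariant inner product on `𝔪`. -/
structure HermitianSymmetricSpace (n : Type*) [Fintype n] [DecidableEq n]
    extends MatrixLieGroup n where
  /-- `𝔤` is a real form of `𝔤 ⊕ i 𝔤`, so that its complexification is a space of matrices -/
  totally_real : ∀ X ∈ 𝔤, Complex.I • X ∈ 𝔤 → X = 0
  /-- the automorphism `τ` of `G` -/
  τ : G ≃* G
  /-- the differential of `τ` at the identity -/
  dτ : 𝔤 ≃ₗ[ℝ] 𝔤
  τ_deriv : ∀ (γ : ℝ → G) (X : 𝔤), γ 0 = 1 →
    HasDerivAt (fun t => toMatrixLieGroup.mat (γ t)) (X : Matrix n n ℂ) 0 →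
    HasDerivAt (fun t => toMatrixLieGroup.mat (τ (γ t))) (dτ X : Matrix n n ℂ) 0
  τ_order : ∀ g : G, τ (τ (τ (τ g))) = g
  /-- the isotropy group; it lies between the fixed group of `σ = τ ∘ τ` and its identity
  component -/
  H : Subgroup G
  H_le : ∀ h ∈ H, τ (τ h) = h
  le_H : connectedComponentIn {g : G | τ (τ g) = g} 1 ⊆ (H : Set G)
  /-- the inner product on `𝔪` (a bilinear form on `𝔤` of which only the restriction to `𝔪` is
  used) -/
  metric : 𝔤 →ₗ[ℝ] 𝔤 →ₗ[ℝ] ℝ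
  metric_symm : ∀ u v : 𝔤, dτ (dτ u) = -u → dτ (dτ v) = -v → metric u v = metric v u
  metric_pos : ∀ u : 𝔤, dτ (dτ u) = -u → u ≠ 0 → 0 < metric u u
  metric_Ad : ∀ h ∈ H, ∀ u v : 𝔤, dτ (dτ u) = -u → dτ (dτ v) = -v →
    metric (toMatrixLieGroup.Ad h u) (toMatrixLieGroup.Ad h v) = metric u v
  metric_τ : ∀ u v : 𝔤, dτ (dτ u) = -u → dτ (dτ v) = -v → metric (dτ u) (dτ v) = metric u v
  /-- the element of `𝔥` with `ad Y = J` on `𝔪`, where `J` is the complex structure -/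
  Y : 𝔤
  J_sq : ∀ u : 𝔤, dτ (dτ u) = -u → toMatrixLieGroup.lie Y (toMatrixLieGroup.lie Y u) = -u
  J_Ad : ∀ h ∈ H, ∀ u : 𝔤, dτ (dτ u) = -u →
    toMatrixLieGroup.Ad h (toMatrixLieGroup.lie Y u) =
      toMatrixLieGroup.lie Y (toMatrixLieGroup.Ad h u)
  /-- the `(-1)`-eigenspace of `τ` in `𝔤` is the line `ℝ Y` -/
  eigen_two : ∀ X : 𝔤, dτ X = -X ↔ ∃ c : ℝ, X = c • Y
  /-- `M` has real dimension four -/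
  finrank_𝔪 : Module.finrank ℝ
    (LinearMap.ker ((dτ : 𝔤 →ₗ[ℝ] 𝔤) ∘ₗ (dτ : 𝔤 →ₗ[ℝ] 𝔤) + LinearMap.id)) = 4

namespace HermitianSymmetricSpace

variable {n : Type*} [Fintype n] [DecidableEq n] (S : HermitianSymmetricSpace n)

/-- The complex structure `J = ad Y` of `𝔪`. -/
def J (u : S.𝔤) : S.𝔤 := S.lie S.Y u

/-- The Kähler form `ω (u, v) = ⟨J u, v⟩` on `𝔪`. -/
def kahler (u v : S.𝔤) : ℝ := S.metric (S.J u) v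

/-- Multiplication of vectors of `𝔪` by complex numbers, `(x + i y) u = x u + y J u`. -/
def complexSmul (c : ℂ) (u : S.𝔤) : S.𝔤 := c.re • u + c.im • S.J u

/-- The projection of `𝔤 = 𝔥 ⊕ 𝔪` onto the `(-1)`-eigenspace `𝔪` of `σ`. -/
def mPart : S.𝔤 →ₗ[ℝ] S.𝔤 :=
  (1 / 2 : ℝ) • (LinearMap.id - (S.dτ : S.𝔤 →ₗ[ℝ] S.𝔤) ∘ₗ (S.dτ : S.𝔤 →ₗ[ℝ] S.𝔤))

/-- A unitary frame `(ε₁, ε₂)` of `𝔪` adapted to `τ`, i.e. with `τ ε₁ = -ε₂` (equivalently,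
`ε₁ - i ε₂` lies in the `i⁻¹`-eigenspace of `τ`). -/
def IsUnitaryFrame (ε : Fin 2 → S.𝔤) : Prop :=
  (∀ j, S.dτ (S.dτ (ε j)) = -ε j) ∧
  (∀ j k, S.metric (ε j) (ε k) = if j = k then 1 else 0) ∧
  (∀ j k, S.kahler (ε j) (ε k) = 0) ∧
  S.dτ (ε 0) = -ε 1

/-! ### Maps into `M = G/H`, described through their lifts to `G` -/

open Classical in
/-- The element of `𝔤` given by a matrix `X` (by convention `0` if `X` is not in `𝔤`). -/
def toLie (X : Matrix n n ℂ) : S.𝔤 := if h : X ∈ S.𝔤 then ⟨X, h⟩ else 0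

/-- The left Maurer–Cartan form `F⁻¹ dF` of a smooth map `F` into `G`, at the point `z` and the
tangent vector `v`. -/
def maurerCartan (F : ℂ → S.G) (z v : ℂ) : S.𝔤 :=
  S.toLie (S.mat (F z)⁻¹ * fderiv ℝ (fun w => S.mat (F w)) z v)

/-- If `F` is a lift of `f`, then `df_z v`, a tangent vector of `M` at `f z = F z · p₀`, corresponds
to the `𝔪`-part of `F⁻¹ dF` under the identification of `𝔪` with the tangent space at `F z · p₀`
given by the action of `F z`. This identification is isometric and complex linear. -/
def tangent (F : ℂ → S.G) (z v : ℂ) : S.𝔤 := S.mPart (S.maurerCartan F z v)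

/-- `F` is a smooth lift to `G` of the map `f` into `M = G/H`, over the open set `V`. -/
def IsLift (F : ℂ → S.G) (f : ℂ → S.G ⧸ S.H) (V : Set ℂ) : Prop :=
  ContDiffOn ℝ ∞ (fun z => S.mat (F z)) V ∧ ∀ z ∈ V, (F z : S.G ⧸ S.H) = f z

/-- `f` is smooth on `U`: it has smooth lifts locally. -/
def IsSmooth (f : ℂ → S.G ⧸ S.H) (U : Set ℂ) : Prop :=
  ∀ z ∈ U, ∃ V ⊆ U, IsOpen V ∧ z ∈ V ∧ ∃ F, S.IsLift F f V

/-- `f` is weakly conformal: `|f_x| = |f_y|` and `⟨f_x, f_y⟩ = 0`. The differential may vanish. -/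
def IsWeaklyConformal (f : ℂ → S.G ⧸ S.H) (U : Set ℂ) : Prop :=
  ∀ V ⊆ U, IsOpen V → ∀ F, S.IsLift F f V → ∀ z ∈ V,
    S.metric (S.tangent F z 1) (S.tangent F z 1) =
      S.metric (S.tangent F z Complex.I) (S.tangent F z Complex.I) ∧
    S.metric (S.tangent F z 1) (S.tangent F z Complex.I) = 0

/-- `f` is Lagrangian: the pull-back of the Kähler form by `f` vanishes. -/
def IsLagrangian (f : ℂ → S.G ⧸ S.H) (U : Set ℂ) : Prop :=
  ∀ V ⊆ U, IsOpen V → ∀ F, S.IsLift F f V → ∀ z ∈ V, ∀ v w : ℂ,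
    S.kahler (S.tangent F z v) (S.tangent F z w) = 0

/-- `f` is a smooth weakly conformal Lagrangian map. -/
def IsConformalLagrangian (f : ℂ → S.G ⧸ S.H) (U : Set ℂ) : Prop :=
  S.IsSmooth f U ∧ S.IsWeaklyConformal f U ∧ S.IsLagrangian f U

/-- The set of points of `U` at which `f` is an immersion. -/
def immersedSet (f : ℂ → S.G ⧸ S.H) (U : Set ℂ) : Set ℂ :=
  {z | ∃ V ⊆ U, IsOpen V ∧ z ∈ V ∧ ∃ F, S.IsLift F f V ∧ Function.Injective (S.tangent F z)}

/-- `F` is a Lagrangian lift of the (weakly conformal Lagrangian) map `f`: at each point the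
orthogonal frame `(f_x, f_y)` is `r ≥ 0` times the image under an element of `SU(2)` of the unitary
frame `(ε₁, ε₂)` transported by `F`. Where `f` is an immersion, `r > 0`, and this says that the frame
of `F` is equivalent modulo `SU(2)` to the oriented orthonormal basis `(f_x / r, f_y / r)`. -/
def IsLagrangianLift (ε : Fin 2 → S.𝔤) (F : ℂ → S.G) (f : ℂ → S.G ⧸ S.H) (U : Set ℂ) : Prop :=
  S.IsLift F f U ∧ ∀ z ∈ U, ∃ r : ℝ, 0 ≤ r ∧
    ∃ A ∈ Matrix.specialUnitaryGroup (Fin 2) ℂ,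
      S.tangent F z 1 = r • ∑ i, S.complexSmul (A i 0) (ε i) ∧
      S.tangent F z Complex.I = r • ∑ i, S.complexSmul (A i 1) (ε i)

/-- The 1-form `α` with values in `𝔤` is smooth on `U`. -/
def IsSmoothForm (α : ℂ → ℂ →ₗ[ℝ] S.𝔤) (U : Set ℂ) : Prop :=
  ∀ v, ContDiffOn ℝ ∞ (fun z => (α z v : Matrix n n ℂ)) U

/-- `α = F⁻¹ dF` on `U`. -/
def IsMaurerCartanForm (α : ℂ → ℂ →ₗ[ℝ] S.𝔤) (F : ℂ → S.G) (U : Set ℂ) : Prop :=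
  ∀ z ∈ U, ∀ v, (α z v : Matrix n n ℂ) =
    S.mat (F z)⁻¹ * fderiv ℝ (fun w => S.mat (F w)) z v

/-! ### Area, minimal and Hamiltonian stationary surfaces -/

/-- The density `√(|f_x|² |f_y|² - ⟨f_x, f_y⟩²)` of the area of the map with lift `F`. -/
def areaDensity (F : ℂ → S.G) (z : ℂ) : ℝ :=
  √(S.metric (S.tangent F z 1) (S.tangent F z 1) *
      S.metric (S.tangent F z Complex.I) (S.tangent F z Complex.I) -
    S.metric (S.tangent F z 1) (S.tangent F z Complex.I) ^ 2)

/-- The area of the restriction to `K` of the map with lift `F`. -/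
def area (F : ℂ → S.G) (K : Set ℂ) : ℝ := ∫ z in K, S.areaDensity F z

/-- A smooth variation `f_t`, `t ∈ ℝ`, of `f_0 = f` on `U` with `f_t = f` outside of `K`, given
by a smooth family `Φ_t` of lifts of the maps `f_t` (such lifts exist for every variation when `U`
is contractible). -/
def IsVariation (f : ℂ → S.G ⧸ S.H) (U K : Set ℂ) (Φ : ℝ → ℂ → S.G) : Prop :=
  ContDiffOn ℝ ∞ (fun p : ℝ × ℂ => S.mat (Φ p.1 p.2)) (Set.univ ×ˢ U) ∧
  (∀ z ∈ U, (Φ 0 z : S.G ⧸ S.H) = f z) ∧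
  ∀ t, ∀ z ∈ U \ K, (Φ t z : S.G ⧸ S.H) = f z

/-- The variation field `∂f_t/∂t` at `t = 0`, as an element of `𝔪` (through the lift `Φ_0`). -/
def variationField (Φ : ℝ → ℂ → S.G) (z : ℂ) : S.𝔤 :=
  S.mPart (S.toLie (S.mat (Φ 0 z)⁻¹ * deriv (fun t => S.mat (Φ t z)) 0))

/-- The variation field `V` is Hamiltonian: `ω (V, df) = dη` for a compactly supported smooth
function `η`. -/
def IsHamiltonianVariation (U : Set ℂ) (Φ : ℝ → ℂ → S.G) : Prop :=
  ∃ η : ℂ → ℝ, ContDiffOn ℝ ∞ η U ∧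
    (∃ K' ⊆ U, IsCompact K' ∧ ∀ z ∈ U \ K', η z = 0) ∧
    ∀ z ∈ U, ∀ v, S.kahler (S.variationField Φ z) (S.tangent (Φ 0) z v) = fderiv ℝ η z v

/-- `f` is Hamiltonian stationary: the area is critical at `f` for all Hamiltonian variations
supported in a compact set of points at which `f` is an immersion. -/
def IsHamiltonianStationary (f : ℂ → S.G ⧸ S.H) (U : Set ℂ) : Prop :=
  ∀ K ⊆ S.immersedSet f U, IsCompact K → ∀ Φ : ℝ → ℂ → S.G, S.IsVariation f U K Φ →
    S.IsHamiltonianVariation U Φ → HasDerivAt (fun t => S.area (Φ t) K) 0 0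

/-- `f` is minimal: the area is critical at `f` for all variations supported in a compact set of
points at which `f` is an immersion. -/
def IsMinimal (f : ℂ → S.G ⧸ S.H) (U : Set ℂ) : Prop :=
  ∀ K ⊆ S.immersedSet f U, IsCompact K → ∀ Φ : ℝ → ℂ → S.G, S.IsVariation f U K Φ →
    HasDerivAt (fun t => S.area (Φ t) K) 0 0

/-! ### Forms with values in `𝔤 ⊗ ℂ = 𝔤 ⊕ i 𝔤` -/

/-- The inclusion of `𝔤` into its complexification. -/
def incl : S.𝔤 →ₗ[ℝ] Matrix n n ℂ := S.𝔤.subtype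

/-- The component of an element of `𝔤` in the eigenspace of the complexification of `τ` for the
eigenvalue `i ^ a`. -/
def eigenPart (a : ℤ) : S.𝔤 →ₗ[ℝ] Matrix n n ℂ :=
  (1 / 4 : ℂ) • ∑ k ∈ Finset.range 4,
    (Complex.I ^ (-(a * k)) : ℂ) • (S.incl ∘ₗ ((S.dτ : S.𝔤 →ₗ[ℝ] S.𝔤) ^ k))

/-- A `𝔤`-valued 1-form as a 1-form with values in the complexification. -/
def complexForm (α : ℂ → ℂ →ₗ[ℝ] S.𝔤) (z : ℂ) : ℂ →ₗ[ℝ] Matrix n n ℂ :=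
  S.incl ∘ₗ α z

/-- The component `α_a` of `α` for the eigenvalue `i ^ a` of `τ`. -/
def component (a : ℤ) (α : ℂ → ℂ →ₗ[ℝ] S.𝔤) (z : ℂ) : ℂ →ₗ[ℝ] Matrix n n ℂ :=
  S.eigenPart a ∘ₗ α z

end HermitianSymmetricSpace

/-- Multiplication of tangent vectors of `ℂ` by `i`. -/
def mulI : ℂ →ₗ[ℝ] ℂ := LinearMap.mulLeft ℝ Complex.I

section Forms

variable {n : Type*} [Fintype n] [DecidableEq n]

/-- The `(1,0)`-part `φ'` of a complex 1-form. -/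
def formPart10 (φ : ℂ → ℂ →ₗ[ℝ] Matrix n n ℂ) (z : ℂ) : ℂ →ₗ[ℝ] Matrix n n ℂ :=
  (1 / 2 : ℂ) • (φ z - Complex.I • φ z ∘ₗ mulI)

/-- The `(0,1)`-part `φ''` of a complex 1-form. -/
def formPart01 (φ : ℂ → ℂ →ₗ[ℝ] Matrix n n ℂ) (z : ℂ) : ℂ →ₗ[ℝ] Matrix n n ℂ :=
  (1 / 2 : ℂ) • (φ z + Complex.I • φ z ∘ₗ mulI)

/-- `dφ + ½ [φ ∧ φ] = 0` on `U`, where `dφ (v, w) = (D_v φ) w - (D_w φ) v` and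
`½ [φ ∧ φ] (v, w) = [φ v, φ w]`. -/
def IsFlatOn (φ : ℂ → ℂ →ₗ[ℝ] Matrix n n ℂ) (U : Set ℂ) : Prop :=
  ∀ z ∈ U, ∀ v w : ℂ,
    fderiv ℝ (fun p => φ p w) z v - fderiv ℝ (fun p => φ p v) z w +
       (φ z v * φ z w - φ z w * φ z v) = 0

end Forms

namespace HermitianSymmetricSpace

variable {n : Type*} [Fintype n] [DecidableEq n] (S : HermitianSymmetricSpace n)

/-- Partial primitivity: `α''₋₁ = 0` and `α'₁ = 0`. -/
def IsPartiallyPrimitive (α : ℂ → ℂ →ₗ[ℝ] S.𝔤) (U : Set ℂ) : Prop :=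
  ∀ z ∈ U, formPart01 (S.component (-1) α) z = 0 ∧ formPart10 (S.component 1 α) z = 0

/-- The extended Maurer–Cartan form
`α_lam = lam⁻² α'₂ + lam⁻¹ α'₋₁ + α₀ + lam α''₁ + lam² α''₂`. -/
def extendedForm (α : ℂ → ℂ →ₗ[ℝ] S.𝔤) (lam : ℂ) (z : ℂ) : ℂ →ₗ[ℝ] Matrix n n ℂ :=
  lam ^ (-2 : ℤ) • formPart10 (S.component 2 α) z +
  lam ^ (-1 : ℤ) • formPart10 (S.component (-1) α) z +
  S.component 0 α z +
  lam • formPart01 (S.component 1 α) z +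
  lam ^ 2 • formPart01 (S.component 2 α) z

end HermitianSymmetricSpace

end

/-! Write A and B for the 𝔪-components of α(∂/∂x) and α(∂/∂y). On 𝔪, τ is an isometry with τ² = -1,
and it anticommutes with J = ad Y because τY = -Y. Thus J and τ form a quaternionic structure, and
the nonnegative multiples of elements of SU(2) carry the frame (ε₁, ε₂) exactly to the pairs (A,
-τA) (`exists_specialUnitary_iff`). Partial primitivity is the same real equation B = -τA, since its
two halves are conjugate (`partiallyPrimitive_iff`). Such a pair is automatically conformal and
Lagrangian, because ⟨A, τA⟩ = ⟨JA, τA⟩ = 0. The characterisation of lifts thereby reduces to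
integrating a flat 𝔤-valued form to a map into G (`exists_hasLogDerivAt`): radial differential
equations give local primitives, a Grönwall estimate keeps them in G, and a covering space glues
them.

For the extended form, write α₂ = θ Y with a real form θ = p dx + q dy. Elements fixed by τ commute
with Y, and [A, τA] is fixed by τ; hence flatness of α contains dθ = 0. For λ = e^{it} the form α_λ
arises from α by replacing A with cos t A + sin t τA and turning θ through the angle 2t. Its
curvature is therefore a multiple of (div θ) Y, with a factor that vanishes only when λ⁴ = 1
(`extendedForm_curvature`). Flatness for all unit λ, or for all nonzero λ, means div θ = 0.

For the area, the 𝔪-part of the structure equations identifies the mean curvature with a multiple of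
p JA + q JB (`meanCurvature_eq`), so the first variation along V is -2 ∫ (p⟨JA, V⟩ + q⟨JB, V⟩). If V
is Hamiltonian with function η, then ⟨JA, V⟩ = -η_x and ⟨JB, V⟩ = -η_y, and integration by parts
gives -2 ∫ η div θ. Testing on the immersed set and passing to its closure shows that minimality is
θ = 0 and Hamiltonian stationarity is div θ = 0. -/

noncomputable section

/-! ### Closed matrix groups -/

/-- A curve in a Banach algebra whose logarithmic derivative is tangent to the multiplicatively
closed set `Γ` stays in the closure of `Γ`. -/
theorem mem_closure_of_logDeriv_tangent {A : Type*} [NormedRing A] [NormedAlgebra ℝ A]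
    {Γ : Set A} (hmul : ∀ g ∈ Γ, ∀ h ∈ Γ, g * h ∈ Γ) {γ X : ℝ → A} {T K : ℝ}
    (hγ : ContinuousOn γ (Set.Icc 0 T))
    (hγ' : ∀ t ∈ Set.Ico 0 T, HasDerivWithinAt γ (γ t * X t) (Set.Ici t) t)
    (h0 : γ 0 ∈ Γ) (hK : ∀ t ∈ Set.Ico 0 T, ‖X t‖ ≤ K)
    (hX : ∀ t ∈ Set.Ico 0 T, ∃ c : ℝ → A, (∀ s, c s ∈ Γ) ∧ c 0 = 1 ∧ HasDerivAt c (X t) 0) :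
    ∀ t ∈ Set.Icc 0 T, γ t ∈ closure Γ := by
  have hne : Γ.Nonempty := ⟨_, h0⟩
  -- The distance d from γ to Γ has d(0) = 0 and right derivative at most ‖X‖ d, so Grönwall forces
  -- d = 0. To first order γ(z) is γ(t) c(z - t), and right multiplication by c(z - t) ∈ Γ preserves
  -- Γ.
  have key := le_gronwallBound_of_liminf_deriv_right_le (f := fun t => Metric.infDist (γ t) Γ)
    (f' := fun t => ‖X t‖ * Metric.infDist (γ t) Γ) (δ := 0) (K := K) (ε := 0) (a := 0) (b := T)
    ((Metric.continuous_infDist_pt Γ).comp_continuousOn hγ) ?_ ?_ ?_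
  · intro t ht
    have := key t ht
    simp only [sub_zero, gronwallBound_ε0_δ0] at this
    rw [Metric.mem_closure_iff_infDist_zero hne]
    exact le_antisymm this Metric.infDist_nonneg
  · intro t ht r hr
    obtain ⟨c, hcΓ, hc0, hc⟩ := hX t ht
    apply Filter.Eventually.frequently
    have hc' : HasDerivAt (fun z => c (z - t)) (X t) t := by
      have := HasDerivAt.scomp t (h := fun z : ℝ => z - t) (h' := 1) (g₁ := c) (g₁' := X t)
        (by simpa using hc) ((hasDerivAt_id t).sub_const t)
      simpa [Function.comp_def] using this
    have h1 : Filter.Tendsto (fun z => ‖slope (fun z => γ z - γ t * c (z - t)) t z‖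
        + Metric.infDist (γ t) Γ * ‖slope (fun z => c (z - t)) t z‖) (𝓝[>] t)
        (𝓝 (‖(0 : A)‖ + Metric.infDist (γ t) Γ * ‖X t‖)) := by
      refine Filter.Tendsto.add (Filter.Tendsto.norm ?_)
        (Filter.Tendsto.const_mul _ (Filter.Tendsto.norm ?_))
      · have h2 : HasDerivWithinAt (fun z => γ z - γ t * c (z - t)) 0 (Set.Ioi t) t := by
          have h3 : HasDerivWithinAt (fun z => γ t * c (z - t)) (γ t * X t) (Set.Ioi t) t :=
            (hc'.const_mul (γ t)).hasDerivWithinAt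
          exact (((hγ' t ht).mono Set.Ioi_subset_Ici_self).sub h3).congr_deriv (sub_self _)
        exact (hasDerivWithinAt_iff_tendsto_slope' (by simp)).1 h2
      · exact (hasDerivWithinAt_iff_tendsto_slope' (by simp)).1 hc'.hasDerivWithinAt
    have h2 := h1.eventually_lt_const (u := r) (by
      rw [norm_zero, zero_add, mul_comm]; exact hr)
    filter_upwards [h2, self_mem_nhdsWithin] with z hz hzt
    refine lt_of_le_of_lt ?_ hz
    have hpos : 0 < z - t := sub_pos.2 hzt
    have e1 : ‖slope (fun z => γ z - γ t * c (z - t)) t z‖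
        = (z - t)⁻¹ * ‖γ z - γ t * c (z - t)‖ := by
      simp [slope_def_module, norm_smul, hc0, abs_of_pos hpos]
    have e2 : ‖slope (fun z => c (z - t)) t z‖ = (z - t)⁻¹ * ‖c (z - t) - 1‖ := by
      simp [slope_def_module, norm_smul, hc0, abs_of_pos hpos]
    rw [e1, e2]
    have main : Metric.infDist (γ z) Γ - Metric.infDist (γ t) Γ ≤
        ‖γ z - γ t * c (z - t)‖ + Metric.infDist (γ t) Γ * ‖c (z - t) - 1‖ := by
      -- The infimum need not be attained: take g ∈ Γ at distance less than d, then let d decrease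
      -- to the infimum.
      have : ∀ d, Metric.infDist (γ t) Γ < d → Metric.infDist (γ z) Γ ≤
          ‖γ z - γ t * c (z - t)‖ + d * (1 + ‖c (z - t) - 1‖) := by
        intro d hd
        obtain ⟨g, hg, hgd⟩ := (Metric.infDist_lt_iff hne).1 hd
        rw [dist_eq_norm] at hgd
        refine (Metric.infDist_le_dist_of_mem (hmul g hg _ (hcΓ (z - t)))).trans ?_
        rw [dist_eq_norm]
        have e : γ z - g * c (z - t) = (γ z - γ t * c (z - t))
            + ((γ t - g) + (γ t - g) * (c (z - t) - 1)) := by noncomm_ring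
        rw [e]
        refine (norm_add_le _ _).trans (add_le_add_right ?_ _)
        refine (norm_add_le _ _).trans ?_
        have := norm_mul_le (γ t - g) (c (z - t) - 1)
        have h5 : ‖γ t - g‖ * ‖c (z - t) - 1‖ ≤ d * ‖c (z - t) - 1‖ :=
          mul_le_mul_of_nonneg_right hgd.le (norm_nonneg _)
        linarith
      have h6 : Metric.infDist (γ z) Γ ≤
          ‖γ z - γ t * c (z - t)‖ + Metric.infDist (γ t) Γ * (1 + ‖c (z - t) - 1‖) := by
        refine le_of_forall_pos_le_add fun e he => ?_
        have hp : 0 < 1 + ‖c (z - t) - 1‖ := by positivity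
        have := this (Metric.infDist (γ t) Γ + e / (1 + ‖c (z - t) - 1‖))
          (lt_add_of_pos_right _ (by positivity))
        rw [add_mul, div_mul_cancel₀ _ hp.ne'] at this
        linarith
      linarith
    calc (z - t)⁻¹ * (Metric.infDist (γ z) Γ - Metric.infDist (γ t) Γ)
        ≤ (z - t)⁻¹ * (‖γ z - γ t * c (z - t)‖ + Metric.infDist (γ t) Γ * ‖c (z - t) - 1‖) :=
          mul_le_mul_of_nonneg_left main (inv_nonneg.2 hpos.le)
      _ = _ := by ring
  · simp [Metric.infDist_zero_of_mem h0]
  · intro t ht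
    simpa using mul_le_mul_of_nonneg_right (hK t ht) Metric.infDist_nonneg

namespace MatrixLieGroup

variable {n : Type*} [Fintype n] [DecidableEq n] (L : MatrixLieGroup n)

/-- The set of matrices of the elements of `G`. -/
def range : Set (Matrix n n ℂ) := Set.range L.mat

@[simp] theorem mat_one : L.mat 1 = 1 := by simp [mat]

@[simp] theorem mat_mul (g h : L.G) : L.mat (g * h) = L.mat g * L.mat h := by simp [mat]

@[simp] theorem mat_mul_inv (g : L.G) : L.mat g * L.mat g⁻¹ = 1 := by
  rw [← mat_mul, mul_inv_cancel, mat_one]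

@[simp] theorem mat_inv_mul (g : L.G) : L.mat g⁻¹ * L.mat g = 1 := by
  rw [← mat_mul, inv_mul_cancel, mat_one]

theorem mat_injective : Function.Injective L.mat := fun _ _ h => Subtype.ext (Units.ext h)

/-- G is closed in GL only, so the limit has to be known to be invertible; the topology of GL is
induced by the inclusion of the units. -/
theorem mem_G_of_mem_closure (M : GL n ℂ) (hM : (M : Matrix n n ℂ) ∈ closure L.range) :
    M ∈ L.G := by
  have h1 : Topology.IsInducing (Units.val : GL n ℂ → Matrix n n ℂ) :=
    Units.isOpenEmbedding_val.isInducing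
  have h2 : L.range = Units.val '' (L.G : Set (GL n ℂ)) := by
    ext x; simp [range, mat]
  have h3 : M ∈ closure (L.G : Set (GL n ℂ)) := by
    rw [h1.closure_eq_preimage_closure_image, ← h2]; exact hM
  rwa [L.isClosed_G.closure_eq] at h3

theorem mul_mem_range : ∀ g ∈ L.range, ∀ h ∈ L.range, g * h ∈ L.range := by
  rintro _ ⟨g, rfl⟩ _ ⟨h, rfl⟩
  exact ⟨g * h, by simp⟩

theorem hasDerivAt_exp_smul (X : Matrix n n ℂ) (t : ℝ) :
    HasDerivAt (fun s : ℝ => NormedSpace.exp (s • X)) (NormedSpace.exp (t • X) * X) t :=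
  hasDerivAt_exp_smul_const X t

/-- The velocity at the identity of a curve in `G` lies in `𝔤`. -/
theorem mem_𝔤_of_hasDerivAt {c : ℝ → L.G} {X : Matrix n n ℂ} (h0 : c 0 = 1)
    (hc : HasDerivAt (fun t => L.mat (c t)) X 0) : X ∈ L.𝔤 := by
  have hpos : ∀ t : ℝ, 0 ≤ t → ∃ g ∈ L.G, (g : Matrix n n ℂ) = NormedSpace.exp (t • X) := by
    intro t ht
    have hu : IsUnit (NormedSpace.exp (t • X)) := Matrix.isUnit_exp _
    refine ⟨hu.unit, L.mem_G_of_mem_closure _ ?_, hu.unit_spec⟩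
    rw [hu.unit_spec]
    -- The curve s ↦ exp (s X) has constant logarithmic derivative X, and c itself is a curve in G
    -- with that velocity at every time.
    refine mem_closure_of_logDeriv_tangent (γ := fun s : ℝ => NormedSpace.exp (s • X))
      (X := fun _ => X) (K := ‖X‖) (T := t) L.mul_mem_range ?_ ?_ ?_ ?_ ?_ t ⟨ht, le_rfl⟩
    · exact fun s _ => (hasDerivAt_exp_smul X s).continuousAt.continuousWithinAt
    · exact fun s _ => (hasDerivAt_exp_smul X s).hasDerivWithinAt
    · exact ⟨1, by simp⟩
    · exact fun _ _ => le_rfl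
    · exact fun _ _ => ⟨_, fun s => ⟨c s, rfl⟩, by simp [h0], hc⟩
  rw [L.mem_𝔤]
  intro t
  rcases le_total 0 t with ht | ht
  · exact hpos t ht
  · obtain ⟨g, hg, e⟩ := hpos (-t) (by linarith)
    refine ⟨g⁻¹, L.G.inv_mem hg, ?_⟩
    rw [Matrix.coe_units_inv, e, ← Matrix.exp_neg]
    simp

/-- The exponential map `𝔤 → G`. -/
def expG (X : L.𝔤) : L.G :=
  ⟨((L.mem_𝔤 X).1 X.2 1).choose, ((L.mem_𝔤 X).1 X.2 1).choose_spec.1⟩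

@[simp] theorem mat_expG (X : L.𝔤) : L.mat (L.expG X) = NormedSpace.exp (X : Matrix n n ℂ) := by
  have := ((L.mem_𝔤 X).1 X.2 1).choose_spec.2
  exact this.trans (by rw [one_smul])

theorem expG_zero : L.expG 0 = 1 := L.mat_injective (by simp)

theorem hasDerivAt_mat_expG (X : L.𝔤) (t : ℝ) :
    HasDerivAt (fun s : ℝ => L.mat (L.expG (s • X))) (L.mat (L.expG (t • X)) * X) t := by
  simpa using hasDerivAt_exp_smul (X : Matrix n n ℂ) t

theorem hasDerivAt_mat_expG_zero (X : L.𝔤) :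
    HasDerivAt (fun s : ℝ => L.mat (L.expG (s • X))) (X : Matrix n n ℂ) 0 := by
  simpa [expG_zero] using L.hasDerivAt_mat_expG X 0

theorem inv_expG (X : L.𝔤) : (L.expG X)⁻¹ = L.expG (-X) := by
  refine inv_eq_of_mul_eq_one_right (L.mat_injective ?_)
  rw [mat_mul, mat_expG, mat_expG, mat_one, Submodule.coe_neg]
  have hinv : NormedSpace.exp (-(X : Matrix n n ℂ)) = (NormedSpace.exp (X : Matrix n n ℂ))⁻¹ :=
    Matrix.exp_neg _
  rw [hinv, Matrix.mul_nonsing_inv]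
  exact (Matrix.isUnit_iff_isUnit_det _).1 (Matrix.isUnit_exp _)

theorem expG_add_smul (X : L.𝔤) (s t : ℝ) :
    L.expG ((s + t) • X) = L.expG (s • X) * L.expG (t • X) := by
  refine L.mat_injective ?_
  rw [mat_mul, mat_expG, mat_expG, mat_expG, add_smul, Submodule.coe_add,
    Matrix.exp_add_of_commute]
  simp only [Submodule.coe_smul]
  exact ((Commute.refl (X : Matrix n n ℂ)).smul_left s).smul_right t

/-- A one-parameter group with velocity `X` is `exp (t X)`. -/
theorem eq_expG_of_hasDerivAt {c : ℝ → L.G} {X : L.𝔤} (hadd : ∀ s t, c (s + t) = c s * c t)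
    (hc : HasDerivAt (fun t => L.mat (c t)) (X : Matrix n n ℂ) 0) (t : ℝ) :
    c t = L.expG (t • X) := by
  have hd : ∀ s, HasDerivAt (fun t => L.mat (c t)) (L.mat (c s) * X) s := by
    intro s
    have h1 : HasDerivAt (fun t => L.mat (c s) * L.mat (c (t - s))) (L.mat (c s) * X) s := by
      refine HasDerivAt.const_mul _ ?_
      have := HasDerivAt.scomp s (h := fun z : ℝ => z - s) (h' := 1)
        (g₁ := fun t => L.mat (c t)) (g₁' := (X : Matrix n n ℂ))
        (by rw [sub_self s]; exact hc) ((hasDerivAt_id s).sub_const s)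
      simpa [Function.comp_def] using this
    refine h1.congr_of_eventuallyEq (Filter.Eventually.of_forall fun t => ?_)
    simp only [← mat_mul, ← hadd]
    congr 2; ring
  -- Uniqueness is obtained by checking that c(t) exp(-tX) has zero derivative.
  have hq : ∀ s, HasDerivAt (fun t => L.mat (c t) * L.mat (L.expG (t • -X))) 0 s := by
    intro s
    have := (hd s).mul (L.hasDerivAt_mat_expG (-X) s)
    refine this.congr_deriv ?_
    have hcomm : (X : Matrix n n ℂ) * L.mat (L.expG (s • -X))
        = L.mat (L.expG (s • -X)) * (X : Matrix n n ℂ) := by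
      rw [mat_expG]
      refine (Commute.exp_right ?_).eq
      simp only [Submodule.coe_smul, Submodule.coe_neg]
      exact ((Commute.refl (X : Matrix n n ℂ)).neg_right).smul_right s
    rw [mul_assoc, hcomm]
    simp
  have hconst := is_const_of_deriv_eq_zero (fun s => (hq s).differentiableAt)
    (fun s => (hq s).deriv) t 0
  have hc0 : c 0 = 1 := by
    have := hadd 0 0
    simpa using this
  simp only [zero_smul, expG_zero, hc0, mat_one, mul_one, ← mat_mul] at hconst
  have := L.mat_injective (hconst.trans L.mat_one.symm)
  rw [smul_neg, ← inv_expG, mul_inv_eq_one] at this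
  exact this

theorem inv_mul_fderiv_mem {E : Type*} [NormedAddCommGroup E] [NormedSpace ℝ E] {F : E → L.G}
    {z : E} (hF : DifferentiableAt ℝ (fun w => L.mat (F w)) z) (v : E) :
    L.mat (F z)⁻¹ * fderiv ℝ (fun w => L.mat (F w)) z v ∈ L.𝔤 := by
  refine L.mem_𝔤_of_hasDerivAt (c := fun t => (F z)⁻¹ * F (z + t • v)) (by simp) ?_
  simp only [mat_mul]
  refine HasDerivAt.const_mul _ ?_
  have h1 : HasDerivAt (fun t : ℝ => z + t • v) v 0 := by
    simpa using ((hasDerivAt_id (0 : ℝ)).smul_const v).const_add z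
  exact HasFDerivAt.comp_hasDerivAt (0 : ℝ) (f := fun t : ℝ => z + t • v)
    (l := fun w => L.mat (F w)) (by rw [zero_smul, add_zero]; exact hF.hasFDerivAt) h1

end MatrixLieGroup

/-! ### The Lie algebra of G, its bracket and the adjoint action. -/

namespace MatrixLieGroup

variable {n : Type*} [Fintype n] [DecidableEq n] (L : MatrixLieGroup n)

/-- A linear projection of the space of matrices onto `𝔤`. -/
def proj : Matrix n n ℂ →L[ℝ] L.𝔤 :=
  LinearMap.toContinuousLinearMap
    (LinearMap.exists_leftInverse_of_injective L.𝔤.subtype L.𝔤.ker_subtype).choose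

@[simp] theorem proj_coe (X : L.𝔤) : L.proj (X : Matrix n n ℂ) = X :=
  LinearMap.congr_fun
    (LinearMap.exists_leftInverse_of_injective L.𝔤.subtype L.𝔤.ker_subtype).choose_spec X

theorem coe_proj {X : Matrix n n ℂ} (hX : X ∈ L.𝔤) : (L.proj X : Matrix n n ℂ) = X :=
  congrArg Subtype.val (L.proj_coe ⟨X, hX⟩)

theorem hasDerivAt_of_coe {c : ℝ → L.𝔤} {X : L.𝔤} {t : ℝ}
    (h : HasDerivAt (fun s => (c s : Matrix n n ℂ)) (X : Matrix n n ℂ) t) : HasDerivAt c X t := by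
  have h1 : HasDerivAt (fun s => L.proj (c s : Matrix n n ℂ)) (L.proj (X : Matrix n n ℂ)) t :=
    L.proj.hasFDerivAt.comp_hasDerivAt t h
  exact (h1.congr_of_eventuallyEq
    (Filter.Eventually.of_forall fun s => (L.proj_coe (c s)).symm)).congr_deriv (L.proj_coe X)

theorem contDiffOn_of_coe {E : Type*} [NormedAddCommGroup E] [NormedSpace ℝ E] {c : E → L.𝔤}
    {s : Set E} (h : ContDiffOn ℝ ∞ (fun x => (c x : Matrix n n ℂ)) s) : ContDiffOn ℝ ∞ c s := by
  have h1 : ContDiffOn ℝ ∞ (fun x => L.proj (c x : Matrix n n ℂ)) s :=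
    L.proj.contDiff.comp_contDiffOn h
  exact h1.congr fun x _ => (L.proj_coe (c x)).symm

/-- The Lie bracket as a bilinear map. -/
def lieB : L.𝔤 →ₗ[ℝ] L.𝔤 →ₗ[ℝ] L.𝔤 :=
  LinearMap.mk₂ ℝ L.lie
    (fun X Y Z => Subtype.ext (by simp [lie]; noncomm_ring))
    (fun c X Y => Subtype.ext (by simp [lie, smul_sub]))
    (fun X Y Z => Subtype.ext (by simp [lie]; noncomm_ring))
    (fun c X Y => Subtype.ext (by simp [lie, smul_sub]))

theorem lie_coe (X Y : L.𝔤) : (L.lieB X Y : Matrix n n ℂ) = X * Y - Y * X := rfl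

theorem lieB_skew (X Y : L.𝔤) : L.lieB X Y = -L.lieB Y X :=
  Subtype.ext (by simp [lie_coe])

theorem lieB_jacobi (X Y Z : L.𝔤) :
    L.lieB (L.lieB X Y) Z = L.lieB X (L.lieB Y Z) - L.lieB Y (L.lieB X Z) :=
  Subtype.ext (by simp only [lie_coe, Submodule.coe_sub]; noncomm_ring)

/-- The adjoint action of an element of `G` as a linear map. -/
def AdL (g : L.G) : L.𝔤 →ₗ[ℝ] L.𝔤 where
  toFun := L.Ad g
  map_add' X Y := Subtype.ext (by simp [Ad, mul_add, add_mul])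
  map_smul' c X := Subtype.ext (by simp [Ad])

theorem Ad_coe (g : L.G) (X : L.𝔤) :
    (L.AdL g X : Matrix n n ℂ) = L.mat g * X * L.mat g⁻¹ := rfl

theorem Ad_mul (g h : L.G) (X : L.𝔤) : L.AdL (g * h) X = L.AdL g (L.AdL h X) :=
  Subtype.ext (by simp [Ad_coe, mul_assoc])

theorem Ad_one (X : L.𝔤) : L.AdL 1 X = X := Subtype.ext (by simp [Ad_coe])

theorem Ad_Ad_inv (g : L.G) (X : L.𝔤) : L.AdL g (L.AdL g⁻¹ X) = X := by
  rw [← Ad_mul, mul_inv_cancel, Ad_one]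

theorem hasDerivAt_conj (g : L.G) (X : L.𝔤) :
    HasDerivAt (fun t : ℝ => L.mat (g * L.expG (t • X) * g⁻¹)) (L.AdL g X : Matrix n n ℂ) 0 := by
  simp only [mat_mul]
  exact ((L.hasDerivAt_mat_expG_zero X).const_mul (L.mat g)).mul_const (L.mat g⁻¹)

/-- Differentiating group identities through this formula yields all the infinitesimal identities
used below. -/
theorem hasDerivAt_Ad_expG (Z X : L.𝔤) :
    HasDerivAt (fun s : ℝ => L.AdL (L.expG (s • Z)) X) (L.lieB Z X) 0 := by
  refine L.hasDerivAt_of_coe ?_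
  simp only [Ad_coe, inv_expG]
  have h1 := (L.hasDerivAt_mat_expG_zero Z).mul_const (X : Matrix n n ℂ)
  have h2 : HasDerivAt (fun s : ℝ => L.mat (L.expG (-(s • Z)))) (-Z : Matrix n n ℂ) 0 := by
    have := L.hasDerivAt_mat_expG_zero (-Z)
    simp only [smul_neg] at this
    exact this
  refine (h1.mul h2).congr_deriv ?_
  simp [expG_zero, lie_coe, sub_eq_add_neg]

theorem continuous_expG_smul (X : L.𝔤) : Continuous (fun t : ℝ => L.expG (t • X)) := by
  have h1 : Topology.IsInducing (Units.val : GL n ℂ → Matrix n n ℂ) :=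
    Units.isOpenEmbedding_val.isInducing
  refine Continuous.subtype_mk (f := fun t : ℝ => (L.expG (t • X) : GL n ℂ)) ?_ _
  rw [h1.continuous_iff]
  exact continuous_iff_continuousAt.2 fun t => (L.hasDerivAt_mat_expG X t).continuousAt

end MatrixLieGroup

namespace HermitianSymmetricSpace

variable {n : Type*} [Fintype n] [DecidableEq n] (S : HermitianSymmetricSpace n)

/-! ### The automorphism `τ` and the isotropy group -/

theorem τ_expG (X : S.𝔤) (t : ℝ) : S.τ (S.expG (t • X)) = S.expG (t • S.dτ X) := by
  refine S.eq_expG_of_hasDerivAt (c := fun t => S.τ (S.expG (t • X))) ?_ ?_ t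
  · intro s t
    rw [S.expG_add_smul, map_mul]
  · exact S.τ_deriv _ X (by simp [S.expG_zero]) (S.hasDerivAt_mat_expG_zero X)

theorem dτ_Ad (g : S.G) (X : S.𝔤) : S.dτ (S.AdL g X) = S.AdL (S.τ g) (S.dτ X) := by
  have h1 := S.τ_deriv _ (S.AdL g X) (by simp [S.expG_zero]) (S.hasDerivAt_conj g X)
  have h2 := S.hasDerivAt_conj (S.τ g) (S.dτ X)
  simp only [map_mul, map_inv, S.τ_expG] at h1
  exact Subtype.ext (h1.unique h2)

/-- That dτ respects brackets is a consequence of τ being a homomorphism: differentiate `dτ_Ad`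
along exp(sZ). -/
theorem dτ_lie (Z X : S.𝔤) : S.dτ (S.lieB Z X) = S.lieB (S.dτ Z) (S.dτ X) := by
  have h1 := (LinearMap.toContinuousLinearMap (S.dτ : S.𝔤 →ₗ[ℝ] S.𝔤)).hasFDerivAt.comp_hasDerivAt
    (0 : ℝ) (S.hasDerivAt_Ad_expG Z X)
  have h2 := S.hasDerivAt_Ad_expG (S.dτ Z) (S.dτ X)
  refine HasDerivAt.unique h1 ?_
  refine h2.congr_of_eventuallyEq (Filter.Eventually.of_forall fun s => ?_)
  change S.dτ _ = _
  rw [dτ_Ad, τ_expG]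

@[simp] theorem dτ_pow_four (X : S.𝔤) : S.dτ (S.dτ (S.dτ (S.dτ X))) = X := by
  have key : ∀ t : ℝ, S.expG (t • S.dτ (S.dτ (S.dτ (S.dτ X)))) = S.expG (t • X) := by
    intro t
    rw [← τ_expG, ← τ_expG, ← τ_expG, ← τ_expG, S.τ_order]
  have h1 := S.hasDerivAt_mat_expG_zero (S.dτ (S.dτ (S.dτ (S.dτ X))))
  simp only [key] at h1
  exact Subtype.ext (h1.unique (S.hasDerivAt_mat_expG_zero X))

/-- The one-parameter group is connected, contains 1 and is fixed by τ², so it lies in the identity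
component that H contains. -/
theorem expG_mem_H {X : S.𝔤} (hX : S.dτ (S.dτ X) = X) (t : ℝ) : S.expG (t • X) ∈ S.H := by
  refine S.le_H ?_
  have hc : IsPreconnected (Set.range fun t : ℝ => S.expG (t • X)) :=
    isPreconnected_range (S.continuous_expG_smul X)
  refine hc.subset_connectedComponentIn ⟨0, by simp [S.expG_zero]⟩ ?_ ⟨t, rfl⟩
  rintro _ ⟨s, rfl⟩
  change S.τ (S.τ _) = _
  rw [τ_expG, τ_expG, hX]

theorem dτ_sq_Ad {h : S.G} (hh : h ∈ S.H) (X : S.𝔤) :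
    S.dτ (S.dτ (S.AdL h X)) = S.AdL h (S.dτ (S.dτ X)) := by
  rw [dτ_Ad, dτ_Ad, S.H_le h hh]

/-- The inner product of `𝔪` as a continuous bilinear form. -/
def metricC : S.𝔤 →L[ℝ] S.𝔤 →L[ℝ] ℝ := S.metric.toContinuousBilinearMap

/-- Infinitesimal form of the Ad H-invariance of the metric: 𝔥 acts on 𝔪 by skew maps. -/
theorem metric_lie {X u v : S.𝔤} (hX : S.dτ (S.dτ X) = X) (hu : S.dτ (S.dτ u) = -u)
    (hv : S.dτ (S.dτ v) = -v) : S.metric (S.lieB X u) v + S.metric u (S.lieB X v) = 0 := by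
  have h1 := ContinuousLinearMap.hasDerivAt_of_bilinear (B := S.metricC)
    (u := fun s : ℝ => S.AdL (S.expG (s • X)) u) (v := fun s : ℝ => S.AdL (S.expG (s • X)) v)
    (fun _ => S.hasDerivAt_Ad_expG X u) (fun _ => S.hasDerivAt_Ad_expG X v)
  have h2 : HasDerivAt (fun s : ℝ => S.metricC (S.AdL (S.expG (s • X)) u)
      (S.AdL (S.expG (s • X)) v)) 0 0 := by
    refine (hasDerivAt_const (0 : ℝ) (S.metric u v)).congr_of_eventuallyEq
      (Filter.Eventually.of_forall fun s => ?_)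
    exact S.metric_Ad _ (S.expG_mem_H hX s) u v hu hv
  have := h1.unique h2
  simp only [zero_smul, S.expG_zero, S.Ad_one] at this
  rw [add_comm]
  exact this

theorem lie_J {X u : S.𝔤} (hX : S.dτ (S.dτ X) = X) (hu : S.dτ (S.dτ u) = -u) :
    S.lieB X (S.lieB S.Y u) = S.lieB S.Y (S.lieB X u) := by
  have h1 := (LinearMap.toContinuousLinearMap (S.lieB S.Y)).hasFDerivAt.comp_hasDerivAt
    (0 : ℝ) (S.hasDerivAt_Ad_expG X u)
  refine (S.hasDerivAt_Ad_expG X (S.lieB S.Y u)).unique ?_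
  refine HasDerivAt.congr_of_eventuallyEq h1 (Filter.Eventually.of_forall fun s => ?_)
  exact S.J_Ad _ (S.expG_mem_H hX s) u hu

@[simp] theorem dτ_Y : S.dτ S.Y = -S.Y := (S.eigen_two S.Y).2 ⟨1, by simp⟩

/-- Since τY = -Y, τ is J-antilinear on 𝔪. This is the source of the quaternionic structure. -/
theorem dτ_J (u : S.𝔤) : S.dτ (S.lieB S.Y u) = -S.lieB S.Y (S.dτ u) := by
  rw [dτ_lie, dτ_Y, map_neg, LinearMap.neg_apply]

theorem J_J {u : S.𝔤} (hu : S.dτ (S.dτ u) = -u) : S.lieB S.Y (S.lieB S.Y u) = -u := S.J_sq u hu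

theorem dτ_sq_J {u : S.𝔤} (hu : S.dτ (S.dτ u) = -u) :
    S.dτ (S.dτ (S.lieB S.Y u)) = -S.lieB S.Y u := by
  rw [dτ_J, map_neg, dτ_J, hu, map_neg, neg_neg]

theorem dτ_sq_dτ {u : S.𝔤} (hu : S.dτ (S.dτ u) = -u) : S.dτ (S.dτ (S.dτ u)) = -S.dτ u := by
  rw [hu, map_neg]

theorem dτ_sq_Y : S.dτ (S.dτ S.Y) = S.Y := by simp

theorem metric_J_left {u v : S.𝔤} (hu : S.dτ (S.dτ u) = -u) (hv : S.dτ (S.dτ v) = -v) :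
    S.metric (S.lieB S.Y u) v = -S.metric u (S.lieB S.Y v) := by
  linarith [S.metric_lie S.dτ_sq_Y hu hv]

theorem metric_J_J {u v : S.𝔤} (hu : S.dτ (S.dτ u) = -u) (hv : S.dτ (S.dτ v) = -v) :
    S.metric (S.lieB S.Y u) (S.lieB S.Y v) = S.metric u v := by
  rw [S.metric_J_left hu (S.dτ_sq_J hv), S.J_J hv, map_neg, neg_neg]

theorem metric_J_self {u : S.𝔤} (hu : S.dτ (S.dτ u) = -u) : S.metric (S.lieB S.Y u) u = 0 := by
  have h1 := S.metric_J_left hu hu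
  rw [S.metric_symm u _ hu (S.dτ_sq_J hu)] at h1
  linarith

/-- Invariance under τ and τ² = -1 give ⟨u, τu⟩ = ⟨τu, -u⟩, which is its own negative. -/
theorem metric_dτ_self {u : S.𝔤} (hu : S.dτ (S.dτ u) = -u) : S.metric u (S.dτ u) = 0 := by
  have h1 := S.metric_τ u (S.dτ u) hu (S.dτ_sq_dτ hu)
  rw [hu, map_neg, S.metric_symm (S.dτ u) u (S.dτ_sq_dτ hu) hu] at h1
  linarith

/-- Applying τ to both entries gives ⟨Ju, τu⟩ = ⟨Jτu, u⟩, and skewness of J turns this into -⟨Ju,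
τu⟩. -/
theorem metric_J_dτ_self {u : S.𝔤} (hu : S.dτ (S.dτ u) = -u) :
    S.metric (S.lieB S.Y u) (S.dτ u) = 0 := by
  have hu' := S.dτ_sq_dτ hu
  have h1 := S.metric_τ (S.lieB S.Y u) (S.dτ u) (S.dτ_sq_J hu) hu'
  rw [hu, S.dτ_J, map_neg, map_neg, LinearMap.neg_apply, neg_neg, S.metric_J_left hu' hu,
    S.metric_symm _ _ hu' (S.dτ_sq_J hu)] at h1
  linarith

/-- An element fixed by `τ` commutes with `Y`. -/
theorem lie_Y_eq_zero {u X : S.𝔤} (hu : S.dτ (S.dτ u) = -u) (hu0 : u ≠ 0) (hX : S.dτ X = X) :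
    S.lieB X S.Y = 0 := by
  have h1 : S.dτ (S.lieB X S.Y) = -S.lieB X S.Y := by rw [dτ_lie, hX, dτ_Y, map_neg]
  obtain ⟨c, hc⟩ := (S.eigen_two _).1 h1
  -- X commutes with J on 𝔪, so Jacobi with [X, Y] = cY leaves c Ju = 0; and Ju ≠ 0 because J² = -1.
  have h2 := S.lieB_jacobi X S.Y u
  rw [S.lie_J (by rw [hX, hX]) hu, sub_self, hc, map_smul, LinearMap.smul_apply] at h2
  rcases smul_eq_zero.1 h2 with h | h
  · rw [hc, h, zero_smul]
  · have := S.J_J hu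
    rw [h, map_zero] at this
    exact absurd (neg_eq_zero.1 this.symm) hu0

/-! ### The decomposition `𝔤 = 𝔥 ⊕ 𝔪` -/

theorem mPart_apply (X : S.𝔤) : S.mPart X = (1 / 2 : ℝ) • (X - S.dτ (S.dτ X)) := rfl

/-- The projection of `𝔤 = 𝔥 ⊕ 𝔪` onto `𝔥`. -/
def hPart : S.𝔤 →ₗ[ℝ] S.𝔤 := LinearMap.id - S.mPart

theorem hPart_apply (X : S.𝔤) : S.hPart X = X - S.mPart X := rfl

theorem hPart_add_mPart (X : S.𝔤) : S.hPart X + S.mPart X = X := by simp [hPart_apply]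

@[simp] theorem dτ_sq_mPart (X : S.𝔤) : S.dτ (S.dτ (S.mPart X)) = -S.mPart X := by
  simp only [mPart_apply, map_smul, map_sub, dτ_pow_four]
  module

@[simp] theorem dτ_sq_hPart (X : S.𝔤) : S.dτ (S.dτ (S.hPart X)) = S.hPart X := by
  simp only [hPart_apply, mPart_apply, map_smul, map_sub, dτ_pow_four]
  module

theorem mPart_of_neg {u : S.𝔤} (hu : S.dτ (S.dτ u) = -u) : S.mPart u = u := by
  rw [mPart_apply, hu]; module

theorem mPart_of_fixed {X : S.𝔤} (hX : S.dτ (S.dτ X) = X) : S.mPart X = 0 := by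
  rw [mPart_apply, hX, sub_self, smul_zero]

theorem mPart_Ad {h : S.G} (hh : h ∈ S.H) (X : S.𝔤) :
    S.mPart (S.AdL h X) = S.AdL h (S.mPart X) := by
  rw [mPart_apply, mPart_apply, S.dτ_sq_Ad hh, map_smul, map_sub]

theorem dτ_sq_lie_of_fixed {X u : S.𝔤} (hX : S.dτ (S.dτ X) = X) (hu : S.dτ (S.dτ u) = -u) :
    S.dτ (S.dτ (S.lieB X u)) = -S.lieB X u := by
  rw [dτ_lie, dτ_lie, hX, hu, map_neg]

/-- The grading [𝔥,𝔥] ⊂ 𝔥, [𝔪,𝔪] ⊂ 𝔥, [𝔥,𝔪] ⊂ 𝔪 leaves only the mixed brackets. -/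
theorem mPart_lie (X Z : S.𝔤) :
    S.mPart (S.lieB X Z) = S.lieB (S.hPart X) (S.mPart Z) + S.lieB (S.mPart X) (S.hPart Z) := by
  conv_lhs => rw [← S.hPart_add_mPart X, ← S.hPart_add_mPart Z]
  simp only [map_add, LinearMap.add_apply]
  rw [S.mPart_of_fixed (X := S.lieB (S.hPart X) (S.hPart Z)) (by simp [dτ_lie]),
    S.mPart_of_fixed (X := S.lieB (S.mPart X) (S.mPart Z)) (by simp [dτ_lie]),
    S.mPart_of_neg (u := S.lieB (S.hPart X) (S.mPart Z)) (by simp [dτ_lie]),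
    S.mPart_of_neg (u := S.lieB (S.mPart X) (S.hPart Z)) (by simp [dτ_lie])]
  abel

end HermitianSymmetricSpace

/-! ### Primitives of flat forms -/

section Primitive

variable {A : Type*} [NormedRing A] [NormedAlgebra ℝ A]

/-- Grönwall with unit rate gives c (e^t - 1), and e - 1 ≤ 2. -/
theorem norm_le_of_norm_deriv_le {D D' : ℝ → A} {c : ℝ} (hc : 0 ≤ c)
    (hD : ∀ t ∈ Set.Icc (0 : ℝ) 1, HasDerivWithinAt D (D' t) (Set.Icc 0 1) t) (h0 : D 0 = 0)
    (hb : ∀ t ∈ Set.Icc (0 : ℝ) 1, ‖D' t‖ ≤ ‖D t‖ + c) :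
    ∀ t ∈ Set.Icc (0 : ℝ) 1, ‖D t‖ ≤ 2 * c := by
  intro t ht
  have h1 := norm_le_gronwallBound_of_norm_deriv_right_le (f := D) (f' := D') (δ := 0) (K := 1)
    (ε := c) (a := 0) (b := 1) (fun s hs => (hD s hs).continuousWithinAt)
    (fun s hs => (hD s ⟨hs.1, hs.2.le⟩).mono_of_mem_nhdsWithin
      (Icc_mem_nhdsGE_of_mem hs))
    (by simp [h0]) (fun s hs => by simpa using hb s ⟨hs.1, hs.2.le⟩) t ht
  refine h1.trans ?_
  rw [gronwallBound_of_K_ne_0 one_ne_zero]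
  have h2 : Real.exp (1 * (t - 0)) ≤ 3 := by
    refine (Real.exp_le_exp.2 (by simpa using ht.2)).trans (Real.exp_one_lt_d9.le.trans (by norm_num))
  nlinarith

/-- Picard–Lindelöf on the unit ball around 1, where solutions have norm at most ‖1‖ + 1. The
smallness of k keeps the solution inside this ball up to time 1. -/
theorem exists_linear_ode_solution [CompleteSpace A] {β : ℝ → A} {k : ℝ} (hk : 0 ≤ k)
    (hβ : ContinuousOn β (Set.Icc 0 1)) (hb : ∀ t ∈ Set.Icc (0 : ℝ) 1, ‖β t‖ ≤ k)
    (hk1 : (‖(1 : A)‖ + 1) * k ≤ 1) :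
    ∃ G : ℝ → A, G 0 = 1 ∧
      ∀ t ∈ Set.Icc (0 : ℝ) 1, HasDerivWithinAt G (G t * β t) (Set.Icc 0 1) t := by
  have hpl : IsPicardLindelof (fun t (X : A) => X * β t) (tmin := 0) (tmax := 1)
      ⟨0, by simp⟩ (1 : A) 1 0 1 ⟨k, hk⟩ := by
    refine ⟨fun t ht => ?_, fun x _ => continuousOn_const.mul hβ, fun t ht x hx => ?_, by simp⟩
    · refine LipschitzOnWith.of_dist_le_mul fun x _ y _ => ?_
      rw [dist_eq_norm, dist_eq_norm, ← sub_mul, mul_comm]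
      exact (norm_mul_le _ _).trans ((mul_le_mul_of_nonneg_left (hb t ht) (norm_nonneg _)).trans
        (le_of_eq (mul_comm _ _)) |>.trans (le_of_eq (mul_comm _ _)))
    · have h1 : ‖x‖ ≤ ‖(1 : A)‖ + 1 := by
        have h2 : ‖x - 1‖ ≤ 1 := by simpa [dist_eq_norm] using hx
        have := norm_add_le (1 : A) (x - 1)
        rw [add_sub_cancel] at this
        linarith
      calc ‖x * β t‖ ≤ ‖x‖ * ‖β t‖ := norm_mul_le _ _
        _ ≤ (‖(1 : A)‖ + 1) * k := mul_le_mul h1 (hb t ht) (norm_nonneg _) (by positivity)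
        _ ≤ _ := by simpa using hk1
  exact hpl.exists_eq_forall_mem_Icc_hasDerivWithinAt₀

variable {E : Type*} [NormedAddCommGroup E] [NormedSpace ℝ E]

/-- A flat form on a small ball is the logarithmic derivative of a function. -/
theorem exists_primitive_on_ball [CompleteSpace A] {α : E → E →L[ℝ] A}
    {α' : E → E →L[ℝ] E →L[ℝ] A} {z₀ : E} {r K : ℝ} (hr : 0 < r) (hK0 : 0 ≤ K)
    (hα : ∀ z ∈ Metric.ball z₀ r, HasFDerivAt α (α' z) z)
    (hK : ∀ z ∈ Metric.ball z₀ r, ‖α z‖ ≤ K) (hK' : ∀ z ∈ Metric.ball z₀ r, ‖α' z‖ ≤ K)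
    (hK'' : ∀ z ∈ Metric.ball z₀ r, ∀ w ∈ Metric.ball z₀ r, ‖α' z - α' w‖ ≤ K * ‖z - w‖)
    (hflat : ∀ z ∈ Metric.ball z₀ r, ∀ v w,
      α' z v w - α' z w v + (α z v * α z w - α z w * α z v) = 0)
    (hrK : (‖(1 : A)‖ + 1) * (K * r) ≤ 1) :
    ∃ F : E → A, F z₀ = 1 ∧ ∀ z ∈ Metric.ball z₀ r,
      HasFDerivAt F ((ContinuousLinearMap.mul ℝ A (F z)).comp (α z)) z := by
  have hball : ∀ v : E, ‖v‖ < r → ∀ t ∈ Set.Icc (0 : ℝ) 1, z₀ + t • v ∈ Metric.ball z₀ r := by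
    intro v hv t ht
    rw [Metric.mem_ball, dist_eq_norm, add_sub_cancel_left, norm_smul, Real.norm_of_nonneg ht.1]
    exact lt_of_le_of_lt (mul_le_of_le_one_left (norm_nonneg _) ht.2) hv
  have hcurve : ∀ v : E, ∀ t : ℝ, HasDerivAt (fun t : ℝ => z₀ + t • v) v t := by
    intro v t
    simpa using ((hasDerivAt_id t).smul_const v).const_add z₀
  have hα1 : ∀ v : E, ‖v‖ < r → ∀ t ∈ Set.Icc (0 : ℝ) 1,
      HasDerivAt (fun t : ℝ => α (z₀ + t • v)) (α' (z₀ + t • v) v) t := by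
    intro v hv t ht
    exact (hα _ (hball v hv t ht)).comp_hasDerivAt t (hcurve v t)
  have hKr : K * r ≤ 1 := by
    have : 0 ≤ ‖(1 : A)‖ * (K * r) := by positivity
    linarith
  have hbound : ∀ v : E, ‖v‖ < r → ∀ t ∈ Set.Icc (0 : ℝ) 1, ‖α (z₀ + t • v) v‖ ≤ K * r := by
    intro v hv t ht
    exact ((α _).le_opNorm v).trans (mul_le_mul (hK _ (hball v hv t ht)) hv.le (norm_nonneg _) hK0)
  -- The primitive is built along rays: G v solves the equation along t ↦ z₀ + t v, and F(z₀ + v)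
  -- will be G v at time 1.
  have hex : ∀ v : E, ‖v‖ < r → ∃ G : ℝ → A, G 0 = 1 ∧ ∀ t ∈ Set.Icc (0 : ℝ) 1,
      HasDerivWithinAt G (G t * α (z₀ + t • v) v) (Set.Icc 0 1) t := by
    intro v hv
    refine exists_linear_ode_solution (k := K * r) (by positivity) ?_ (hbound v hv) hrK
    exact fun t ht => ((hα1 v hv t ht).continuousAt.clm_apply continuousAt_const).continuousWithinAt
  choose! G hG0 hG using hex
  have hGn : ∀ v : E, ‖v‖ < r → ∀ t ∈ Set.Icc (0 : ℝ) 1, ‖G v t‖ ≤ 3 * ‖(1 : A)‖ := by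
    intro v hv t ht
    have h1 := norm_le_of_norm_deriv_le (D := fun t => G v t - 1) (c := ‖(1 : A)‖)
      (norm_nonneg _) (fun t ht => (hG v hv t ht).sub_const 1) (by simp [hG0 v hv]) (by
        intro t ht
        have e : G v t * α (z₀ + t • v) v
            = (G v t - 1) * α (z₀ + t • v) v + 1 * α (z₀ + t • v) v := by noncomm_ring
        rw [e]
        have hb := (hbound v hv t ht).trans hKr
        refine (norm_add_le _ _).trans (add_le_add ?_ ?_) <;>
          exact (norm_mul_le _ _).trans (mul_le_of_le_one_right (norm_nonneg _) hb)) t ht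
    have := norm_add_le (G v t - 1) 1
    rw [sub_add_cancel] at this
    linarith
  set M := K * (r + 1) with hM
  have hM0 : 0 ≤ M := by positivity
  set C₀ := 3 * ‖(1 : A)‖ with hC₀
  have hC0 : 0 ≤ C₀ := by positivity
  have hconv : Convex ℝ (Metric.ball z₀ r) := convex_ball _ _
  -- Neighbouring rays are compared directly, up to an error quadratic in h. This gives the
  -- derivative of F without any smooth dependence of solutions on parameters.
  have hmain : ∀ v h : E, ‖v‖ < r → ‖v + h‖ < r →
      ‖G (v + h) 1 - G v 1 - G v 1 * α (z₀ + v) h‖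
        ≤ 2 * (C₀ * M + 2 * (C₀ * M) * M) * ‖h‖ ^ 2 := by
    intro v h hv hvh
    have hq : ∀ t : ℝ, z₀ + t • (v + h) = z₀ + t • v + t • h := by intro t; rw [smul_add, add_assoc]
    have hth : ∀ t ∈ Set.Icc (0 : ℝ) 1, ‖t • h‖ ≤ ‖h‖ := by
      intro t ht
      rw [norm_smul, Real.norm_of_nonneg ht.1]
      exact mul_le_of_le_one_left (norm_nonneg _) ht.2
    have e1 : ∀ t ∈ Set.Icc (0 : ℝ) 1, ‖α (z₀ + t • (v + h)) - α (z₀ + t • v)‖ ≤ K * ‖h‖ := by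
      intro t ht
      have := hconv.norm_image_sub_le_of_norm_hasFDerivWithin_le
        (fun z hz => (hα z hz).hasFDerivWithinAt) hK' (hball v hv t ht) (hball _ hvh t ht)
      refine this.trans (mul_le_mul_of_nonneg_left ?_ hK0)
      rw [hq, add_sub_cancel_left]
      exact hth t ht
    have e2 : ∀ t ∈ Set.Icc (0 : ℝ) 1, ‖α (z₀ + t • (v + h)) - α (z₀ + t • v)
        - α' (z₀ + t • v) (t • h)‖ ≤ K * ‖h‖ ^ 2 := by
      intro t ht
      have hseg := hconv.segment_subset (hball v hv t ht) (hball _ hvh t ht)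
      have := (convex_segment (𝕜 := ℝ) (z₀ + t • v) (z₀ + t • (v + h))).norm_image_sub_le_of_norm_hasFDerivWithin_le'
        (φ := α' (z₀ + t • v)) (C := K * ‖h‖)
        (fun z hz => (hα z (hseg hz)).hasFDerivWithinAt) (fun z hz => ?_)
        (left_mem_segment ℝ _ _) (right_mem_segment ℝ _ _)
      · rw [hq, add_sub_cancel_left] at this
        rw [hq]
        refine this.trans ?_
        rw [pow_two, ← mul_assoc]
        exact mul_le_mul_of_nonneg_left (hth t ht) (by positivity)
      · refine (hK'' z (hseg hz) _ (hball v hv t ht)).trans (mul_le_mul_of_nonneg_left ?_ hK0)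
        refine (norm_sub_le_of_mem_segment hz).trans ?_
        rw [hq, add_sub_cancel_left]
        exact hth t ht
    have hE : ∀ t ∈ Set.Icc (0 : ℝ) 1, ‖G (v + h) t - G v t‖ ≤ 2 * (C₀ * (M * ‖h‖)) := by
      refine norm_le_of_norm_deriv_le (by positivity)
        (fun t ht => (hG _ hvh t ht).sub (hG v hv t ht)) (by simp [hG0 v hv, hG0 _ hvh]) ?_
      intro t ht
      have e : G (v + h) t * α (z₀ + t • (v + h)) (v + h) - G v t * α (z₀ + t • v) v
          = (G (v + h) t - G v t) * α (z₀ + t • (v + h)) (v + h)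
            + G v t * ((α (z₀ + t • (v + h)) - α (z₀ + t • v)) v + α (z₀ + t • (v + h)) h) := by
        simp only [map_add, _root_.sub_apply]; noncomm_ring
      rw [e]
      refine (norm_add_le _ _).trans (add_le_add ?_ ?_)
      · exact (norm_mul_le _ _).trans (mul_le_of_le_one_right (norm_nonneg _)
          ((hbound _ hvh t ht).trans hKr))
      · refine (norm_mul_le _ _).trans (mul_le_mul (hGn v hv t ht) ?_ (norm_nonneg _) hC0)
        have i1 := ((α (z₀ + t • (v + h)) - α (z₀ + t • v)).le_opNorm v).trans
          (mul_le_mul (e1 t ht) hv.le (norm_nonneg _) (by positivity))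
        have i2 := ((α (z₀ + t • (v + h))).le_opNorm h).trans
          (mul_le_mul_of_nonneg_right (hK _ (hball _ hvh t ht)) (norm_nonneg _))
        refine (norm_add_le _ _).trans ((add_le_add i1 i2).trans (le_of_eq ?_))
        rw [hM]; ring
    -- The defect D(t) = G_{v+h} - G_v - G_v α(th) starts at 0 and satisfies D' = D α(v) + O(‖h‖²),
    -- so it is itself O(‖h‖²) at time 1.
    have hD := norm_le_of_norm_deriv_le
      (D := fun t => G (v + h) t - G v t - G v t * α (z₀ + t • v) (t • h))
      (D' := fun t => G (v + h) t * α (z₀ + t • (v + h)) (v + h) - G v t * α (z₀ + t • v) v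
        - (G v t * α (z₀ + t • v) v * α (z₀ + t • v) (t • h)
          + G v t * (α' (z₀ + t • v) v (t • h) + α (z₀ + t • v) h)))
      (c := (C₀ * M + 2 * (C₀ * M) * M) * ‖h‖ ^ 2) (by positivity) ?_
      (by simp [hG0 v hv, hG0 _ hvh]) ?_ 1 (by simp)
    · simpa [mul_assoc] using hD
    · intro t ht
      have i1 : HasDerivAt (fun t : ℝ => t • h) h t := by
        simpa using (hasDerivAt_id t).smul_const h
      have i2 := (hα1 v hv t ht).clm_apply i1
      exact ((hG _ hvh t ht).sub (hG v hv t ht)).sub ((hG v hv t ht).mul i2.hasDerivWithinAt)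
    · intro t ht
      -- Flatness is used here: it exchanges v and th in α', and the resulting commutator cancels
      -- the terms of D' that are only linear in h.
      have hf := hflat _ (hball v hv t ht) v (t • h)
      have e : G (v + h) t * α (z₀ + t • (v + h)) (v + h) - G v t * α (z₀ + t • v) v
          - (G v t * α (z₀ + t • v) v * α (z₀ + t • v) (t • h)
            + G v t * (α' (z₀ + t • v) v (t • h) + α (z₀ + t • v) h))
          = (G (v + h) t - G v t - G v t * α (z₀ + t • v) (t • h)) * α (z₀ + t • v) v
            + (G (v + h) t * ((α (z₀ + t • (v + h)) - α (z₀ + t • v)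
                - α' (z₀ + t • v) (t • h)) v + (α (z₀ + t • (v + h)) - α (z₀ + t • v)) h)
              + (G (v + h) t - G v t) * (α' (z₀ + t • v) (t • h) v + α (z₀ + t • v) h)) := by
        have hf' : α' (z₀ + t • v) v (t • h) = α' (z₀ + t • v) (t • h) v
            - (α (z₀ + t • v) v * α (z₀ + t • v) (t • h)
              - α (z₀ + t • v) (t • h) * α (z₀ + t • v) v) := by
          rw [← sub_eq_zero, ← hf]; abel
        rw [hf', map_add (α (z₀ + t • (v + h)))]
        simp only [_root_.sub_apply]
        noncomm_ring
      rw [e]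
      refine (norm_add_le _ _).trans (add_le_add ?_ ?_)
      · exact (norm_mul_le _ _).trans (mul_le_of_le_one_right (norm_nonneg _)
          ((hbound v hv t ht).trans hKr))
      have j1 : ‖(α (z₀ + t • (v + h)) - α (z₀ + t • v) - α' (z₀ + t • v) (t • h)) v
          + (α (z₀ + t • (v + h)) - α (z₀ + t • v)) h‖ ≤ M * ‖h‖ ^ 2 := by
        have k1 := (ContinuousLinearMap.le_opNorm (α (z₀ + t • (v + h)) - α (z₀ + t • v)
          - α' (z₀ + t • v) (t • h)) v).trans
          (mul_le_mul (e2 t ht) hv.le (norm_nonneg _) (by positivity))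
        have k2 := ((α (z₀ + t • (v + h)) - α (z₀ + t • v)).le_opNorm h).trans
          (mul_le_mul_of_nonneg_right (e1 t ht) (norm_nonneg _))
        refine (norm_add_le _ _).trans ((add_le_add k1 k2).trans (le_of_eq ?_))
        rw [hM]; ring
      have j2 : ‖α' (z₀ + t • v) (t • h) v + α (z₀ + t • v) h‖ ≤ M * ‖h‖ := by
        have k1 : ‖α' (z₀ + t • v) (t • h) v‖ ≤ K * ‖h‖ * r := by
          refine (ContinuousLinearMap.le_opNorm _ _).trans
            (mul_le_mul ?_ hv.le (norm_nonneg _) (by positivity))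
          exact (ContinuousLinearMap.le_opNorm _ _).trans
            (mul_le_mul (hK' _ (hball v hv t ht)) (hth t ht) (norm_nonneg _) hK0)
        have k2 := ((α (z₀ + t • v)).le_opNorm h).trans
          (mul_le_mul_of_nonneg_right (hK _ (hball _ hv t ht)) (norm_nonneg _))
        refine (norm_add_le _ _).trans ((add_le_add k1 k2).trans (le_of_eq ?_))
        rw [hM]; ring
      have l1 := (norm_mul_le (G (v + h) t) ((α (z₀ + t • (v + h)) - α (z₀ + t • v)
          - α' (z₀ + t • v) (t • h)) v + (α (z₀ + t • (v + h)) - α (z₀ + t • v)) h)).trans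
        (mul_le_mul (hGn _ hvh t ht) j1 (norm_nonneg _) hC0)
      have l2 := (norm_mul_le (G (v + h) t - G v t)
          (α' (z₀ + t • v) (t • h) v + α (z₀ + t • v) h)).trans
        (mul_le_mul (hE t ht) j2 (norm_nonneg _) (by positivity))
      refine (norm_add_le _ _).trans ((add_le_add l1 l2).trans (le_of_eq ?_))
      ring
  refine ⟨fun z => G (z - z₀) 1, ?_, fun z hz => ?_⟩
  · have h0 : ‖(0 : E)‖ < r := by simpa using hr
    have hz0 : ∀ t ∈ Set.Icc (0 : ℝ) 1, ‖G 0 t - 1‖ ≤ 2 * 0 := by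
      refine norm_le_of_norm_deriv_le le_rfl (fun t ht => (hG 0 h0 t ht).sub_const 1)
        (by simp [hG0 0 h0]) ?_
      intro t _
      simp
    have := hz0 1 (by simp)
    rw [mul_zero, norm_le_zero_iff, sub_eq_zero] at this
    simpa using this
  · have hv : ‖z - z₀‖ < r := by simpa [dist_eq_norm] using hz
    rw [hasFDerivAt_iff_isLittleO_nhds_zero]
    refine Asymptotics.IsBigO.trans_isLittleO (g := fun h : E => ‖h‖ ^ 2)
      (Asymptotics.IsBigO.of_bound (2 * (C₀ * M + 2 * (C₀ * M) * M)) ?_)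
      (Asymptotics.isLittleO_norm_pow_id one_lt_two)
    have hev : ∀ᶠ h : E in 𝓝 0, ‖z - z₀ + h‖ < r := by
      have : ContinuousAt (fun h : E => ‖z - z₀ + h‖) 0 := by fun_prop
      exact this.eventually_lt continuousAt_const (by simpa using hv)
    filter_upwards [hev] with h hh
    have := hmain (z - z₀) h hv hh
    rw [add_sub_cancel] at this
    rw [norm_pow, norm_norm, add_sub_right_comm]
    exact this

end Primitive

section Primitive

variable {A : Type*} [NormedRing A] [NormedAlgebra ℝ A]
variable {E : Type*} [NormedAddCommGroup E] [NormedSpace ℝ E]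

/-- The function `F` has logarithmic derivative `α` at `z`. -/
def HasLogDerivAt (F : E → A) (α : E → E →ₗ[ℝ] A) (z : E) : Prop :=
  DifferentiableAt ℝ F z ∧ ∀ v, fderiv ℝ F z v = F z * α z v

theorem hasFDerivAt_inverse [CompleteSpace A] {G Gi : E → A} {z : E} (h1 : ∀ w, G w * Gi w = 1)
    (h2 : ∀ w, Gi w * G w = 1) {G' : E →L[ℝ] A} (hG : HasFDerivAt G G' z) :
    HasFDerivAt Gi (-(ContinuousLinearMap.mulLeftRight ℝ A (Gi z) (Gi z)).comp G') z := by
  have e : Gi = fun w => Ring.inverse (G w) := funext fun w =>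
    (Ring.inverse_unit (⟨G w, Gi w, h1 w, h2 w⟩ : Aˣ)).symm
  have h3 := hasFDerivAt_ringInverse (𝕜 := ℝ) (⟨G z, Gi z, h1 z, h2 z⟩ : Aˣ)
  have h4 := HasFDerivAt.comp z (f := G) (g := Ring.inverse) h3 hG
  refine (h4.congr_of_eventuallyEq (Filter.Eventually.of_forall fun w => congrFun e w))

theorem contDiffOn_inverse [CompleteSpace A] {G Gi : E → A} {V : Set E} (h1 : ∀ w, G w * Gi w = 1)
    (h2 : ∀ w, Gi w * G w = 1) (hG : ContDiffOn ℝ ∞ G V) : ContDiffOn ℝ ∞ Gi V := by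
  have e : Gi = fun w => Ring.inverse (G w) := funext fun w =>
    (Ring.inverse_unit (⟨G w, Gi w, h1 w, h2 w⟩ : Aˣ)).symm
  intro z hz
  have h3 := contDiffAt_ringInverse ℝ (n := ∞) (⟨G z, Gi z, h1 z, h2 z⟩ : Aˣ)
  rw [e]
  exact ContDiffAt.comp_contDiffWithinAt z (f := G) (g := Ring.inverse) h3 (hG z hz)

/-- Two primitives of one form satisfy d(F G⁻¹) = F α G⁻¹ - F α G⁻¹ = 0, so locally they differ by a
constant left factor. -/
theorem HasLogDerivAt.eventually_mul_inverse_eq [CompleteSpace A] {F G Gi : E → A}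
    {α : E → E →ₗ[ℝ] A} {z : E} (h1 : ∀ w, G w * Gi w = 1) (h2 : ∀ w, Gi w * G w = 1)
    (hF : ∀ᶠ w in 𝓝 z, HasLogDerivAt F α w) (hG : ∀ᶠ w in 𝓝 z, HasLogDerivAt G α w) :
    ∀ᶠ w in 𝓝 z, F w * Gi w = F z * Gi z := by
  obtain ⟨r, hr, hball⟩ := Metric.eventually_nhds_iff_ball.1 (hF.and hG)
  have hd : ∀ w ∈ Metric.ball z r, HasFDerivAt (fun w => F w * Gi w) (0 : E →L[ℝ] A) w := by
    intro w hw
    obtain ⟨⟨hF1, hF2⟩, hG1, hG2⟩ := hball w hw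
    refine (hF1.hasFDerivAt.mul' (hasFDerivAt_inverse h1 h2 hG1.hasFDerivAt)).congr_fderiv ?_
    ext v
    simp only [_root_.add_apply, _root_.smul_apply,
      _root_.neg_apply, ContinuousLinearMap.comp_apply, smul_eq_mul,
      ContinuousLinearMap.mulLeftRight_apply, hF2, hG2, _root_.zero_apply,
      op_smul_eq_mul]
    rw [← mul_assoc (Gi w) (G w), h2, one_mul, mul_neg, mul_assoc, neg_add_cancel]
  filter_upwards [Metric.ball_mem_nhds z hr] with w hw
  exact Metric.isOpen_ball.is_const_of_fderiv_eq_zero (𝕜 := ℝ)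
    (convex_ball z r).isPreconnected
    (fun x hx => (hd x hx).differentiableAt.differentiableWithinAt)
    (fun x hx => (hd x hx).fderiv) hw (Metric.mem_ball_self hr)

variable [FiniteDimensional ℝ E]

theorem contDiffOn_toContinuousLinearMap {α : E → E →ₗ[ℝ] A} {U : Set E}
    (hα : ∀ v, ContDiffOn ℝ ∞ (fun z => α z v) U) :
    ContDiffOn ℝ ∞ (fun z => LinearMap.toContinuousLinearMap (α z)) U :=
  contDiffOn_clm_apply.2 hα

/-- Bootstrap: dF = F α gains one derivative of F at each induction step. -/
theorem contDiffOn_of_hasLogDerivAt {F : E → A} {α : E → E →ₗ[ℝ] A} {U : Set E} (hU : IsOpen U)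
    (hα : ∀ v, ContDiffOn ℝ ∞ (fun z => α z v) U) (hF : ∀ z ∈ U, HasLogDerivAt F α z) :
    ContDiffOn ℝ ∞ F U := by
  rw [contDiffOn_infty]
  intro m
  induction m with
  | zero =>
    rw [Nat.cast_zero, contDiffOn_zero]
    exact fun z hz => (hF z hz).1.continuousAt.continuousWithinAt
  | succ m ih =>
    rw [Nat.cast_succ, contDiffOn_succ_iff_fderiv_of_isOpen hU]
    refine ⟨fun z hz => (hF z hz).1.differentiableWithinAt, by simp, ?_⟩
    rw [contDiffOn_clm_apply]
    intro v
    have h1 : ContDiffOn ℝ m (fun z => F z * α z v) U :=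
      ih.mul ((hα v).of_le (by exact_mod_cast le_top))
    exact h1.congr fun z hz => (hF z hz).2 v

theorem exists_hasLogDerivAt_ball [CompleteSpace A] {α : E → E →ₗ[ℝ] A} {U : Set E}
    (hU : IsOpen U) (hα : ∀ v, ContDiffOn ℝ ∞ (fun z => α z v) U)
    (hflat : ∀ z ∈ U, ∀ v w, fderiv ℝ (fun p => α p w) z v - fderiv ℝ (fun p => α p v) z w
      + (α z v * α z w - α z w * α z v) = 0) {z₀ : E} (hz₀ : z₀ ∈ U) :
    ∃ r > 0, Metric.ball z₀ r ⊆ U ∧ ∃ F : E → A, F z₀ = 1 ∧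
      ∀ z ∈ Metric.ball z₀ r, HasLogDerivAt F α z := by
  set β : E → E →L[ℝ] A := fun z => LinearMap.toContinuousLinearMap (α z) with hβ
  have hβs : ContDiffOn ℝ ∞ β U := contDiffOn_toContinuousLinearMap hα
  have hβ1 : ContDiffAt ℝ ∞ β z₀ := hβs.contDiffAt (hU.mem_nhds hz₀)
  have hβ2 : ContDiffAt ℝ 1 (fderiv ℝ β) z₀ := hβ1.fderiv_right (by norm_cast)
  obtain ⟨K₀, t, ht, hlip⟩ := hβ2.exists_lipschitzOnWith
  set K : ℝ := max K₀ (max (‖β z₀‖ + 1) (‖fderiv ℝ β z₀‖ + 1)) with hK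
  have hK0 : 0 ≤ K := le_max_of_le_left K₀.2
  have ev1 : ∀ᶠ z in 𝓝 z₀, ‖β z‖ ≤ K := by
    refine (hβ1.continuousAt.norm.eventually_le_const (u := ‖β z₀‖ + 1) (by simp)).mono ?_
    exact fun z hz => hz.trans (le_max_of_le_right (le_max_left _ _))
  have ev2 : ∀ᶠ z in 𝓝 z₀, ‖fderiv ℝ β z‖ ≤ K := by
    have hn : ContinuousAt (fun z => ‖fderiv ℝ β z‖) z₀ :=
      (continuous_norm (E := E →L[ℝ] E →L[ℝ] A)).continuousAt.comp hβ2.continuousAt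
    refine (hn.eventually_le_const (u := ‖fderiv ℝ β z₀‖ + 1) (lt_add_one _)).mono ?_
    exact fun z hz => hz.trans (le_max_of_le_right (le_max_right _ _))
  obtain ⟨r₀, hr₀, hball⟩ := Metric.eventually_nhds_iff_ball.1
    ((ev1.and ev2).and (Filter.Eventually.and ht (hU.mem_nhds hz₀)))
  -- The radius is at most C⁻¹, so that (‖1‖ + 1) K r ≤ 1 as the radial construction requires.
  set C : ℝ := (‖(1 : A)‖ + 1) * (K + 1) with hC
  have hC0 : 0 < C := by positivity
  have hr : 0 < min r₀ C⁻¹ := lt_min hr₀ (inv_pos.2 hC0)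
  have hsub : Metric.ball z₀ (min r₀ C⁻¹) ⊆ Metric.ball z₀ r₀ :=
    Metric.ball_subset_ball (min_le_left _ _)
  have hUball : Metric.ball z₀ (min r₀ C⁻¹) ⊆ U := fun z hz => (hball z (hsub hz)).2.2
  have hd : ∀ z ∈ U, HasFDerivAt β (fderiv ℝ β z) z := fun z hz =>
    ((hβs.contDiffAt (hU.mem_nhds hz)).differentiableAt (by simp)).hasFDerivAt
  obtain ⟨F, hF0, hF⟩ := exists_primitive_on_ball (α := β) (α' := fderiv ℝ β) (z₀ := z₀) (K := K) hr
    hK0 (fun z hz => hd z (hUball hz))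
    (fun z hz => (hball z (hsub hz)).1.1) (fun z hz => (hball z (hsub hz)).1.2)
    (fun z hz w hw => by
      rw [← dist_eq_norm z w]
      refine (dist_eq_norm (fderiv ℝ β z) (fderiv ℝ β w)).symm.trans_le ?_
      exact (hlip.dist_le_mul z (hball z (hsub hz)).2.1 w (hball w (hsub hw)).2.1).trans
        (mul_le_mul_of_nonneg_right (le_max_left _ _) dist_nonneg))
    (fun z hz v w => by
      have h1 : ∀ w, HasFDerivAt (fun p => α p w) ((fderiv ℝ β z).flip w) z := by
        intro w
        have := (hd z (hUball hz)).clm_apply (hasFDerivAt_const w z)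
        refine this.congr_fderiv ?_
        ext; simp
      have := hflat z (hUball hz) v w
      rw [(h1 w).fderiv, (h1 v).fderiv] at this
      exact this)
    (by
      calc (‖(1 : A)‖ + 1) * (K * min r₀ C⁻¹) ≤ (‖(1 : A)‖ + 1) * ((K + 1) * C⁻¹) := by
            gcongr
            · linarith
            · exact min_le_right _ _
        _ = C * C⁻¹ := by rw [hC]; ring
        _ = 1 := mul_inv_cancel₀ hC0.ne'
        _ ≤ 1 := le_rfl)
  refine ⟨_, hr, hUball, F, hF0, fun z hz => ⟨(hF z hz).differentiableAt, fun v => ?_⟩⟩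
  rw [(hF z hz).fderiv]
  rfl

end Primitive

/-! ### Gluing -/

/-- Local functions to a group which agree up to locally constant left factors can be glued over a
simply connected space. -/
theorem exists_eventually_eq_mul {X G : Type*} [TopologicalSpace X] [SimplyConnectedSpace X]
    [LocallyPathConnectedSpace X] [Group G] (B : X → Set X) (hB : ∀ x, IsOpen (B x))
    (hxB : ∀ x, x ∈ B x) (f : X → X → G)
    (h : ∀ i j, ∀ x ∈ B i ∩ B j, ∀ᶠ y in 𝓝 x, f i y * (f j y)⁻¹ = f i x * (f j x)⁻¹) :
    ∃ F : X → G, ∀ x, ∃ c, ∀ᶠ y in 𝓝 x, F y = c * f x y := by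
  -- For the discrete topology on G the locally constant quotients form a continuous cocycle. The
  -- bundle they define is a covering of X.
  let _ : TopologicalSpace G := ⊥
  have _ : DiscreteTopology G := ⟨rfl⟩
  let Z : FiberBundleCore X X G :=
    { baseSet := B
      isOpen_baseSet := hB
      indexAt := id
      mem_baseSet_at := hxB
      coordChange := fun i j x c => c * f i x * (f j x)⁻¹
      coordChange_self := fun i x _ v => mul_inv_cancel_right v _
      continuousOn_coordChange := by
        rintro i j ⟨x, c⟩ ⟨hx, -⟩
        refine ContinuousAt.continuousWithinAt ?_
        have h1 : ContinuousAt (fun p : X × G => p.2 * (f i x * (f j x)⁻¹)) (x, c) :=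
          ((continuous_of_discreteTopology (f := fun g : G => g * (f i x * (f j x)⁻¹))).comp
            continuous_snd).continuousAt
        refine h1.congr ?_
        filter_upwards [continuous_fst.continuousAt.eventually (h i j x hx)] with p hp
        rw [← hp, mul_assoc]
      coordChange_comp := fun i j k x _ v => by
        rw [inv_mul_cancel_right] }
  have hcov : IsCoveringMap Z.proj :=
    IsFiberBundle.isCoveringMap fun x => ⟨Z.localTrivAt x, hxB x⟩
  obtain ⟨x₀⟩ : Nonempty X := inferInstance
  -- Simple connectedness lifts the identity of X to a global section, which is a coherent choice of
  -- the left constants.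
  obtain ⟨σ, ⟨-, hσ⟩, -⟩ := hcov.existsUnique_continuousMap_lifts (ContinuousMap.id X) x₀
    (⟨x₀, (1 : G)⟩ : Z.TotalSpace) rfl
  have hσ' : ∀ x, (σ x).1 = x := fun x => congrFun hσ x
  let s : X → G := fun x => (σ x).2
  -- In the chart of x the section reads s(y) f_y(y) f_x(y)⁻¹. It is continuous into a discrete
  -- space, hence constant near x.
  refine ⟨fun x => s x * f x x, fun x => ⟨s x * f x x * (f x x)⁻¹, ?_⟩⟩
  have hmem : σ x ∈ (Z.localTrivAt x).source := by
    rw [(Z.localTrivAt x).mem_source]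
    change (σ x).1 ∈ B x
    rw [hσ']
    exact hxB x
  have hc : ContinuousAt (fun y => ((Z.localTrivAt x) (σ y)).2) x :=
    continuous_snd.continuousAt.comp
      (((Z.localTrivAt x).continuousAt hmem).comp σ.continuous.continuousAt)
  have hval : ∀ y, ((Z.localTrivAt x) (σ y)).2 = s y * f y y * (f x y)⁻¹ := by
    intro y
    have : ((Z.localTrivAt x) (σ y)).2 = s y * f (σ y).1 (σ y).1 * (f x (σ y).1)⁻¹ := rfl
    rw [this, hσ']
  simp only [hval] at hc
  have : ∀ᶠ y in 𝓝 x, s y * f y y * (f x y)⁻¹ ∈ ({s x * f x x * (f x x)⁻¹} : Set G) :=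
    hc.eventually ((isOpen_discrete _).mem_nhds rfl)
  filter_upwards [this] with y hy
  rw [← Set.mem_singleton_iff.1 hy, inv_mul_cancel_right]

/-! ### Logarithmic derivatives are flat. -/

section Primitive

variable {A : Type*} [NormedRing A] [NormedAlgebra ℝ A]
variable {E : Type*} [NormedAddCommGroup E] [NormedSpace ℝ E]

theorem HasLogDerivAt.congr {F G : E → A} {α : E → E →ₗ[ℝ] A} {z : E} (hF : HasLogDerivAt F α z)
    (h : G =ᶠ[𝓝 z] F) : HasLogDerivAt G α z := by
  refine ⟨hF.1.congr_of_eventuallyEq h, fun v => ?_⟩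
  rw [h.fderiv_eq, h.self_of_nhds, hF.2]

theorem HasLogDerivAt.const_mul {F : E → A} {α : E → E →ₗ[ℝ] A} {z : E}
    (hF : HasLogDerivAt F α z) (a : A) : HasLogDerivAt (fun w => a * F w) α z := by
  have h1 : HasFDerivAt (fun w => a * F w) (a • fderiv ℝ F z) z := hF.1.hasFDerivAt.const_mul a
  refine ⟨h1.differentiableAt, fun v => ?_⟩
  rw [h1.fderiv, _root_.smul_apply, hF.2, smul_eq_mul, mul_assoc]

/-- Logarithmic derivatives are flat. -/
theorem flat_of_hasLogDerivAt {F Fi : E → A} {α : E → E →ₗ[ℝ] A} {z : E} (h2 : Fi z * F z = 1)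
    (hF : ∀ᶠ w in 𝓝 z, HasLogDerivAt F α w) (hF2 : ContDiffAt ℝ 2 F z)
    (hα : ∀ v, DifferentiableAt ℝ (fun p => α p v) z) (v w : E) :
    fderiv ℝ (fun p => α p w) z v - fderiv ℝ (fun p => α p v) z w
      + (α z v * α z w - α z w * α z v) = 0 := by
  -- Flatness is the symmetry of the second derivative of F, after cancelling the invertible factor
  -- F(z).
  have hsymm := hF2.isSymmSndFDerivAt (by simp)
  have hd : DifferentiableAt ℝ (fderiv ℝ F) z :=
    (hF2.fderiv_right (m := 1) (by norm_num)).differentiableAt (by simp)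
  have key : ∀ v w, fderiv ℝ (fderiv ℝ F) z v w
      = F z * α z v * α z w + F z * fderiv ℝ (fun p => α p w) z v := by
    intro v w
    have e1 : HasFDerivAt (fun p => fderiv ℝ F p w) ((fderiv ℝ (fderiv ℝ F) z).flip w) z := by
      refine (hd.hasFDerivAt.clm_apply (hasFDerivAt_const w z)).congr_fderiv ?_
      ext; simp
    have e2 := hF.self_of_nhds.1.hasFDerivAt.mul' (hα w).hasFDerivAt
    have e3 : (fun p => fderiv ℝ F p w) =ᶠ[𝓝 z] fun p => F p * α p w := by
      filter_upwards [hF] with p hp using hp.2 w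
    have e4 := congrArg (fun T : E →L[ℝ] A => T v)
      ((e1.congr_of_eventuallyEq e3.symm).unique e2)
    simp only [ContinuousLinearMap.flip_apply, _root_.add_apply, _root_.smul_apply, smul_eq_mul,
      op_smul_eq_mul, hF.self_of_nhds.2] at e4
    rw [e4, add_comm]
  have h := hsymm v w
  rw [key, key] at h
  have h3 : F z * (fderiv ℝ (fun p => α p w) z v - fderiv ℝ (fun p => α p v) z w
      + (α z v * α z w - α z w * α z v)) = 0 := by
    rw [← sub_eq_zero] at h
    rw [← h]
    noncomm_ring
  calc _ = Fi z * F z * (fderiv ℝ (fun p => α p w) z v - fderiv ℝ (fun p => α p v) z w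
      + (α z v * α z w - α z w * α z v)) := by rw [h2, one_mul]
    _ = 0 := by rw [mul_assoc, h3, mul_zero]

end Primitive

/-! ### Integration of flat 𝔤-valued forms to maps into G. -/

namespace MatrixLieGroup

variable {n : Type*} [Fintype n] [DecidableEq n] (L : MatrixLieGroup n)
  {E : Type*} [NormedAddCommGroup E] [NormedSpace ℝ E]

/-- A `𝔤`-valued form as a form with values in the space of matrices. -/
def coeForm (α : E → E →ₗ[ℝ] L.𝔤) (z : E) : E →ₗ[ℝ] Matrix n n ℂ := L.𝔤.subtype ∘ₗ α z

theorem hasLogDerivAt_mat_iff {F : E → L.G} {α : E → E →ₗ[ℝ] L.𝔤} {z : E} :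
    HasLogDerivAt (fun w => L.mat (F w)) (L.coeForm α) z ↔
      DifferentiableAt ℝ (fun w => L.mat (F w)) z ∧ ∀ v,
        fderiv ℝ (fun w => L.mat (F w)) z v = L.mat (F z) * (α z v : Matrix n n ℂ) := Iff.rfl

/-- The primitive is first found among matrices. On a smaller ball it is invertible, and along each
segment from z₀ it starts at 1 with logarithmic derivative in 𝔤. It therefore stays in the closure
of G, and so in G. -/
theorem exists_hasLogDerivAt_ball {α : ℂ → ℂ →ₗ[ℝ] L.𝔤} {U : Set ℂ} (hU : IsOpen U)
    (hα : ∀ v, ContDiffOn ℝ ∞ (fun z => (α z v : Matrix n n ℂ)) U)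
    (hflat : IsFlatOn (L.coeForm α) U) {z₀ : ℂ} (hz₀ : z₀ ∈ U) :
    ∃ r > 0, ∃ F : ℂ → L.G,
      ∀ z ∈ Metric.ball z₀ r, HasLogDerivAt (fun w => L.mat (F w)) (L.coeForm α) z := by
  obtain ⟨r₀, hr₀, hball, F, hF0, hF⟩ :=
    _root_.exists_hasLogDerivAt_ball (α := L.coeForm α) hU hα hflat hz₀
  have hunit : ∀ᶠ z in 𝓝 z₀, IsUnit (F z) := by
    have hc : ContinuousAt F z₀ := (hF z₀ (Metric.mem_ball_self hr₀)).1.continuousAt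
    refine hc.eventually (Units.isOpen.mem_nhds ?_)
    rw [hF0]
    exact isUnit_one
  obtain ⟨r₁, hr₁, hball₁⟩ := Metric.eventually_nhds_iff_ball.1 hunit
  have hr : 0 < min r₀ r₁ := lt_min hr₀ hr₁
  have hsub₀ : Metric.ball z₀ (min r₀ r₁) ⊆ Metric.ball z₀ r₀ :=
    Metric.ball_subset_ball (min_le_left _ _)
  have hsub₁ : Metric.ball z₀ (min r₀ r₁) ⊆ Metric.ball z₀ r₁ :=
    Metric.ball_subset_ball (min_le_right _ _)
  have hmem : ∀ z ∈ Metric.ball z₀ (min r₀ r₁), ∃ g : L.G, L.mat g = F z := by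
    intro z hz
    have hu := hball₁ z (hsub₁ hz)
    suffices h : hu.unit ∈ L.G from ⟨⟨hu.unit, h⟩, hu.unit_spec⟩
    refine L.mem_G_of_mem_closure _ ?_
    rw [hu.unit_spec]
    have hline : ∀ t ∈ Set.Icc (0 : ℝ) 1, z₀ + t • (z - z₀) ∈ Metric.ball z₀ r₀ := by
      intro t ht
      have := (convex_ball z₀ r₀).add_smul_sub_mem (Metric.mem_ball_self hr₀) (hsub₀ hz) ht
      simpa using this
    have hd : ∀ t ∈ Set.Icc (0 : ℝ) 1, HasDerivAt (fun t : ℝ => F (z₀ + t • (z - z₀)))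
        (F (z₀ + t • (z - z₀)) * (α (z₀ + t • (z - z₀)) (z - z₀) : Matrix n n ℂ)) t := by
      intro t ht
      have h1 : HasDerivAt (fun t : ℝ => z₀ + t • (z - z₀)) (z - z₀) t := by
        simpa using ((hasDerivAt_id t).smul_const (z - z₀)).const_add z₀
      refine (HasFDerivAt.comp_hasDerivAt t (hF _ (hline t ht)).1.hasFDerivAt h1).congr_deriv ?_
      exact (hF _ (hline t ht)).2 _
    have hcont : ContinuousOn (fun t : ℝ => (α (z₀ + t • (z - z₀)) (z - z₀) : Matrix n n ℂ))
        (Set.Icc 0 1) := by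
      have hl : Continuous (fun t : ℝ => z₀ + t • (z - z₀)) := by fun_prop
      exact ContinuousOn.comp (t := U) (g := fun w => (α w (z - z₀) : Matrix n n ℂ))
        (hα (z - z₀)).continuousOn hl.continuousOn (fun t ht => hball (hline t ht))
    obtain ⟨K, hK⟩ := isCompact_Icc.exists_bound_of_continuousOn hcont
    have := mem_closure_of_logDeriv_tangent (Γ := L.range) (T := 1) (K := K) L.mul_mem_range
      (γ := fun t : ℝ => F (z₀ + t • (z - z₀)))
      (X := fun t : ℝ => (α (z₀ + t • (z - z₀)) (z - z₀) : Matrix n n ℂ))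
      (fun t ht => (hd t ht).continuousAt.continuousWithinAt)
      (fun t ht => (hd t ⟨ht.1, ht.2.le⟩).hasDerivWithinAt)
      ⟨1, by simp [hF0]⟩ (fun t ht => hK t ⟨ht.1, ht.2.le⟩)
      (fun t _ => ⟨_, fun s => ⟨L.expG (s • α (z₀ + t • (z - z₀)) (z - z₀)), rfl⟩,
        by simp [L.expG_zero], L.hasDerivAt_mat_expG_zero _⟩) 1 (by simp)
    simp only [one_smul, add_sub_cancel] at this
    exact this
  choose! g hg using hmem
  refine ⟨_, hr, g, fun z hz => ?_⟩
  have he : (fun w => L.mat (g w)) =ᶠ[𝓝 z] F := by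
    filter_upwards [Metric.isOpen_ball.mem_nhds hz] with w hw using hg w hw
  exact HasLogDerivAt.congr (hF z (hsub₀ hz)) he

/-- A flat `𝔤`-valued form on a simply connected domain is the Maurer–Cartan form of a map into
`G`. -/
theorem exists_hasLogDerivAt {α : ℂ → ℂ →ₗ[ℝ] L.𝔤} {U : Set ℂ} (hU : IsOpen U)
    (hU' : SimplyConnectedSpace U)
    (hα : ∀ v, ContDiffOn ℝ ∞ (fun z => (α z v : Matrix n n ℂ)) U)
    (hflat : IsFlatOn (L.coeForm α) U) :
    ∃ F : ℂ → L.G, ∀ z ∈ U, HasLogDerivAt (fun w => L.mat (F w)) (L.coeForm α) z := by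
  have := hU.locallyPathConnectedSpace
  have hloc := fun x : U => L.exists_hasLogDerivAt_ball hU hα hflat x.2
  choose r hr f hf using hloc
  obtain ⟨F, hF⟩ := exists_eventually_eq_mul (X := U) (G := L.G)
    (fun x => Subtype.val ⁻¹' Metric.ball (x : ℂ) (r x))
    (fun x => Metric.isOpen_ball.preimage continuous_subtype_val)
    (fun x => Metric.mem_ball_self (hr x)) (fun x y => f x y) (by
      rintro i j x ⟨hi, hj⟩
      have h1 := HasLogDerivAt.eventually_mul_inverse_eq (z := (x : ℂ))
        (F := fun w => L.mat (f i w)) (G := fun w => L.mat (f j w))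
        (Gi := fun w => L.mat (f j w)⁻¹) (α := L.coeForm α) (fun w => L.mat_mul_inv _)
        (fun w => L.mat_inv_mul _)
        (by filter_upwards [Metric.isOpen_ball.mem_nhds hi] with w hw using hf i w hw)
        (by filter_upwards [Metric.isOpen_ball.mem_nhds hj] with w hw using hf j w hw)
      filter_upwards [continuous_subtype_val.continuousAt.eventually h1] with y hy
      refine L.mat_injective ?_
      simpa using hy)
  classical
  refine ⟨fun z => if h : z ∈ U then F ⟨z, h⟩ else 1, fun z hz => ?_⟩
  obtain ⟨c, hc⟩ := hF ⟨z, hz⟩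
  have he : (fun w => L.mat (if h : w ∈ U then F ⟨w, h⟩ else 1)) =ᶠ[𝓝 z]
      fun w => L.mat c * L.mat (f ⟨z, hz⟩ w) := by
    have h1 : ∀ᶠ w in 𝓝 z, ∀ h : w ∈ U, F ⟨w, h⟩ = c * f ⟨z, hz⟩ w := by
      have h2 := hU.isOpenEmbedding_subtypeVal.map_nhds_eq ⟨z, hz⟩
      rw [← h2, Filter.eventually_map]
      filter_upwards [hc] with y hy _ using hy
    filter_upwards [h1, hU.mem_nhds hz] with w hw hwU
    rw [dif_pos hwU, hw hwU, L.mat_mul]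
  exact HasLogDerivAt.congr
    (HasLogDerivAt.const_mul (hf ⟨z, hz⟩ z (Metric.mem_ball_self (hr _))) (L.mat c)) he

theorem contDiffOn_mat_inv {F : E → L.G}
    {V : Set E} (hF : ContDiffOn ℝ ∞ (fun w => L.mat (F w)) V) :
    ContDiffOn ℝ ∞ (fun w => L.mat (F w)⁻¹) V :=
  contDiffOn_inverse (fun w => L.mat_mul_inv (F w)) (fun w => L.mat_inv_mul (F w)) hF

theorem contDiffOn_mat_mul {F K : E → L.G}
    {V : Set E} (hF : ContDiffOn ℝ ∞ (fun w => L.mat (F w)) V)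
    (hK : ContDiffOn ℝ ∞ (fun w => L.mat (K w)) V) :
    ContDiffOn ℝ ∞ (fun w => L.mat (F w * K w)) V := by
  have h : ContDiffOn ℝ ∞ (fun w => L.mat (F w) * L.mat (K w)) V := hF.mul hK
  exact h.congr fun w _ => L.mat_mul _ _

end MatrixLieGroup

namespace HermitianSymmetricSpace

variable {n : Type*} [Fintype n] [DecidableEq n] (S : HermitianSymmetricSpace n)
  {E : Type*} [NormedAddCommGroup E] [NormedSpace ℝ E]

/-! ### Lifts -/

/-- The Maurer–Cartan form of `F`, as a form with values in `𝔤`. -/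
def mcForm (F : E → S.G) (z : E) : E →ₗ[ℝ] S.𝔤 :=
  (S.proj : Matrix n n ℂ →ₗ[ℝ] S.𝔤) ∘ₗ LinearMap.mulLeft ℝ (S.mat (F z)⁻¹) ∘ₗ
    (fderiv ℝ (fun w => S.mat (F w)) z : E →ₗ[ℝ] Matrix n n ℂ)

theorem toLie_coe (X : S.𝔤) : S.toLie (X : Matrix n n ℂ) = X := by
  rw [toLie, dif_pos X.2]

theorem hasLogDerivAt_mcForm {F : E → S.G} {z : E}
    (hF : DifferentiableAt ℝ (fun w => S.mat (F w)) z) :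
    HasLogDerivAt (fun w => S.mat (F w)) (S.coeForm (S.mcForm F)) z := by
  refine S.hasLogDerivAt_mat_iff.2 ⟨hF, fun v => ?_⟩
  have h1 : (S.mcForm F z v : Matrix n n ℂ)
      = S.mat (F z)⁻¹ * fderiv ℝ (fun w => S.mat (F w)) z v :=
    S.coe_proj (S.inv_mul_fderiv_mem hF v)
  rw [h1, ← mul_assoc, S.mat_mul_inv, one_mul]

theorem mat_inv_mul_fderiv {F : E → S.G} {α : E → E →ₗ[ℝ] S.𝔤} {z : E}
    (hF : HasLogDerivAt (fun w => S.mat (F w)) (S.coeForm α) z) (v : E) :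
    S.mat (F z)⁻¹ * fderiv ℝ (fun w => S.mat (F w)) z v = (α z v : Matrix n n ℂ) := by
  rw [(S.hasLogDerivAt_mat_iff.1 hF).2 v, ← mul_assoc, S.mat_inv_mul, one_mul]

theorem maurerCartan_eq {F : ℂ → S.G} {α : ℂ → ℂ →ₗ[ℝ] S.𝔤} {z : ℂ}
    (hF : HasLogDerivAt (fun w => S.mat (F w)) (S.coeForm α) z) (v : ℂ) :
    S.maurerCartan F z v = α z v := by
  rw [maurerCartan, S.mat_inv_mul_fderiv hF, toLie_coe]

theorem tangent_eq {F : ℂ → S.G} {α : ℂ → ℂ →ₗ[ℝ] S.𝔤} {z : ℂ}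
    (hF : HasLogDerivAt (fun w => S.mat (F w)) (S.coeForm α) z) (v : ℂ) :
    S.tangent F z v = S.mPart (α z v) := by
  rw [tangent, S.maurerCartan_eq hF]

theorem isMaurerCartanForm_iff {F : ℂ → S.G} {α : ℂ → ℂ →ₗ[ℝ] S.𝔤} {U : Set ℂ} (hU : IsOpen U)
    (hF : ContDiffOn ℝ ∞ (fun w => S.mat (F w)) U) :
    S.IsMaurerCartanForm α F U ↔
      ∀ z ∈ U, HasLogDerivAt (fun w => S.mat (F w)) (S.coeForm α) z := by
  constructor
  · intro h z hz
    refine S.hasLogDerivAt_mat_iff.2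
      ⟨(hF.contDiffAt (hU.mem_nhds hz)).differentiableAt (by simp), fun v => ?_⟩
    rw [h z hz v, ← mul_assoc, S.mat_mul_inv, one_mul]
  · intro h z hz v
    exact (S.mat_inv_mul_fderiv (h z hz) v).symm

/-- H is fixed pointwise by τ², so velocities of curves in H are fixed by dτ². -/
theorem dτ_sq_of_curve {c : ℝ → S.G} {X : S.𝔤} (h0 : c 0 = 1)
    (hc : HasDerivAt (fun t => S.mat (c t)) (X : Matrix n n ℂ) 0)
    (hH : ∀ᶠ t in 𝓝 0, c t ∈ S.H) : S.dτ (S.dτ X) = X := by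
  have h1 := S.τ_deriv _ _ (by simp [h0]) (S.τ_deriv c X h0 hc)
  refine Subtype.ext (h1.unique (hc.congr_of_eventuallyEq ?_))
  filter_upwards [hH] with t ht
  rw [S.H_le _ ht]

theorem mPart_eq_zero_of_mem_H {h : ℂ → S.G} {α : ℂ → ℂ →ₗ[ℝ] S.𝔤} {z : ℂ}
    (hd : HasLogDerivAt (fun w => S.mat (h w)) (S.coeForm α) z)
    (hH : ∀ᶠ w in 𝓝 z, h w ∈ S.H) (v : ℂ) : S.mPart (α z v) = 0 := by
  refine S.mPart_of_fixed (S.dτ_sq_of_curve (c := fun t => (h z)⁻¹ * h (z + t • v)) (by simp) ?_ ?_)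
  · rw [← S.mat_inv_mul_fderiv hd]
    simp only [S.mat_mul]
    refine HasDerivAt.const_mul _ ?_
    have h1 : HasDerivAt (fun t : ℝ => z + t • v) v 0 := by
      simpa using ((hasDerivAt_id (0 : ℝ)).smul_const v).const_add z
    exact HasFDerivAt.comp_hasDerivAt (0 : ℝ) (f := fun t : ℝ => z + t • v)
      (l := fun w => S.mat (h w)) (by rw [zero_smul, add_zero]; exact hd.1.hasFDerivAt) h1
  · have h2 : ContinuousAt (fun t : ℝ => z + t • v) 0 := by fun_prop
    have h3 := h2.eventually (p := fun w => h w ∈ S.H) (by simpa using hH)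
    filter_upwards [h3] with t ht
    exact S.H.mul_mem (S.H.inv_mem hH.self_of_nhds) ht

/-- The gauge transformation rule. With h valued in H, only the Ad h⁻¹ term reaches 𝔪, which makes
`tangent` well defined up to Ad H. -/
theorem hasLogDerivAt_mul {F h : ℂ → S.G} {α β : ℂ → ℂ →ₗ[ℝ] S.𝔤} {z : ℂ}
    (hF : HasLogDerivAt (fun w => S.mat (F w)) (S.coeForm α) z)
    (hh : HasLogDerivAt (fun w => S.mat (h w)) (S.coeForm β) z) :
    HasLogDerivAt (fun w => S.mat (F w * h w))
      (S.coeForm (fun w => S.AdL (h w)⁻¹ ∘ₗ α w + β w)) z := by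
  have h1 : HasFDerivAt (fun w => S.mat (F w) * S.mat (h w)) _ z :=
    hF.1.hasFDerivAt.mul' hh.1.hasFDerivAt
  have e : (fun w => S.mat (F w * h w)) = fun w => S.mat (F w) * S.mat (h w) := by simp
  refine S.hasLogDerivAt_mat_iff.2 ⟨?_, fun v => ?_⟩
  · rw [e]; exact h1.differentiableAt
  · have h2 : fderiv ℝ (fun w => S.mat (F w * h w)) z v
        = S.mat (F z) * fderiv ℝ (fun w => S.mat (h w)) z v
          + fderiv ℝ (fun w => S.mat (F w)) z v * S.mat (h z) := by
      rw [e]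
      exact congrArg (fun T : ℂ →L[ℝ] Matrix n n ℂ => T v) h1.fderiv
    have h4 : S.mat (h z) * S.mat (h z)⁻¹ = 1 := S.mat_mul_inv _
    rw [h2, (S.hasLogDerivAt_mat_iff.1 hF).2, (S.hasLogDerivAt_mat_iff.1 hh).2, S.mat_mul,
      LinearMap.add_apply, Submodule.coe_add, LinearMap.comp_apply, S.Ad_coe, inv_inv]
    calc _ = S.mat (F z) * (1 * (α z v : Matrix n n ℂ) * S.mat (h z)
          + S.mat (h z) * (β z v : Matrix n n ℂ)) := by noncomm_ring
      _ = _ := by rw [← h4]; noncomm_ring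

variable {S} in
theorem IsLift.differentiableAt {F : ℂ → S.G} {f : ℂ → S.G ⧸ S.H} {V : Set ℂ}
    (hF : S.IsLift F f V) (hV : IsOpen V) {z : ℂ} (hz : z ∈ V) :
    DifferentiableAt ℝ (fun w => S.mat (F w)) z :=
  (hF.1.contDiffAt (hV.mem_nhds hz)).differentiableAt (by simp)

/-- Two lifts of the same map differ by a map to `H`, so the differentials seen through the lifts
differ by the adjoint action of `H`. -/
theorem tangent_eq_AdL {F F' : ℂ → S.G} {f : ℂ → S.G ⧸ S.H} {V V' : Set ℂ} (hV : IsOpen V)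
    (hV' : IsOpen V') (hF : S.IsLift F f V) (hF' : S.IsLift F' f V') {z : ℂ} (hz : z ∈ V)
    (hz' : z ∈ V') : (F z)⁻¹ * F' z ∈ S.H ∧
      ∀ v, S.tangent F' z v = S.AdL ((F z)⁻¹ * F' z)⁻¹ (S.tangent F z v) := by
  have hmem : ∀ w ∈ V ∩ V', (F w)⁻¹ * F' w ∈ S.H := fun w hw =>
    QuotientGroup.eq.1 ((hF.2 w hw.1).trans (hF'.2 w hw.2).symm)
  have hsm : ContDiffOn ℝ ∞ (fun w => S.mat ((F w)⁻¹ * F' w)) (V ∩ V') :=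
    S.contDiffOn_mat_mul (S.contDiffOn_mat_inv (hF.1.mono Set.inter_subset_left))
      (hF'.1.mono Set.inter_subset_right)
  have hn : V ∩ V' ∈ 𝓝 z := (hV.inter hV').mem_nhds ⟨hz, hz'⟩
  have h1 := S.hasLogDerivAt_mcForm (hF.differentiableAt hV hz)
  have h2 := S.hasLogDerivAt_mcForm (F := fun w => (F w)⁻¹ * F' w)
    ((hsm.contDiffAt hn).differentiableAt (by simp))
  have h3 := S.hasLogDerivAt_mul h1 h2
  simp only [mul_inv_cancel_left] at h3
  refine ⟨hmem z ⟨hz, hz'⟩, fun v => ?_⟩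
  rw [S.tangent_eq h1, S.tangent_eq h3, LinearMap.add_apply, map_add,
    S.mPart_eq_zero_of_mem_H h2 (Filter.mem_of_superset hn hmem), add_zero,
    LinearMap.comp_apply, S.mPart_Ad (S.H.inv_mem (hmem z ⟨hz, hz'⟩))]

theorem tangent_eq_Ad {F F' : ℂ → S.G} {f : ℂ → S.G ⧸ S.H} {V V' : Set ℂ} (hV : IsOpen V)
    (hV' : IsOpen V') (hF : S.IsLift F f V) (hF' : S.IsLift F' f V') {z : ℂ} (hz : z ∈ V)
    (hz' : z ∈ V') : ∃ h ∈ S.H, ∀ v, S.tangent F' z v = S.AdL h (S.tangent F z v) :=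
  have h := S.tangent_eq_AdL hV hV' hF hF' hz hz'
  ⟨_, S.H.inv_mem h.1, h.2⟩

theorem J_eq (u : S.𝔤) : S.J u = S.lieB S.Y u := rfl

theorem J_AdL {h : S.G} (hh : h ∈ S.H) {u : S.𝔤} (hu : S.dτ (S.dτ u) = -u) :
    S.lieB S.Y (S.AdL h u) = S.AdL h (S.lieB S.Y u) := (S.J_Ad h hh u hu).symm

theorem metric_AdL {h : S.G} (hh : h ∈ S.H) {u v : S.𝔤} (hu : S.dτ (S.dτ u) = -u)
    (hv : S.dτ (S.dτ v) = -v) : S.metric (S.AdL h u) (S.AdL h v) = S.metric u v :=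
  S.metric_Ad h hh u v hu hv

theorem kahler_AdL {h : S.G} (hh : h ∈ S.H) {u v : S.𝔤} (hu : S.dτ (S.dτ u) = -u)
    (hv : S.dτ (S.dτ v) = -v) : S.kahler (S.AdL h u) (S.AdL h v) = S.kahler u v := by
  rw [kahler, kahler, J_eq, J_eq, S.J_AdL hh hu, S.metric_AdL hh (S.dτ_sq_J hu) hv]

theorem dτ_sq_tangent (F : ℂ → S.G) (z v : ℂ) :
    S.dτ (S.dτ (S.tangent F z v)) = -S.tangent F z v := S.dτ_sq_mPart _

/-! ### Eigenspaces of `τ` -/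

/-- The projection of `𝔤` onto the fixed subalgebra of `τ`. -/
def zeroPart : S.𝔤 →ₗ[ℝ] S.𝔤 :=
  (1 / 2 : ℝ) • ((LinearMap.id + (S.dτ : S.𝔤 →ₗ[ℝ] S.𝔤)) ∘ₗ S.hPart)

/-- The projection of `𝔤` onto the line `{X | τ X = -X}`. -/
def twoPart : S.𝔤 →ₗ[ℝ] S.𝔤 :=
  (1 / 2 : ℝ) • ((LinearMap.id - (S.dτ : S.𝔤 →ₗ[ℝ] S.𝔤)) ∘ₗ S.hPart)

theorem zeroPart_apply (X : S.𝔤) : S.zeroPart X = (1 / 2 : ℝ) • (S.hPart X + S.dτ (S.hPart X)) :=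
  rfl

theorem twoPart_apply (X : S.𝔤) : S.twoPart X = (1 / 2 : ℝ) • (S.hPart X - S.dτ (S.hPart X)) := rfl

@[simp] theorem dτ_zeroPart (X : S.𝔤) : S.dτ (S.zeroPart X) = S.zeroPart X := by
  rw [zeroPart_apply, map_smul, map_add, dτ_sq_hPart, add_comm]

@[simp] theorem dτ_twoPart (X : S.𝔤) : S.dτ (S.twoPart X) = -S.twoPart X := by
  rw [twoPart_apply, map_smul, map_sub, dτ_sq_hPart]
  module

theorem zeroPart_add_twoPart (X : S.𝔤) : S.zeroPart X + S.twoPart X = S.hPart X := by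
  rw [zeroPart_apply, twoPart_apply]; module

theorem eigenPart_apply (a : ℤ) (X : S.𝔤) : S.eigenPart a X = (1 / 4 : ℂ) •
    ((X : Matrix n n ℂ) + (Complex.I ^ (-a) : ℂ) • (S.dτ X : Matrix n n ℂ)
      + (Complex.I ^ (-(a * 2)) : ℂ) • (S.dτ (S.dτ X) : Matrix n n ℂ)
      + (Complex.I ^ (-(a * 3)) : ℂ) • (S.dτ (S.dτ (S.dτ X)) : Matrix n n ℂ)) := by
  simp [eigenPart, Finset.sum_range_succ, incl, pow_succ]

theorem coe_smul_real (c : ℝ) (X : S.𝔤) :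
    ((c • X : S.𝔤) : Matrix n n ℂ) = (c : ℂ) • (X : Matrix n n ℂ) := by
  ext i j
  simp [Matrix.smul_apply]

theorem eigenPart_zero (X : S.𝔤) : S.eigenPart 0 X = (S.zeroPart X : Matrix n n ℂ) := by
  rw [eigenPart_apply]
  simp only [zeroPart_apply, hPart_apply, mPart_apply, map_sub, map_smul, coe_smul_real,
    Submodule.coe_add, Submodule.coe_sub]
  simp
  module

theorem eigenPart_two (X : S.𝔤) : S.eigenPart 2 X = (S.twoPart X : Matrix n n ℂ) := by
  rw [eigenPart_apply]
  have h1 : (Complex.I : ℂ) ^ (-2 : ℤ) = -1 := by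
    rw [zpow_neg]; norm_num [zpow_ofNat]
  have h2 : (Complex.I : ℂ) ^ (-(2 * 2) : ℤ) = 1 := by
    rw [zpow_neg, show (2 * 2 : ℤ) = (4 : ℕ) by norm_num, zpow_natCast]; simp
  have h3 : (Complex.I : ℂ) ^ (-(2 * 3) : ℤ) = -1 := by
    rw [zpow_neg, show (2 * 3 : ℤ) = (4 + 2 : ℕ) by norm_num, zpow_natCast, pow_add]; norm_num
  rw [h1, h2, h3]
  simp only [twoPart_apply, hPart_apply, mPart_apply, map_sub, map_smul, coe_smul_real,
    Submodule.coe_sub]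
  push_cast
  module

theorem eigenPart_neg_one (X : S.𝔤) : S.eigenPart (-1) X = (1 / 2 : ℂ) •
    ((S.mPart X : Matrix n n ℂ) + Complex.I • (S.dτ (S.mPart X) : Matrix n n ℂ)) := by
  rw [eigenPart_apply]
  have h2 : (Complex.I : ℂ) ^ (-(-1 * 2) : ℤ) = -1 := by norm_num [zpow_ofNat]
  have h3 : (Complex.I : ℂ) ^ (-(-1 * 3) : ℤ) = -Complex.I := by
    rw [show (-(-1 * 3) : ℤ) = (3 : ℕ) by norm_num, zpow_natCast, Complex.I_pow_three]
  rw [neg_neg, zpow_one, h2, h3]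
  simp only [mPart_apply, map_sub, map_smul, coe_smul_real, Submodule.coe_sub]
  push_cast
  module

theorem eigenPart_one (X : S.𝔤) : S.eigenPart 1 X = (1 / 2 : ℂ) •
    ((S.mPart X : Matrix n n ℂ) - Complex.I • (S.dτ (S.mPart X) : Matrix n n ℂ)) := by
  rw [eigenPart_apply]
  have h1 : (Complex.I : ℂ) ^ (-1 : ℤ) = -Complex.I := by simp
  have h2 : (Complex.I : ℂ) ^ (-(1 * 2) : ℤ) = -1 := by
    rw [one_mul, zpow_neg]; norm_num [zpow_ofNat]
  have h3 : (Complex.I : ℂ) ^ (-(1 * 3) : ℤ) = Complex.I := by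
    rw [zpow_neg, show (1 * 3 : ℤ) = (3 : ℕ) by norm_num, zpow_natCast, Complex.I_pow_three]
    simp
  rw [h1, h2, h3]
  simp only [mPart_apply, map_sub, map_smul, coe_smul_real, Submodule.coe_sub]
  push_cast
  module

/-- The relation puts iv = -u in 𝔤, so v = 0 because 𝔤 is a real form. Complex equations thus split
into two equations in 𝔤. -/
theorem eq_zero_of_add_I_smul {u v : S.𝔤}
    (h : (u : Matrix n n ℂ) + Complex.I • (v : Matrix n n ℂ) = 0) : u = 0 ∧ v = 0 := by
  have h1 : Complex.I • (v : Matrix n n ℂ) = ((-u : S.𝔤) : Matrix n n ℂ) := by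
    rw [Submodule.coe_neg]; exact (neg_eq_of_add_eq_zero_right h).symm
  have h2 : (v : Matrix n n ℂ) = 0 := S.totally_real _ v.2 (h1 ▸ (-u).2)
  rw [h2, smul_zero, add_zero] at h
  exact ⟨Subtype.ext h, Subtype.ext h2⟩

end HermitianSymmetricSpace

/-! ### Real-linear forms on ℂ and their (1,0)- and (0,1)-parts. -/

theorem complex_linearMap_eq_zero_iff {M : Type*} [AddCommGroup M] [Module ℝ M]
    {φ : ℂ →ₗ[ℝ] M} : φ = 0 ↔ φ 1 = 0 ∧ φ Complex.I = 0 := by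
  refine ⟨fun h => by simp [h], fun h => LinearMap.ext fun v => ?_⟩
  have e : v = v.re • (1 : ℂ) + v.im • Complex.I := by
    simp [Complex.re_add_im]
  rw [e, map_add, map_smul, map_smul, h.1, h.2]
  simp

theorem complex_linearMap_apply {M : Type*} [AddCommGroup M] [Module ℝ M]
    (φ : ℂ →ₗ[ℝ] M) (v : ℂ) : φ v = v.re • φ 1 + v.im • φ Complex.I := by
  rw [← map_smul, ← map_smul, ← map_add]
  simp [Complex.re_add_im]

/-- Pairing with the e i proves independence, so B need not be symmetric or definite; the dimension
count then gives spanning. -/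
theorem exists_sum_smul_eq_of_orthonormal {V ι : Type*} [AddCommGroup V] [Module ℝ V]
    [FiniteDimensional ℝ V] [Fintype ι] [DecidableEq ι] (B : V →ₗ[ℝ] V →ₗ[ℝ] ℝ) {e : ι → V}
    (he : ∀ i j, B (e i) (e j) = if i = j then 1 else 0) {N : Submodule ℝ V}
    (heN : ∀ i, e i ∈ N) (hN : Module.finrank ℝ N = Fintype.card ι) {u : V} (hu : u ∈ N) :
    ∃ g : ι → ℝ, ∑ i, g i • e i = u := by
  have hli : LinearIndependent ℝ (fun i => (⟨e i, heN i⟩ : N)) := by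
    rw [Fintype.linearIndependent_iff]
    intro g hg i
    have h1 : ∑ j, g j • e j = 0 := by simpa using congrArg Subtype.val hg
    simpa [map_sum, he] using congrArg (B (e i)) h1
  have hspan := hli.span_eq_top_of_card_eq_finrank' hN.symm
  have hu' : (⟨u, hu⟩ : N) ∈ Submodule.span ℝ (Set.range fun i => (⟨e i, heN i⟩ : N)) := by
    rw [hspan]; trivial
  obtain ⟨g, hg⟩ := (Submodule.mem_span_range_iff_exists_fun ℝ).1 hu'
  exact ⟨g, by simpa using congrArg Subtype.val hg⟩

section

variable {n : Type*}

theorem formPart10_one (φ : ℂ → ℂ →ₗ[ℝ] Matrix n n ℂ) (z : ℂ) :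
    formPart10 φ z 1 = (1 / 2 : ℂ) • (φ z 1 - Complex.I • φ z Complex.I) := by
  simp [formPart10, mulI]

theorem formPart10_I (φ : ℂ → ℂ →ₗ[ℝ] Matrix n n ℂ) (z : ℂ) :
    formPart10 φ z Complex.I = Complex.I • formPart10 φ z 1 := by
  have e : φ z (Complex.I * Complex.I) = -φ z 1 := by rw [Complex.I_mul_I, map_neg]
  have h : formPart10 φ z Complex.I
      = (1 / 2 : ℂ) • (φ z Complex.I - Complex.I • φ z (Complex.I * Complex.I)) := rfl
  rw [h, e, formPart10_one, smul_comm Complex.I, smul_sub Complex.I, smul_smul, Complex.I_mul_I]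
  module

theorem formPart01_one (φ : ℂ → ℂ →ₗ[ℝ] Matrix n n ℂ) (z : ℂ) :
    formPart01 φ z 1 = (1 / 2 : ℂ) • (φ z 1 + Complex.I • φ z Complex.I) := by
  simp [formPart01, mulI]

theorem formPart01_I (φ : ℂ → ℂ →ₗ[ℝ] Matrix n n ℂ) (z : ℂ) :
    formPart01 φ z Complex.I = -(Complex.I • formPart01 φ z 1) := by
  have e : φ z (Complex.I * Complex.I) = -φ z 1 := by rw [Complex.I_mul_I, map_neg]
  have h : formPart01 φ z Complex.I
      = (1 / 2 : ℂ) • (φ z Complex.I + Complex.I • φ z (Complex.I * Complex.I)) := rfl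
  rw [h, e, formPart01_one, smul_comm Complex.I, smul_add Complex.I, smul_smul, Complex.I_mul_I]
  module

theorem formPart10_eq_zero_iff {φ : ℂ → ℂ →ₗ[ℝ] Matrix n n ℂ} {z : ℂ} :
    formPart10 φ z = 0 ↔ φ z 1 - Complex.I • φ z Complex.I = 0 := by
  rw [complex_linearMap_eq_zero_iff, formPart10_I, formPart10_one]
  constructor
  · rintro ⟨h, -⟩
    exact (smul_eq_zero.1 h).resolve_left (by norm_num)
  · intro h
    simp [h]

theorem formPart01_eq_zero_iff {φ : ℂ → ℂ →ₗ[ℝ] Matrix n n ℂ} {z : ℂ} :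
    formPart01 φ z = 0 ↔ φ z 1 + Complex.I • φ z Complex.I = 0 := by
  rw [complex_linearMap_eq_zero_iff, formPart01_I, formPart01_one]
  constructor
  · rintro ⟨h, -⟩
    exact (smul_eq_zero.1 h).resolve_left (by norm_num)
  · intro h
    simp [h]

end

namespace HermitianSymmetricSpace

variable {n : Type*} [Fintype n] [DecidableEq n] (S : HermitianSymmetricSpace n)

theorem component_apply (a : ℤ) (α : ℂ → ℂ →ₗ[ℝ] S.𝔤) (z v : ℂ) :
    S.component a α z v = S.eigenPart a (α z v) := rfl

/-- Each of the two conditions reads (A - τB) ± i(B + τA) = 0, and A - τB = 0 follows from B + τA =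
0 since τ² = -1 on 𝔪. -/
theorem partiallyPrimitive_iff (α : ℂ → ℂ →ₗ[ℝ] S.𝔤) (z : ℂ) :
    (formPart01 (S.component (-1) α) z = 0 ∧ formPart10 (S.component 1 α) z = 0) ↔
      S.mPart (α z Complex.I) = -S.dτ (S.mPart (α z 1)) := by
  set A := S.mPart (α z 1) with hA
  set B := S.mPart (α z Complex.I) with hB
  have hAA : S.dτ (S.dτ A) = -A := S.dτ_sq_mPart _
  have e1 : S.component (-1) α z 1 + Complex.I • S.component (-1) α z Complex.I
      = (1 / 2 : ℂ) • (((A - S.dτ B : S.𝔤) : Matrix n n ℂ)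
        + Complex.I • ((B + S.dτ A : S.𝔤) : Matrix n n ℂ)) := by
    rw [component_apply, component_apply, eigenPart_neg_one, eigenPart_neg_one, ← hA, ← hB,
      smul_comm Complex.I, smul_add Complex.I, smul_smul, Complex.I_mul_I, Submodule.coe_sub,
      Submodule.coe_add]
    module
  have e2 : S.component 1 α z 1 - Complex.I • S.component 1 α z Complex.I
      = (1 / 2 : ℂ) • (((A - S.dτ B : S.𝔤) : Matrix n n ℂ)
        + Complex.I • ((-(B + S.dτ A) : S.𝔤) : Matrix n n ℂ)) := by
    rw [component_apply, component_apply, eigenPart_one, eigenPart_one, ← hA, ← hB,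
      smul_comm Complex.I, smul_sub Complex.I, smul_smul, Complex.I_mul_I, Submodule.coe_sub,
      Submodule.coe_neg, Submodule.coe_add]
    module
  rw [formPart01_eq_zero_iff, formPart10_eq_zero_iff, e1, e2]
  constructor
  · rintro ⟨h, -⟩
    exact eq_neg_of_add_eq_zero_left
      (S.eq_zero_of_add_I_smul ((smul_eq_zero.1 h).resolve_left (by norm_num))).2
  · intro h
    have h1 : B + S.dτ A = 0 := by rw [h, neg_add_cancel]
    have h2 : A - S.dτ B = 0 := by rw [h, map_neg, hAA, neg_neg, sub_self]
    rw [h1, h2]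
    simp

theorem formPart10_ne_zero_iff {α : ℂ → ℂ →ₗ[ℝ] S.𝔤} {z : ℂ}
    (h : S.mPart (α z Complex.I) = -S.dτ (S.mPart (α z 1))) :
    formPart10 (S.component (-1) α) z ≠ 0 ↔ S.mPart (α z 1) ≠ 0 := by
  rw [not_iff_not, formPart10_eq_zero_iff, component_apply, component_apply, eigenPart_neg_one,
    eigenPart_neg_one, h, map_neg, S.dτ_sq_mPart, neg_neg]
  have e : (1 / 2 : ℂ) • ((S.mPart (α z 1) : Matrix n n ℂ)
        + Complex.I • (S.dτ (S.mPart (α z 1)) : Matrix n n ℂ))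
      - Complex.I • (1 / 2 : ℂ) • (((-S.dτ (S.mPart (α z 1)) : S.𝔤) : Matrix n n ℂ)
        + Complex.I • (S.mPart (α z 1) : Matrix n n ℂ))
      = (S.mPart (α z 1) : Matrix n n ℂ)
        + Complex.I • (S.dτ (S.mPart (α z 1)) : Matrix n n ℂ) := by
    rw [smul_comm Complex.I, smul_add Complex.I, smul_smul, Complex.I_mul_I, Submodule.coe_neg]
    module
  rw [e]
  constructor
  · exact fun h => (S.eq_zero_of_add_I_smul h).1
  · intro h
    simp [h]

/-! ### Unitary frames -/

section Frame

variable {S} {ε : Fin 2 → S.𝔤}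

theorem IsUnitaryFrame.ne_zero (hε : S.IsUnitaryFrame ε) : ε 0 ≠ 0 := by
  intro h
  have := hε.2.1 0 0
  rw [h] at this
  simp at this

theorem IsUnitaryFrame.dτ_one (hε : S.IsUnitaryFrame ε) : S.dτ (ε 1) = ε 0 := by
  have h1 : ε 1 = -S.dτ (ε 0) := by rw [hε.2.2.2, neg_neg]
  rw [h1, map_neg, hε.1, neg_neg]

/-- The four vectors ε j and Jε j are orthonormal in the four-dimensional space 𝔪. -/
theorem IsUnitaryFrame.exists_eq_sum (hε : S.IsUnitaryFrame ε) {u : S.𝔤}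
    (hu : S.dτ (S.dτ u) = -u) :
    ∃ c : Fin 2 → ℂ, u = ∑ i, S.complexSmul (c i) (ε i) := by
  obtain ⟨h1, h2, h3, h4⟩ := hε
  set N := LinearMap.ker ((S.dτ : S.𝔤 →ₗ[ℝ] S.𝔤) ∘ₗ (S.dτ : S.𝔤 →ₗ[ℝ] S.𝔤) + LinearMap.id)
    with hN
  have hmem : ∀ w : S.𝔤, w ∈ N ↔ S.dτ (S.dτ w) = -w := by
    intro w
    rw [hN, LinearMap.mem_ker]
    exact eq_neg_iff_add_eq_zero.symm
  let e : Fin 2 × Bool → S.𝔤 := fun p => if p.2 then S.lieB S.Y (ε p.1) else ε p.1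
  have heN : ∀ p, e p ∈ N := by
    rintro ⟨j, b⟩
    rw [hmem]
    cases b
    · exact h1 j
    · exact S.dτ_sq_J (h1 j)
  have h5 : ∀ j k, S.metric (S.lieB S.Y (ε j)) (ε k) = 0 := h3
  have h6 : ∀ j k, S.metric (ε j) (S.lieB S.Y (ε k)) = 0 := fun j k => by
    rw [S.metric_symm _ _ (h1 j) (S.dτ_sq_J (h1 k)), h5]
  have hon : ∀ p q, S.metric (e p) (e q) = if p = q then 1 else 0 := by
    rintro ⟨j, b⟩ ⟨k, c⟩
    cases b <;> cases c <;> simp [e, h2, h5, h6, S.metric_J_J (h1 j) (h1 k)]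
  obtain ⟨g, h9⟩ := exists_sum_smul_eq_of_orthonormal S.metric hon heN
    (S.finrank_𝔪.trans (by simp)) ((hmem u).2 hu)
  refine ⟨fun i => ⟨g (i, false), g (i, true)⟩, ?_⟩
  rw [← h9, Fintype.sum_prod_type]
  simp [complexSmul, e, J_eq, add_comm]

theorem IsUnitaryFrame.dτ_sum (hε : S.IsUnitaryFrame ε) (c : Fin 2 → ℂ) :
    S.dτ (∑ i, S.complexSmul (c i) (ε i)) = S.complexSmul (star (c 1)) (ε 0)
      - S.complexSmul (star (c 0)) (ε 1) := by
  simp only [Fin.sum_univ_two, complexSmul, J_eq, map_add, map_smul, S.dτ_J, hε.2.2.2, hε.dτ_one,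
    map_neg, Complex.star_def, Complex.conj_re, Complex.conj_im]
  module

/-- The matrices `r k`, `r ≥ 0` and `k ∈ SU(2)`, transform the unitary frame into the pairs of
vectors `(A, -τ A)`. -/
theorem IsUnitaryFrame.exists_specialUnitary_iff (hε : S.IsUnitaryFrame ε) {A B : S.𝔤} (hA : S.dτ (S.dτ A) = -A) :
    (∃ r : ℝ, 0 ≤ r ∧ ∃ k ∈ Matrix.specialUnitaryGroup (Fin 2) ℂ,
      A = r • ∑ i, S.complexSmul (k i 0) (ε i) ∧ B = r • ∑ i, S.complexSmul (k i 1) (ε i)) ↔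
      B = -S.dτ A := by
  constructor
  · rintro ⟨r, -, k, hk, rfl, rfl⟩
    rw [Matrix.mem_specialUnitaryGroup_iff, Matrix.mem_unitaryGroup_iff'] at hk
    obtain ⟨hk1, hk2⟩ := hk
    -- For k in SU(2) the adjoint is the inverse, which is the adjugate; this gives the second
    -- column in terms of the first.
    have h1 : star k = k.adjugate := by
      calc star k = star k * (k * k.adjugate) := by rw [Matrix.mul_adjugate, hk2]; simp
        _ = k.adjugate := by rw [← mul_assoc, hk1, one_mul]
    have h2 : star (k 0 0) = k 1 1 := by
      have := congrFun (congrFun h1 0) 0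
      simpa [Matrix.adjugate_fin_two, Matrix.star_apply] using this
    have h3 : star (k 1 0) = -k 0 1 := by
      have := congrFun (congrFun h1 0) 1
      simpa [Matrix.adjugate_fin_two, Matrix.star_apply] using this
    rw [map_smul, hε.dτ_sum, h2, h3]
    simp only [Fin.sum_univ_two, complexSmul, Complex.neg_re, Complex.neg_im]
    module
  · rintro rfl
    obtain ⟨c, rfl⟩ := hε.exists_eq_sum hA
    set s : ℝ := Complex.normSq (c 0) + Complex.normSq (c 1) with hs
    have hs0 : 0 ≤ s := add_nonneg (Complex.normSq_nonneg _) (Complex.normSq_nonneg _)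
    rcases hs0.eq_or_lt with h0 | hpos
    · have hc0 : c 0 = 0 := by
        rw [← Complex.normSq_eq_zero]
        linarith [Complex.normSq_nonneg (c 0), Complex.normSq_nonneg (c 1)]
      have hc1 : c 1 = 0 := by
        rw [← Complex.normSq_eq_zero]
        linarith [Complex.normSq_nonneg (c 0), Complex.normSq_nonneg (c 1)]
      -- If A = 0 the radius is 0 and any element of SU(2) serves.
      refine ⟨0, le_rfl, 1, one_mem _, ?_, ?_⟩ <;>
        simp [Fin.sum_univ_two, hc0, hc1, complexSmul]
    · set r : ℝ := √s with hr
      have hr0 : 0 < r := Real.sqrt_pos.2 hpos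
      have hrr : (r : ℂ) * r = s := by
        rw [← Complex.ofReal_mul, Real.mul_self_sqrt hs0]
      have hrC : (r : ℂ) ≠ 0 := by exact_mod_cast hr0.ne'
      have hss : c 0 * star (c 0) + c 1 * star (c 1) = r * r := by
        rw [hrr, hs, Complex.star_def, Complex.mul_conj, Complex.mul_conj]
        push_cast; rfl
      -- The first column is the normalised coordinate vector of A. Membership in SU(2) forces the
      -- second, which by `dτ_sum` holds the coordinates of -τA.
      refine ⟨r, hr0.le, !![c 0 / r, -star (c 1) / r; c 1 / r, star (c 0) / r], ?_, ?_, ?_⟩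
      · rw [Matrix.mem_specialUnitaryGroup_iff, Matrix.mem_unitaryGroup_iff]
        constructor
        · ext i j
          fin_cases i <;> fin_cases j <;>
            simp [Matrix.mul_apply, Fin.sum_univ_two, Matrix.star_apply] <;> field_simp <;>
            simp only [Complex.star_def] at hss <;> first | linear_combination hss | ring
        · rw [Matrix.det_fin_two_of]
          field_simp
          linear_combination hss
      · have e : ∀ x : ℂ, x = (r : ℂ) * (x / r) := fun x => by field_simp
        have e' : ∀ (x : ℂ) (u : S.𝔤), S.complexSmul x u = r • S.complexSmul (x / r) u := by
          intro x u
          conv_lhs => rw [e x]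
          simp only [complexSmul, Complex.re_ofReal_mul, Complex.im_ofReal_mul]
          module
        simp only [Fin.sum_univ_two, e' (c 0), e' (c 1), smul_add]
        simp
      · have e' : ∀ (x : ℂ) (u : S.𝔤), r • S.complexSmul (x / r) u = S.complexSmul x u := by
          intro x u
          have e : x = (r : ℂ) * (x / r) := by field_simp
          conv_rhs => rw [e]
          simp only [complexSmul, Complex.re_ofReal_mul, Complex.im_ofReal_mul]
          module
        rw [hε.dτ_sum]
        simp only [Fin.sum_univ_two, smul_add]
        simp only [Matrix.of_apply, Matrix.cons_val', Matrix.cons_val_zero, Matrix.cons_val_one,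
          Matrix.cons_val_fin_one, e']
        simp only [complexSmul, Complex.neg_re, Complex.neg_im]
        module

end Frame

end HermitianSymmetricSpace

/-! ### Lagrangian lifts and partial primitivity. -/

namespace HermitianSymmetricSpace

variable {n : Type*} [Fintype n] [DecidableEq n] {S : HermitianSymmetricSpace n}

theorem tangent_apply (F : ℂ → S.G) {z : ℂ} (hF : DifferentiableAt ℝ (fun w => S.mat (F w)) z)
    (v : ℂ) : S.tangent F z v = v.re • S.tangent F z 1 + v.im • S.tangent F z Complex.I := by
  simp only [S.tangent_eq (S.hasLogDerivAt_mcForm hF)]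
  rw [complex_linearMap_apply (S.mcForm F z) v, map_add, map_smul, map_smul]

theorem IsLift.hasLogDerivAt {F : ℂ → S.G} {f : ℂ → S.G ⧸ S.H} {U : Set ℂ}
    {α : ℂ → ℂ →ₗ[ℝ] S.𝔤} (hU : IsOpen U) (hF : S.IsLift F f U)
    (hα : S.IsMaurerCartanForm α F U) {z : ℂ} (hz : z ∈ U) :
    HasLogDerivAt (fun w => S.mat (F w)) (S.coeForm α) z :=
  (S.isMaurerCartanForm_iff hU hF.1).1 hα z hz

theorem isFlatOn_of_isMaurerCartanForm {F : ℂ → S.G} {U : Set ℂ} {α : ℂ → ℂ →ₗ[ℝ] S.𝔤}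
    (hU : IsOpen U) (hF : ContDiffOn ℝ ∞ (fun w => S.mat (F w)) U) (hαs : S.IsSmoothForm α U)
    (hα : S.IsMaurerCartanForm α F U) : IsFlatOn (S.complexForm α) U := by
  have h1 := (S.isMaurerCartanForm_iff hU hF).1 hα
  intro z hz v w
  have hn := hU.mem_nhds hz
  exact flat_of_hasLogDerivAt (α := S.coeForm α) (F := fun w => S.mat (F w))
    (Fi := fun w => S.mat (F w)⁻¹) (S.mat_inv_mul (F z))
    (by filter_upwards [hn] with p hp using h1 p hp)
    ((hF.contDiffAt hn).of_le (WithTop.coe_le_coe.2 le_top))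
    (fun v => ((hαs v).contDiffAt hn).differentiableAt (by simp)) v w

variable {F : ℂ → S.G} {f : ℂ → S.G ⧸ S.H} {U : Set ℂ}

theorem metric_dτ_dτ {u : S.𝔤} (hu : S.dτ (S.dτ u) = -u) :
    S.metric (-S.dτ u) (-S.dτ u) = S.metric u u := by
  rw [map_neg, map_neg, LinearMap.neg_apply, neg_neg, S.metric_τ u u hu hu]

/-- The definitions quantify over all local lifts. Another lift changes the tangent vectors by Ad H,
which preserves the metric and J, so a single lift decides. -/
theorem IsLift.isConformalLagrangian (hU : IsOpen U) (hF : S.IsLift F f U)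
    (h : ∀ z ∈ U, S.tangent F z Complex.I = -S.dτ (S.tangent F z 1)) :
    S.IsConformalLagrangian f U := by
  refine ⟨fun z hz => ⟨U, subset_rfl, hU, hz, F, hF⟩, ?_, ?_⟩
  · intro V hVU hV F' hF' z hz
    obtain ⟨g, hg, hgv⟩ := S.tangent_eq_Ad hU hV hF hF' (hVU hz) hz
    have hm := S.dτ_sq_tangent F z
    rw [hgv, hgv, S.metric_AdL hg (hm _) (hm _), S.metric_AdL hg (hm _) (hm _),
      S.metric_AdL hg (hm _) (hm _), h z (hVU hz), metric_dτ_dτ (hm 1)]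
    refine ⟨rfl, ?_⟩
    rw [map_neg, S.metric_dτ_self (hm 1), neg_zero]
  · intro V hVU hV F' hF' z hz v w
    obtain ⟨g, hg, hgv⟩ := S.tangent_eq_Ad hU hV hF hF' (hVU hz) hz
    have hm := S.dτ_sq_tangent F z
    have hd := hF.differentiableAt hU (hVU hz)
    have hm' := S.dτ_sq_dτ (hm 1)
    have hJ := S.dτ_sq_J (hm 1)
    rw [hgv, hgv, S.kahler_AdL hg (hm _) (hm _), tangent_apply F hd v, tangent_apply F hd w,
      h z (hVU hz)]
    have e1 := S.metric_J_self (hm 1)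
    have e2 := S.metric_J_dτ_self (hm 1)
    have e3 : S.metric (S.lieB S.Y (S.dτ (S.tangent F z 1))) (S.tangent F z 1) = 0 := by
      rw [S.metric_J_left hm' (hm 1), S.metric_symm _ _ hm' hJ, e2, neg_zero]
    have e4 := S.metric_J_self hm'
    simp only [kahler, J_eq, map_add, map_smul, map_neg, LinearMap.add_apply, LinearMap.smul_apply,
      LinearMap.neg_apply, e1, e2, e3, e4]
    simp

/-- The images of 1 and i are orthogonal and of equal length, so df is injective as soon as the
first is nonzero. -/
theorem IsLift.immersedSet_eq (hU : IsOpen U) (hF : S.IsLift F f U)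
    (h : ∀ z ∈ U, S.tangent F z Complex.I = -S.dτ (S.tangent F z 1)) :
    S.immersedSet f U = {z ∈ U | S.tangent F z 1 ≠ 0} := by
  ext z
  constructor
  · rintro ⟨V, hVU, hV, hz, F', hF', hinj⟩
    refine ⟨hVU hz, fun h0 => ?_⟩
    obtain ⟨g, hg, hgv⟩ := S.tangent_eq_Ad hU hV hF hF' (hVU hz) hz
    have h1 : S.tangent F' z 1 = 0 := by rw [hgv, h0, map_zero]
    have h2 : S.tangent F' z 0 = 0 := by
      rw [tangent_apply F' (hF'.differentiableAt hV hz)]; simp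
    exact one_ne_zero (hinj (h1.trans h2.symm))
  · rintro ⟨hz, h0⟩
    refine ⟨U, subset_rfl, hU, hz, F, hF, fun v w hvw => ?_⟩
    have hm := S.dτ_sq_tangent F z
    have hpos := S.metric_pos _ (hm 1) h0
    have hd := hF.differentiableAt hU hz
    have h3 := S.metric_dτ_self (hm 1)
    have h4 : S.metric (S.dτ (S.tangent F z 1)) (S.tangent F z 1) = 0 := by
      rw [S.metric_symm _ _ (S.dτ_sq_dτ (hm 1)) (hm 1), h3]
    rw [tangent_apply F hd v, tangent_apply F hd w, h z hz] at hvw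
    have h1 := congrArg (S.metric (S.tangent F z 1)) hvw
    have h2 := congrArg (S.metric (S.dτ (S.tangent F z 1))) hvw
    simp only [map_add, map_smul, map_neg, h3, h4, smul_eq_mul, neg_zero, mul_zero, add_zero,
      zero_add, S.metric_τ _ _ (hm 1) (hm 1)] at h1 h2
    refine Complex.ext (mul_right_cancel₀ hpos.ne' h1) ?_
    have h5 : v.im * S.metric (S.tangent F z 1) (S.tangent F z 1)
        = w.im * S.metric (S.tangent F z 1) (S.tangent F z 1) := by linarith
    exact mul_right_cancel₀ hpos.ne' h5

variable {ε : Fin 2 → S.𝔤} {α : ℂ → ℂ →ₗ[ℝ] S.𝔤}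

theorem IsLift.tangent_eq (hU : IsOpen U) (hF : S.IsLift F f U)
    (hα : S.IsMaurerCartanForm α F U) {z : ℂ} (hz : z ∈ U) (v : ℂ) :
    S.tangent F z v = S.mPart (α z v) := S.tangent_eq (hF.hasLogDerivAt hU hα hz) v

theorem IsLagrangianLift.tangent_I (hε : S.IsUnitaryFrame ε)
    (hF : S.IsLagrangianLift ε F f U) : ∀ z ∈ U, S.tangent F z Complex.I = -S.dτ (S.tangent F z 1) :=
  fun z hz => (hε.exists_specialUnitary_iff (S.dτ_sq_tangent F z 1)).1 (hF.2 z hz)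

theorem IsLagrangianLift.isPartiallyPrimitive (hε : S.IsUnitaryFrame ε) (hU : IsOpen U)
    (hF : S.IsLagrangianLift ε F f U) (hα : S.IsMaurerCartanForm α F U) :
    S.IsPartiallyPrimitive α U := by
  intro z hz
  rw [S.partiallyPrimitive_iff, ← hF.1.tangent_eq hU hα hz, ← hF.1.tangent_eq hU hα hz]
  exact hF.tangent_I hε z hz

/-- A flat and partially primitive form is the Maurer–Cartan form of a Lagrangian lift of a weakly
conformal Lagrangian map. -/
theorem exists_isLagrangianLift (hε : S.IsUnitaryFrame ε) (hU : IsOpen U)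
    (hU' : SimplyConnectedSpace U) (hαs : S.IsSmoothForm α U)
    (hflat : IsFlatOn (S.complexForm α) U) (hpp : S.IsPartiallyPrimitive α U) :
    ∃ (f : ℂ → S.G ⧸ S.H) (F : ℂ → S.G), S.IsConformalLagrangian f U ∧
      S.IsLagrangianLift ε F f U ∧ S.IsMaurerCartanForm α F U := by
  obtain ⟨F, hF⟩ := S.exists_hasLogDerivAt hU hU' hαs hflat
  have hs : ContDiffOn ℝ ∞ (fun w => S.mat (F w)) U :=
    contDiffOn_of_hasLogDerivAt (α := S.coeForm α) hU hαs hF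
  have hl : S.IsLift F (fun z => (F z : S.G ⧸ S.H)) U := ⟨hs, fun _ _ => rfl⟩
  have ht : ∀ z ∈ U, S.tangent F z Complex.I = -S.dτ (S.tangent F z 1) := by
    intro z hz
    rw [S.tangent_eq (hF z hz), S.tangent_eq (hF z hz)]
    exact (S.partiallyPrimitive_iff α z).1 (hpp z hz)
  exact ⟨_, F, hl.isConformalLagrangian hU ht,
    ⟨hl, fun z hz => (hε.exists_specialUnitary_iff (S.dτ_sq_tangent F z 1)).2 (ht z hz)⟩,
    (S.isMaurerCartanForm_iff hU hs).2 hF⟩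

theorem IsLagrangianLift.immersedSet_eq_iff (hε : S.IsUnitaryFrame ε) (hU : IsOpen U)
    (hF : S.IsLagrangianLift ε F f U) (hα : S.IsMaurerCartanForm α F U) :
    S.immersedSet f U = U ↔ ∀ z ∈ U, formPart10 (S.component (-1) α) z ≠ 0 := by
  have ht := hF.tangent_I hε
  rw [hF.1.immersedSet_eq hU ht, Set.sep_eq_self_iff_mem_true]
  refine forall₂_congr fun z hz => ?_
  have ht' := ht z hz
  rw [hF.1.tangent_eq hU hα hz, hF.1.tangent_eq hU hα hz] at ht'
  rw [S.formPart10_ne_zero_iff ht', hF.1.tangent_eq hU hα hz]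

end HermitianSymmetricSpace

/-! ### Curvature computations. -/

/-- The curvature of a form on `ℂ` is determined by its value on `(∂/∂x, ∂/∂y)`. -/
theorem curvature_eq_smul {A : Type*} [NormedRing A] [NormedAlgebra ℝ A]
    {φ : ℂ → ℂ →ₗ[ℝ] A} {z : ℂ} (hφ : ∀ v, DifferentiableAt ℝ (fun p => φ p v) z) (v w : ℂ) :
    fderiv ℝ (fun p => φ p w) z v - fderiv ℝ (fun p => φ p v) z w
      + (φ z v * φ z w - φ z w * φ z v) =
    (v.re * w.im - v.im * w.re) • (fderiv ℝ (fun p => φ p Complex.I) z 1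
      - fderiv ℝ (fun p => φ p 1) z Complex.I
      + (φ z 1 * φ z Complex.I - φ z Complex.I * φ z 1)) := by
  have h1 : ∀ v u, fderiv ℝ (fun p => φ p v) z u =
      u.re • (v.re • fderiv ℝ (fun p => φ p 1) z 1 + v.im • fderiv ℝ (fun p => φ p Complex.I) z 1)
      + u.im • (v.re • fderiv ℝ (fun p => φ p 1) z Complex.I
        + v.im • fderiv ℝ (fun p => φ p Complex.I) z Complex.I) := by
    intro v u
    have e : (fun p => φ p v) = fun p => v.re • φ p 1 + v.im • φ p Complex.I :=
      funext fun p => complex_linearMap_apply _ v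
    have h2 : HasFDerivAt (fun p => φ p v) (v.re • fderiv ℝ (fun p => φ p 1) z
        + v.im • fderiv ℝ (fun p => φ p Complex.I) z) z := by
      rw [e]
      exact ((hφ 1).hasFDerivAt.const_smul v.re).add ((hφ Complex.I).hasFDerivAt.const_smul v.im)
    rw [h2.fderiv]
    exact complex_linearMap_apply ((v.re • fderiv ℝ (fun p => φ p 1) z
        + v.im • fderiv ℝ (fun p => φ p Complex.I) z : ℂ →L[ℝ] A) : ℂ →ₗ[ℝ] A) u
  rw [h1 w v, h1 v w, complex_linearMap_apply (φ z) v, complex_linearMap_apply (φ z) w]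
  simp only [mul_add, add_mul, smul_mul_assoc, mul_smul_comm]
  module

/-- The curvature of the extended form, computed from the structure equations. -/
theorem extended_curvature {M : Type*} [Ring M] [Algebra ℂ M]
    {a b A T Y ay bx Ax Ay Tx Ty : M} {p q px py qx qy c s : ℂ} (hcs : c ^ 2 + s ^ 2 = 1)
    (h0 : bx - ay + ((a * b - b * a) - (A * T - T * A)) = 0) (hY : qx - py = 0)
    (hE : -Tx - Ay - (a * T - T * a) - (b * A - A * b) - p • (Y * T - T * Y)
      - q • (Y * A - A * Y) = 0)
    (hF : Ax - Ty + (a * A - A * a) - (b * T - T * b) + q • (Y * T - T * Y)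
      - p • (Y * A - A * Y) = 0)
    (ha : a * Y - Y * a = 0) (hb : b * Y - Y * b = 0) :
    (bx - c • Tx + s • Ax + ((c ^ 2 - s ^ 2) * qx + 2 * c * s * px) • Y)
      - (ay + c • Ay + s • Ty + ((c ^ 2 - s ^ 2) * py - 2 * c * s * qy) • Y)
      + ((a + c • A + s • T + ((c ^ 2 - s ^ 2) * p - 2 * c * s * q) • Y)
          * (b - c • T + s • A + ((c ^ 2 - s ^ 2) * q + 2 * c * s * p) • Y)
        - (b - c • T + s • A + ((c ^ 2 - s ^ 2) * q + 2 * c * s * p) • Y)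
          * (a + c • A + s • T + ((c ^ 2 - s ^ 2) * p - 2 * c * s * q) • Y))
      = (2 * c * s * (px + qy)) • Y := by
  -- The normalisation treats c and s as independent scalars, so c² + s² = 1 has to be supplied on
  -- each bracket where it is needed; the coefficients of k2 and k3 come from the double-angle
  -- formulas.
  have k1 : (c ^ 2 + s ^ 2 - 1) • (A * T - T * A) = 0 := by rw [hcs, sub_self, zero_smul]
  have k2 : (c ^ 2 + s ^ 2 - 1) • (Y * A - A * Y) = 0 := by rw [hcs, sub_self, zero_smul]
  have k3 : (c ^ 2 + s ^ 2 - 1) • (Y * T - T * Y) = 0 := by rw [hcs, sub_self, zero_smul]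
  have k4 : (qx - py) • Y = 0 := by rw [hY, zero_smul]
  simp only [mul_add, add_mul, mul_sub, sub_mul, smul_mul_assoc, mul_smul_comm]
  linear_combination (norm := module) h0 + c • hE + s • hF + (c ^ 2 - s ^ 2) • k4
    + ((c ^ 2 - s ^ 2) * q + 2 * c * s * p) • ha - ((c ^ 2 - s ^ 2) * p - 2 * c * s * q) • hb
    - k1 - (p * s + q * c) • k2 - (p * c - q * s) • k3

namespace HermitianSymmetricSpace

variable {n : Type*} [Fintype n] [DecidableEq n] (S : HermitianSymmetricSpace n)

/-! ### The structure equations -/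

theorem hPart_lie (X Z : S.𝔤) :
    S.hPart (S.lieB X Z) = S.lieB (S.hPart X) (S.hPart Z) + S.lieB (S.mPart X) (S.mPart Z) := by
  rw [hPart_apply, mPart_lie]
  conv_lhs => rw [← S.hPart_add_mPart X, ← S.hPart_add_mPart Z]
  simp only [map_add, LinearMap.add_apply, hPart_apply, map_sub, LinearMap.sub_apply,
    S.mPart_of_neg (S.dτ_sq_mPart X), S.mPart_of_neg (S.dτ_sq_mPart Z)]
  abel

/-- The linear form `X ↦ c` with `twoPart X = c Y`. -/
def yCoord (u : S.𝔤) : S.𝔤 →ₗ[ℝ] ℝ :=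
  S.metric.flip (S.lieB S.Y u) ∘ₗ S.lieB.flip u ∘ₗ S.twoPart

theorem yCoord_apply (u X : S.𝔤) :
    S.yCoord u X = S.metric (S.lieB (S.twoPart X) u) (S.lieB S.Y u) := rfl

variable {S} {ε : Fin 2 → S.𝔤}

theorem IsUnitaryFrame.twoPart_eq (hε : S.IsUnitaryFrame ε) (X : S.𝔤) :
    S.twoPart X = S.yCoord (ε 0) X • S.Y := by
  obtain ⟨c, hc⟩ := (S.eigen_two _).1 (S.dτ_twoPart X)
  rw [yCoord_apply, hc, map_smul, LinearMap.smul_apply, map_smul, LinearMap.smul_apply,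
    S.metric_J_J (hε.1 0) (hε.1 0), hε.2.1]
  simp

theorem IsUnitaryFrame.hPart_eq (hε : S.IsUnitaryFrame ε) (X : S.𝔤) :
    S.hPart X = S.zeroPart X + S.yCoord (ε 0) X • S.Y := by
  rw [← hε.twoPart_eq, zeroPart_add_twoPart]

theorem IsUnitaryFrame.lie_zeroPart_Y (hε : S.IsUnitaryFrame ε) (X : S.𝔤) :
    S.lieB (S.zeroPart X) S.Y = 0 :=
  S.lie_Y_eq_zero (hε.1 0) hε.ne_zero (S.dτ_zeroPart X)

/-- The Y-components of a and b contribute nothing, because τ-fixed elements commute with Y. -/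
theorem IsUnitaryFrame.hPart_lie_eq (hε : S.IsUnitaryFrame ε) {a b : S.𝔤}
    (hb : S.mPart b = -S.dτ (S.mPart a)) :
    S.hPart (S.lieB a b) =
      S.lieB (S.zeroPart a) (S.zeroPart b) - S.lieB (S.mPart a) (S.dτ (S.mPart a)) := by
  have h1 := hε.lie_zeroPart_Y a
  have h2 := hε.lie_zeroPart_Y b
  rw [S.lieB_skew, neg_eq_zero] at h2
  have h3 : S.lieB S.Y S.Y = 0 := Subtype.ext (by simp [S.lie_coe])
  rw [hPart_lie, hε.hPart_eq, hε.hPart_eq, hb]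
  simp only [map_add, map_smul, map_neg, LinearMap.add_apply, LinearMap.smul_apply, h1, h2, h3]
  simp [sub_eq_add_neg]

/-- Since τ² = -1 on 𝔪, τ[A, τA] = [τA, -A] = [A, τA]: the bracket has no component along Y. -/
theorem IsUnitaryFrame.dτ_hPart_lie (hε : S.IsUnitaryFrame ε) {a b : S.𝔤}
    (hb : S.mPart b = -S.dτ (S.mPart a)) :
    S.dτ (S.hPart (S.lieB a b)) = S.hPart (S.lieB a b) := by
  rw [hε.hPart_lie_eq hb, map_sub, S.dτ_lie, S.dτ_lie, S.dτ_zeroPart, S.dτ_zeroPart,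
    S.dτ_sq_mPart, map_neg, S.lieB_skew (S.mPart a)]

variable (S) in
theorem fderiv_linear_comp {E W : Type*} [NormedAddCommGroup E] [NormedSpace ℝ E]
    [NormedAddCommGroup W] [NormedSpace ℝ W] (T : S.𝔤 →ₗ[ℝ] W) {g : E → S.𝔤} {z : E} (hg : DifferentiableAt ℝ g z) :
    HasFDerivAt (fun p => T (g p))
      ((LinearMap.toContinuousLinearMap T).comp (fderiv ℝ g z)) z :=
  (LinearMap.toContinuousLinearMap T).hasFDerivAt.comp z hg.hasFDerivAt

end HermitianSymmetricSpace

namespace HermitianSymmetricSpace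

variable {n : Type*} [Fintype n] [DecidableEq n] {S : HermitianSymmetricSpace n}

/-- The derivative of `α w` in the direction `v`. -/
def formDeriv (α : ℂ → ℂ →ₗ[ℝ] S.𝔤) (z v w : ℂ) : S.𝔤 := fderiv ℝ (fun p => α p w) z v

variable {ε : Fin 2 → S.𝔤} {α : ℂ → ℂ →ₗ[ℝ] S.𝔤} {U : Set ℂ}

theorem IsSmoothForm.contDiffOn (hα : S.IsSmoothForm α U) (v : ℂ) :
    ContDiffOn ℝ ∞ (fun z => α z v) U := S.contDiffOn_of_coe (hα v)

theorem IsSmoothForm.differentiableAt (hα : S.IsSmoothForm α U) (hU : IsOpen U) {z : ℂ}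
    (hz : z ∈ U) (v : ℂ) : DifferentiableAt ℝ (fun z => α z v) z :=
  ((hα.contDiffOn v).contDiffAt (hU.mem_nhds hz)).differentiableAt (by simp)

theorem IsSmoothForm.fderiv_comp (hα : S.IsSmoothForm α U) (hU : IsOpen U) {z : ℂ}
    (hz : z ∈ U) {W : Type*} [NormedAddCommGroup W] [NormedSpace ℝ W] (T : S.𝔤 →ₗ[ℝ] W) (v w : ℂ) :
    fderiv ℝ (fun p => T (α p w)) z v = T (S.formDeriv α z v w) := by
  rw [(S.fderiv_linear_comp T (hα.differentiableAt hU hz w)).fderiv]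
  rfl

theorem IsSmoothForm.lie_flat (hα : S.IsSmoothForm α U) (hU : IsOpen U)
    (hflat : IsFlatOn (S.complexForm α) U) {z : ℂ} (hz : z ∈ U) :
    S.formDeriv α z 1 Complex.I - S.formDeriv α z Complex.I 1
      + S.lieB (α z 1) (α z Complex.I) = 0 := by
  refine Subtype.ext ?_
  have h1 := hflat z hz 1 Complex.I
  have h2 : ∀ v w, fderiv ℝ (fun p => S.complexForm α p w) z v
      = (S.formDeriv α z v w : Matrix n n ℂ) := fun v w =>
    hα.fderiv_comp hU hz S.𝔤.subtype v w
  rw [h2, h2] at h1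
  rw [Submodule.coe_add, Submodule.coe_sub, S.lie_coe]
  exact h1

/-- The derivatives of the two `𝔪`-components of a partially primitive form. -/
theorem IsSmoothForm.mPart_formDeriv (hα : S.IsSmoothForm α U) (hU : IsOpen U)
    (hpp : ∀ z ∈ U, S.mPart (α z Complex.I) = -S.dτ (S.mPart (α z 1))) {z : ℂ} (hz : z ∈ U)
    (v : ℂ) : S.mPart (S.formDeriv α z v Complex.I) = -S.dτ (S.mPart (S.formDeriv α z v 1)) := by
  rw [← hα.fderiv_comp hU hz S.mPart]
  have h1 := hα.fderiv_comp hU hz (-((S.dτ : S.𝔤 →ₗ[ℝ] S.𝔤) ∘ₗ S.mPart)) v 1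
  refine Eq.trans ?_ h1
  have he : (fun p => S.mPart (α p Complex.I)) =ᶠ[𝓝 z]
      fun p => (-((S.dτ : S.𝔤 →ₗ[ℝ] S.𝔤) ∘ₗ S.mPart)) (α p 1) := by
    filter_upwards [hU.mem_nhds hz] with p hp using hpp p hp
  exact congrArg (fun T : ℂ →L[ℝ] S.𝔤 => T v) (Filter.EventuallyEq.fderiv_eq he)

section Structure

theorem structure_zero (hε : S.IsUnitaryFrame ε) (hα : S.IsSmoothForm α U) (hU : IsOpen U)
    (hflat : IsFlatOn (S.complexForm α) U)
    (hpp : ∀ z ∈ U, S.mPart (α z Complex.I) = -S.dτ (S.mPart (α z 1))) {z : ℂ} (hz : z ∈ U) :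
    S.zeroPart (S.formDeriv α z 1 Complex.I) - S.zeroPart (S.formDeriv α z Complex.I 1)
      + (S.lieB (S.zeroPart (α z 1)) (S.zeroPart (α z Complex.I))
        - S.lieB (S.mPart (α z 1)) (S.dτ (S.mPart (α z 1)))) = 0 := by
  have h1 := congrArg S.zeroPart (hα.lie_flat hU hflat hz)
  rw [map_add, map_sub, map_zero] at h1
  have h2 : S.zeroPart (S.lieB (α z 1) (α z Complex.I))
      = S.hPart (S.lieB (α z 1) (α z Complex.I)) := by
    rw [zeroPart_apply, hε.dτ_hPart_lie (hpp z hz)]; module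
  rwa [h2, hε.hPart_lie_eq (hpp z hz)] at h1

/-- No bracket contributes along Y, so with α₂ = θ Y the Y-component of flatness is dθ = 0. -/
theorem structure_two (hε : S.IsUnitaryFrame ε) (hα : S.IsSmoothForm α U) (hU : IsOpen U)
    (hflat : IsFlatOn (S.complexForm α) U)
    (hpp : ∀ z ∈ U, S.mPart (α z Complex.I) = -S.dτ (S.mPart (α z 1))) {z : ℂ} (hz : z ∈ U) :
    S.yCoord (ε 0) (S.formDeriv α z 1 Complex.I)
      - S.yCoord (ε 0) (S.formDeriv α z Complex.I 1) = 0 := by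
  have h1 := congrArg (S.yCoord (ε 0)) (hα.lie_flat hU hflat hz)
  rw [map_add, map_sub, map_zero] at h1
  have h2 : S.yCoord (ε 0) (S.lieB (α z 1) (α z Complex.I)) = 0 := by
    rw [yCoord_apply, twoPart_apply, hε.dτ_hPart_lie (hpp z hz)]
    simp
  rwa [h2, add_zero] at h1

theorem structure_m (hε : S.IsUnitaryFrame ε) (hα : S.IsSmoothForm α U) (hU : IsOpen U)
    (hflat : IsFlatOn (S.complexForm α) U)
    (hpp : ∀ z ∈ U, S.mPart (α z Complex.I) = -S.dτ (S.mPart (α z 1))) {z : ℂ} (hz : z ∈ U) :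
    -S.dτ (S.mPart (S.formDeriv α z 1 1)) - S.mPart (S.formDeriv α z Complex.I 1)
      - S.lieB (S.zeroPart (α z 1)) (S.dτ (S.mPart (α z 1)))
      - S.lieB (S.zeroPart (α z Complex.I)) (S.mPart (α z 1))
      - S.yCoord (ε 0) (α z 1) • S.lieB S.Y (S.dτ (S.mPart (α z 1)))
      - S.yCoord (ε 0) (α z Complex.I) • S.lieB S.Y (S.mPart (α z 1)) = 0 := by
  have h1 := congrArg S.mPart (hα.lie_flat hU hflat hz)
  rw [map_add, map_sub, map_zero, hα.mPart_formDeriv hU hpp hz, mPart_lie, hpp z hz,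
    S.lieB_skew (S.mPart (α z 1)), hε.hPart_eq (α z 1), hε.hPart_eq (α z Complex.I)] at h1
  simp only [map_add, map_smul, map_neg, LinearMap.add_apply, LinearMap.smul_apply] at h1
  rw [← h1]
  module

/-- The image of `structure_m` under τ. The pair enters the extended curvature with coefficients c
and s, and this one alone gives the mean curvature. -/
theorem structure_m' (hε : S.IsUnitaryFrame ε) (hα : S.IsSmoothForm α U) (hU : IsOpen U)
    (hflat : IsFlatOn (S.complexForm α) U)
    (hpp : ∀ z ∈ U, S.mPart (α z Complex.I) = -S.dτ (S.mPart (α z 1))) {z : ℂ} (hz : z ∈ U) :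
    S.mPart (S.formDeriv α z 1 1) - S.dτ (S.mPart (S.formDeriv α z Complex.I 1))
      + S.lieB (S.zeroPart (α z 1)) (S.mPart (α z 1))
      - S.lieB (S.zeroPart (α z Complex.I)) (S.dτ (S.mPart (α z 1)))
      + S.yCoord (ε 0) (α z Complex.I) • S.lieB S.Y (S.dτ (S.mPart (α z 1)))
      - S.yCoord (ε 0) (α z 1) • S.lieB S.Y (S.mPart (α z 1)) = 0 := by
  have h1 := congrArg S.dτ (structure_m hε hα hU hflat hpp hz)
  simp only [map_sub, map_neg, map_smul, map_zero, dτ_lie, dτ_zeroPart, dτ_Y, dτ_sq_mPart,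
    LinearMap.neg_apply, map_neg] at h1
  rw [← h1]
  module

end Structure

/-! ### The extended form -/

/-- The divergence of the form `θ` with `α₂ = θ Y`. -/
def divTheta (ε : Fin 2 → S.𝔤) (α : ℂ → ℂ →ₗ[ℝ] S.𝔤) (z : ℂ) : ℝ :=
  S.yCoord (ε 0) (S.formDeriv α z 1 1) + S.yCoord (ε 0) (S.formDeriv α z Complex.I Complex.I)

/-- The extended form as a linear function of `α v` and `α (i v)`: the term in `α v`. -/
def extendedFst (u : S.𝔤) (c s : ℂ) : S.𝔤 →ₗ[ℝ] Matrix n n ℂ :=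
  S.incl ∘ₗ S.zeroPart + c • (S.incl ∘ₗ S.mPart)
    + s • (S.incl ∘ₗ (S.dτ : S.𝔤 →ₗ[ℝ] S.𝔤) ∘ₗ S.mPart)
    + (c ^ 2 - s ^ 2) • (S.incl ∘ₗ (S.yCoord u).smulRight S.Y)

/-- The extended form as a linear function of `α v` and `α (i v)`: the term in `α (i v)`. -/
def extendedSnd (u : S.𝔤) (c s : ℂ) : S.𝔤 →ₗ[ℝ] Matrix n n ℂ :=
  (-(2 * c * s)) • (S.incl ∘ₗ (S.yCoord u).smulRight S.Y)

theorem extendedFst_apply (u : S.𝔤) (c s : ℂ) (X : S.𝔤) : extendedFst u c s X =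
    (S.zeroPart X : Matrix n n ℂ) + c • (S.mPart X : Matrix n n ℂ)
      + s • (S.dτ (S.mPart X) : Matrix n n ℂ)
      + ((c ^ 2 - s ^ 2) * (S.yCoord u X : ℂ)) • (S.Y : Matrix n n ℂ) := by
  rw [mul_smul, ← S.coe_smul_real]
  rfl

theorem extendedSnd_apply (u : S.𝔤) (c s : ℂ) (X : S.𝔤) : extendedSnd u c s X =
    (-(2 * c * s) * (S.yCoord u X : ℂ)) • (S.Y : Matrix n n ℂ) := by
  rw [mul_smul, ← S.coe_smul_real]
  rfl

/-- For λ = e^{it} one has c = cos t and s = sin t. The 𝔪-part is turned by cos t + sin t τ and the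
coefficients of θ through the double angle. -/
theorem extendedForm_one_I (hε : S.IsUnitaryFrame ε) {z : ℂ}
    (hpp : S.mPart (α z Complex.I) = -S.dτ (S.mPart (α z 1))) {lam c s : ℂ}
    (hc : c = (lam⁻¹ + lam) / 2) (hs : s = Complex.I * (lam⁻¹ - lam) / 2) :
    S.extendedForm α lam z 1
      = extendedFst (ε 0) c s (α z 1) + extendedSnd (ε 0) c s (α z Complex.I) ∧
    S.extendedForm α lam z Complex.I
      = extendedFst (ε 0) c s (α z Complex.I) - extendedSnd (ε 0) c s (α z 1) := by
  have hA := S.dτ_sq_mPart (α z 1)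
  set A := S.mPart (α z 1) with hAdef
  have e1 : formPart10 (S.component (-1) α) z 1
      = (1 / 2 : ℂ) • ((A : Matrix n n ℂ) + Complex.I • (S.dτ A : Matrix n n ℂ)) := by
    rw [formPart10_one, component_apply, component_apply, eigenPart_neg_one, eigenPart_neg_one,
      hpp, ← hAdef, map_neg, hA, neg_neg, smul_comm Complex.I, smul_add Complex.I, smul_smul,
      Complex.I_mul_I, Submodule.coe_neg]
    module
  have e2 : formPart01 (S.component 1 α) z 1
      = (1 / 2 : ℂ) • ((A : Matrix n n ℂ) - Complex.I • (S.dτ A : Matrix n n ℂ)) := by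
    rw [formPart01_one, component_apply, component_apply, eigenPart_one, eigenPart_one,
      hpp, ← hAdef, map_neg, hA, neg_neg, smul_comm Complex.I, smul_sub Complex.I, smul_smul,
      Complex.I_mul_I, Submodule.coe_neg]
    module
  have e3 : ∀ v, S.component 2 α z v = (S.yCoord (ε 0) (α z v) : ℂ) • (S.Y : Matrix n n ℂ) := by
    intro v
    rw [component_apply, eigenPart_two, hε.twoPart_eq, coe_smul_real]
  have e4 : lam ^ (-2 : ℤ) = lam⁻¹ ^ 2 := by
    rw [zpow_neg, inv_pow]; norm_cast
  have hI2 : Complex.I ^ 2 = -1 := Complex.I_sq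
  have e5 : c ^ 2 - s ^ 2 = (lam⁻¹ ^ 2 + lam ^ 2) / 2 := by
    rw [hc, hs]; linear_combination (-(lam⁻¹ - lam) ^ 2 / 4) * hI2
  have e6 : 2 * c * s = Complex.I * (lam⁻¹ ^ 2 - lam ^ 2) / 2 := by
    rw [hc, hs]; ring
  have e0 : ∀ v, S.extendedForm α lam z v = lam⁻¹ ^ 2 • formPart10 (S.component 2 α) z v
      + lam⁻¹ • formPart10 (S.component (-1) α) z v + (S.zeroPart (α z v) : Matrix n n ℂ)
      + lam • formPart01 (S.component 1 α) z v
      + lam ^ 2 • formPart01 (S.component 2 α) z v := by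
    intro v
    rw [← e4, ← zpow_neg_one, ← eigenPart_zero]
    rfl
  rw [e0, e0, formPart10_I, formPart10_I, formPart01_I, formPart01_I, formPart10_one (S.component 2 α),
    formPart01_one (S.component 2 α), e1, e2, e3, e3, extendedFst_apply, extendedFst_apply,
    extendedSnd_apply, extendedSnd_apply, hpp, ← hAdef, map_neg, hA, neg_neg, e5, e6, hc, hs]
  constructor
  · module
  · simp only [smul_add, smul_sub, smul_smul, Submodule.coe_neg, smul_neg]
    match_scalars <;> ring_nf <;> simp only [Complex.I_sq] <;> ring

end HermitianSymmetricSpace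

namespace HermitianSymmetricSpace

variable {n : Type*} [Fintype n] [DecidableEq n] {S : HermitianSymmetricSpace n}
  {ε : Fin 2 → S.𝔤} {α : ℂ → ℂ →ₗ[ℝ] S.𝔤} {U : Set ℂ}

theorem IsSmoothForm.hasFDerivAt_comp (hα : S.IsSmoothForm α U) (hU : IsOpen U) {z : ℂ}
    (hz : z ∈ U) {W : Type*} [NormedAddCommGroup W] [NormedSpace ℝ W] (T : S.𝔤 →ₗ[ℝ] W) (w : ℂ) :
    HasFDerivAt (fun p => T (α p w)) (fderiv ℝ (fun p => T (α p w)) z) z :=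
  (S.fderiv_linear_comp T (hα.differentiableAt hU hz w)).differentiableAt.hasFDerivAt

theorem IsUnitaryFrame.Y_ne_zero (hε : S.IsUnitaryFrame ε) : (S.Y : Matrix n n ℂ) ≠ 0 := by
  intro h
  have h1 := S.metric_J_J (hε.1 0) (hε.1 0)
  rw [show S.Y = 0 from Subtype.ext h, map_zero, hε.2.1] at h1
  simp at h1

/-- The curvature of the extended form. -/
theorem extendedForm_curvature (hε : S.IsUnitaryFrame ε) (hα : S.IsSmoothForm α U) (hU : IsOpen U)
    (hflat : IsFlatOn (S.complexForm α) U)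
    (hpp : ∀ z ∈ U, S.mPart (α z Complex.I) = -S.dτ (S.mPart (α z 1))) {lam : ℂ} (hlam : lam ≠ 0)
    {z : ℂ} (hz : z ∈ U) (v w : ℂ) :
    fderiv ℝ (fun p => S.extendedForm α lam p w) z v
      - fderiv ℝ (fun p => S.extendedForm α lam p v) z w
      + (S.extendedForm α lam z v * S.extendedForm α lam z w
        - S.extendedForm α lam z w * S.extendedForm α lam z v)
    = (v.re * w.im - v.im * w.re) •
      (Complex.I * (lam⁻¹ ^ 2 - lam ^ 2) / 2 * (divTheta ε α z : ℂ)) • (S.Y : Matrix n n ℂ) := by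
  obtain ⟨c, hc⟩ : ∃ c, c = (lam⁻¹ + lam) / 2 := ⟨_, rfl⟩
  obtain ⟨s, hs⟩ : ∃ s, s = Complex.I * (lam⁻¹ - lam) / 2 := ⟨_, rfl⟩
  have hll : lam⁻¹ * lam = 1 := inv_mul_cancel₀ hlam
  have hcs : c ^ 2 + s ^ 2 = 1 := by
    rw [hc, hs]
    linear_combination ((lam⁻¹ - lam) ^ 2 / 4) * Complex.I_sq + hll
  have hcs2 : 2 * c * s = Complex.I * (lam⁻¹ ^ 2 - lam ^ 2) / 2 := by
    rw [hc, hs]; ring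
  have e1 : (fun p => S.extendedForm α lam p 1) =ᶠ[𝓝 z] fun p =>
      extendedFst (ε 0) c s (α p 1) + extendedSnd (ε 0) c s (α p Complex.I) := by
    filter_upwards [hU.mem_nhds hz] with p hp
      using (extendedForm_one_I hε (hpp p hp) hc hs).1
  have e2 : (fun p => S.extendedForm α lam p Complex.I) =ᶠ[𝓝 z] fun p =>
      extendedFst (ε 0) c s (α p Complex.I) - extendedSnd (ε 0) c s (α p 1) := by
    filter_upwards [hU.mem_nhds hz] with p hp
      using (extendedForm_one_I hε (hpp p hp) hc hs).2
  have d1 := ((hα.hasFDerivAt_comp hU hz (extendedFst (ε 0) c s) 1).add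
    (hα.hasFDerivAt_comp hU hz (extendedSnd (ε 0) c s) Complex.I)).congr_of_eventuallyEq e1
  have d2 := ((hα.hasFDerivAt_comp hU hz (extendedFst (ε 0) c s) Complex.I).sub
    (hα.hasFDerivAt_comp hU hz (extendedSnd (ε 0) c s) 1)).congr_of_eventuallyEq e2
  have hd : ∀ v, DifferentiableAt ℝ (fun p => S.extendedForm α lam p v) z := by
    intro v
    have e : (fun p => S.extendedForm α lam p v) = fun p =>
        v.re • S.extendedForm α lam p 1 + v.im • S.extendedForm α lam p Complex.I :=
      funext fun p => complex_linearMap_apply _ v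
    rw [e]
    exact ((d1.const_smul v.re).add (d2.const_smul v.im)).differentiableAt
  suffices key : fderiv ℝ (fun p => S.extendedForm α lam p Complex.I) z 1
      - fderiv ℝ (fun p => S.extendedForm α lam p 1) z Complex.I
      + (S.extendedForm α lam z 1 * S.extendedForm α lam z Complex.I
        - S.extendedForm α lam z Complex.I * S.extendedForm α lam z 1)
      = (Complex.I * (lam⁻¹ ^ 2 - lam ^ 2) / 2 * (divTheta ε α z : ℂ)) • (S.Y : Matrix n n ℂ) from
    (curvature_eq_smul hd v w).trans (congrArg _ key)
  have f1 : fderiv ℝ (fun p => S.extendedForm α lam p 1) z Complex.I =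
      extendedFst (ε 0) c s (S.formDeriv α z Complex.I 1)
      + extendedSnd (ε 0) c s (S.formDeriv α z Complex.I Complex.I) := by
    refine (congrArg (fun T : ℂ →L[ℝ] Matrix n n ℂ => T Complex.I) d1.fderiv).trans ?_
    rw [← hα.fderiv_comp hU hz, ← hα.fderiv_comp hU hz]
    rfl
  have f2 : fderiv ℝ (fun p => S.extendedForm α lam p Complex.I) z 1 =
      extendedFst (ε 0) c s (S.formDeriv α z 1 Complex.I)
      - extendedSnd (ε 0) c s (S.formDeriv α z 1 1) := by
    refine (congrArg (fun T : ℂ →L[ℝ] Matrix n n ℂ => T 1) d2.fderiv).trans ?_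
    rw [← hα.fderiv_comp hU hz, ← hα.fderiv_comp hU hz]
    rfl
  have g := extendedForm_one_I hε (hpp z hz) hc hs
  rw [f1, f2, g.1, g.2]
  have k0 := congrArg S.incl (structure_zero hε hα hU hflat hpp hz)
  have kY := congrArg Complex.ofReal (structure_two hε hα hU hflat hpp hz)
  have kE := congrArg S.incl (structure_m hε hα hU hflat hpp hz)
  have kF := congrArg S.incl (structure_m' hε hα hU hflat hpp hz)
  have ka := congrArg S.incl (hε.lie_zeroPart_Y (α z 1))
  have kb := congrArg S.incl (hε.lie_zeroPart_Y (α z Complex.I))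
  simp only [incl, Submodule.subtype_apply, Submodule.coe_add, Submodule.coe_sub,
    Submodule.coe_neg, coe_smul_real, S.lie_coe, Submodule.coe_zero] at k0 kE kF ka kb
  push_cast at kY
  have key := extended_curvature hcs k0 kY kE kF ka kb
    (px := (S.yCoord (ε 0) (S.formDeriv α z 1 1) : ℂ))
    (qy := (S.yCoord (ε 0) (S.formDeriv α z Complex.I Complex.I) : ℂ))
  rw [divTheta, Complex.ofReal_add, ← hcs2]
  refine Eq.trans ?_ key
  simp only [extendedFst_apply, extendedSnd_apply, hpp z hz, hα.mPart_formDeriv hU hpp hz, map_neg,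
    S.dτ_sq_mPart, neg_neg, Submodule.coe_neg]
  congr 1
  · module
  · congr 1 <;> congr 1 <;> module

/-- The curvature is a scalar times the nonzero matrix Y; the values with λ⁴ = 1 are flat for every
partially primitive flat α. -/
theorem extendedForm_flat_iff (hε : S.IsUnitaryFrame ε) (hα : S.IsSmoothForm α U) (hU : IsOpen U)
    (hflat : IsFlatOn (S.complexForm α) U)
    (hpp : ∀ z ∈ U, S.mPart (α z Complex.I) = -S.dτ (S.mPart (α z 1))) {lam : ℂ} (hlam : lam ≠ 0) :
    IsFlatOn (S.extendedForm α lam) U ↔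
      ∀ z ∈ U, lam⁻¹ ^ 2 - lam ^ 2 = 0 ∨ divTheta ε α z = 0 := by
  refine forall₂_congr fun z hz => ?_
  simp only [extendedForm_curvature hε hα hU hflat hpp hlam hz]
  constructor
  · intro h
    have h1 := h 1 Complex.I
    simp only [smul_eq_zero, hε.Y_ne_zero, or_false] at h1
    simpa using h1
  · rintro (h | h) v w
    · rw [h, mul_zero, zero_div, zero_mul, zero_smul, smul_zero]
    · simp [h]

theorem extendedForm_flat_circle_iff (hε : S.IsUnitaryFrame ε) (hα : S.IsSmoothForm α U)
    (hU : IsOpen U) (hflat : IsFlatOn (S.complexForm α) U)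
    (hpp : ∀ z ∈ U, S.mPart (α z Complex.I) = -S.dτ (S.mPart (α z 1))) :
    (∀ lam : ℂ, ‖lam‖ = 1 → IsFlatOn (S.extendedForm α lam) U) ↔ ∀ z ∈ U, divTheta ε α z = 0 := by
  constructor
  · intro h z hz
    -- One value suffices: λ = e^{iπ/4} has λ² = i, and λ⁻² - λ² = -2i does not vanish.
    have hI : Complex.exp ((Real.pi / 4 : ℝ) * Complex.I) ^ 2 = Complex.I := by
      rw [← Complex.exp_nat_mul]
      refine Eq.trans (congrArg Complex.exp ?_) Complex.exp_pi_div_two_mul_I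
      push_cast
      ring
    have h1 := (extendedForm_flat_iff hε hα hU hflat hpp (Complex.exp_ne_zero _)).1
      (h _ (Complex.norm_exp_ofReal_mul_I (Real.pi / 4))) z hz
    rw [inv_pow, hI, Complex.inv_I] at h1
    refine h1.resolve_left fun h2 => Complex.I_ne_zero ?_
    linear_combination (-1 / 2 : ℂ) * h2
  · intro h lam hlam
    exact (extendedForm_flat_iff hε hα hU hflat hpp (by rintro rfl; simp at hlam)).2
      fun z hz => Or.inr (h z hz)

theorem extendedForm_flat_ne_zero_iff (hε : S.IsUnitaryFrame ε) (hα : S.IsSmoothForm α U)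
    (hU : IsOpen U) (hflat : IsFlatOn (S.complexForm α) U)
    (hpp : ∀ z ∈ U, S.mPart (α z Complex.I) = -S.dτ (S.mPart (α z 1))) :
    (∀ lam : ℂ, lam ≠ 0 → IsFlatOn (S.extendedForm α lam) U) ↔ ∀ z ∈ U, divTheta ε α z = 0 := by
  constructor
  · exact fun h => (extendedForm_flat_circle_iff hε hα hU hflat hpp).1
      fun lam hlam => h lam (by rintro rfl; simp at hlam)
  · exact fun h lam hlam => (extendedForm_flat_iff hε hα hU hflat hpp hlam).2
      fun z hz => Or.inr (h z hz)

theorem component_two_eq_zero_iff (hε : S.IsUnitaryFrame ε) (α : ℂ → ℂ →ₗ[ℝ] S.𝔤) (z : ℂ) :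
    S.component 2 α z = 0 ↔
      S.yCoord (ε 0) (α z 1) = 0 ∧ S.yCoord (ε 0) (α z Complex.I) = 0 := by
  rw [complex_linearMap_eq_zero_iff, component_apply, component_apply, eigenPart_two,
    eigenPart_two, hε.twoPart_eq, hε.twoPart_eq, coe_smul_real, coe_smul_real, smul_eq_zero,
    smul_eq_zero]
  simp [hε.Y_ne_zero]

end HermitianSymmetricSpace

/-! ### Integrals over compact subsets of the plane. -/

/-- Differentiation under the integral sign over a compact set. -/
theorem hasDerivAt_setIntegral_of_contDiffOn {g : ℝ × ℂ → ℝ} {O : Set (ℝ × ℂ)} {K : Set ℂ}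
    (hO : IsOpen O) (hg : ContDiffOn ℝ 1 g O) (hK : IsCompact K) (hKO : ∀ z ∈ K, (0, z) ∈ O) :
    HasDerivAt (fun t => ∫ z in K, g (t, z)) (∫ z in K, fderiv ℝ g (0, z) (1, 0)) 0 := by
  -- The tube lemma provides an interval of parameters that works for all points of K at once.
  obtain ⟨u, v, hu, -, h0u, hKv, huv⟩ := generalized_tube_lemma (isCompact_singleton (x := (0 : ℝ)))
    hK hO (by rintro ⟨t, z⟩ ⟨rfl, hz⟩; exact hKO z hz)
  obtain ⟨δ, hδ, hball⟩ := Metric.nhds_basis_closedBall.mem_iff.1 (hu.mem_nhds (h0u rfl))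
  have hsub : Metric.closedBall (0 : ℝ) δ ×ˢ K ⊆ O := (Set.prod_mono hball hKv).trans huv
  have hd : ContinuousOn (fun p => fderiv ℝ g p (1, 0)) O :=
    (hg.continuousOn_fderiv_of_isOpen hO le_rfl).clm_apply continuousOn_const
  obtain ⟨C, hC⟩ := ((isCompact_closedBall (0 : ℝ) δ).prod hK).exists_bound_of_continuousOn
    (hd.mono hsub)
  have hslice : ∀ t : ℝ, ContinuousOn (fun z : ℂ => (t, z)) K := fun t => by fun_prop
  have hmaps : ∀ t ∈ Metric.closedBall (0 : ℝ) δ, Set.MapsTo (fun z : ℂ => (t, z)) K O :=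
    fun t ht z hz => hsub ⟨ht, hz⟩
  have hcont : ∀ t ∈ Metric.closedBall (0 : ℝ) δ, ContinuousOn (fun z => g (t, z)) K :=
    fun t ht => hg.continuousOn.comp (hslice t) (hmaps t ht)
  have h0 : (0 : ℝ) ∈ Metric.closedBall (0 : ℝ) δ := Metric.mem_closedBall_self hδ.le
  refine (hasDerivAt_integral_of_dominated_loc_of_deriv_le (bound := fun _ => C)
    (F' := fun t z => fderiv ℝ g (t, z) (1, 0)) (Metric.closedBall_mem_nhds (0 : ℝ) hδ)
    ?_ ((hcont 0 h0).integrableOn_compact hK) ?_ ?_ ?_ ?_).2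
  · filter_upwards [Metric.closedBall_mem_nhds (0 : ℝ) hδ] with t ht
      using (hcont t ht).aestronglyMeasurable hK.measurableSet
  · exact (hd.comp (hslice 0) (hmaps 0 h0)).aestronglyMeasurable hK.measurableSet
  · exact (ae_restrict_iff' hK.measurableSet).2
      (Filter.Eventually.of_forall fun z hz t ht => hC (t, z) ⟨ht, hz⟩)
  · exact continuousOn_const.integrableOn_compact hK
  · refine (ae_restrict_iff' hK.measurableSet).2
      (Filter.Eventually.of_forall fun z hz t ht => ?_)
    have h1 : HasFDerivAt g (fderiv ℝ g (t, z)) (t, z) :=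
      ((hg.contDiffAt (hO.mem_nhds (hsub ⟨ht, hz⟩))).differentiableAt one_ne_zero).hasFDerivAt
    exact h1.comp_hasDerivAt t ((hasDerivAt_id t).prodMk (hasDerivAt_const t z))

/-- The integral of a derivative of a compactly supported function vanishes. -/
theorem setIntegral_fderiv_eq_zero {P : ℂ → ℝ} {U K : Set ℂ} (hU : IsOpen U)
    (hP : ContDiffOn ℝ 1 P U) (hK : IsCompact K) (hKU : K ⊆ U) (h0 : ∀ z ∈ U \ K, P z = 0) (v : ℂ) :
    ∫ z in K, fderiv ℝ P z v = 0 := by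
  have hPU : ∀ z ∈ U, U.indicator P =ᶠ[𝓝 z] P := fun z hz => by
    filter_upwards [hU.mem_nhds hz] with w hw using Set.indicator_of_mem hw P
  have hz0 : ∀ z ∉ K, U.indicator P z = 0 := by
    intro z hz
    by_cases hzU : z ∈ U
    · rw [Set.indicator_of_mem hzU, h0 z ⟨hzU, hz⟩]
    · exact Set.indicator_of_notMem hzU P
  have hcs : HasCompactSupport (U.indicator P) := HasCompactSupport.intro hK hz0
  have hPK : ∀ z ∉ K, U.indicator P =ᶠ[𝓝 z] fun _ => 0 := fun z hz => by
    filter_upwards [hK.isClosed.isOpen_compl.mem_nhds hz] with w hw using hz0 w hw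
  -- Extension by zero is C¹: near points of K it agrees with P, and it vanishes on the open
  -- complement of K.
  have hC : ContDiff ℝ 1 (U.indicator P) := by
    refine contDiff_iff_contDiffAt.2 fun z => ?_
    by_cases hz : z ∈ K
    · exact (hP.contDiffAt (hU.mem_nhds (hKU hz))).congr_of_eventuallyEq (hPU z (hKU hz))
    · exact contDiffAt_const.congr_of_eventuallyEq (hPK z hz)
  have hc' : Continuous fun z => fderiv ℝ (U.indicator P) z v :=
    (hC.continuous_fderiv one_ne_zero).clm_apply continuous_const
  have hcs' : HasCompactSupport fun z => fderiv ℝ (U.indicator P) z v :=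
    hcs.fderiv_apply ℝ v
  have h1 : ∫ z in K, fderiv ℝ P z v = ∫ z in K, fderiv ℝ (U.indicator P) z v :=
    setIntegral_congr_fun hK.measurableSet fun z hz =>
      congrArg (fun T : ℂ →L[ℝ] ℝ => T v) (hPU z (hKU hz)).fderiv_eq.symm
  have h2 : ∫ z in K, fderiv ℝ (U.indicator P) z v = ∫ z, fderiv ℝ (U.indicator P) z v := by
    refine setIntegral_eq_integral_of_forall_compl_eq_zero fun z hz => ?_
    rw [(hPK z hz).fderiv_eq]
    simp
  -- Integration by parts against the constant function 1.
  have h3 := integral_mul_fderiv_eq_neg_fderiv_mul_of_integrable (μ := volume) (v := v)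
    (f := fun _ : ℂ => (1 : ℝ)) (g := U.indicator P) (by simp)
    (by simpa using hc'.integrable_of_hasCompactSupport hcs')
    (by simpa using hC.continuous.integrable_of_hasCompactSupport hcs)
    (fun _ _ => differentiableAt_const _) (fun z _ => hC.differentiable one_ne_zero z)
  rw [h1, h2]
  simpa using h3

/-- The fundamental lemma of the calculus of variations, for continuous functions. -/
theorem eq_zero_of_setIntegral_contDiff_mul_eq_zero {g : ℂ → ℝ} {W : Set ℂ} (hW : IsOpen W)
    (hg : ContinuousOn g W)
    (h : ∀ φ : ℂ → ℝ, ContDiff ℝ ∞ φ → HasCompactSupport φ → tsupport φ ⊆ W →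
      ∫ z in tsupport φ, φ z * g z = 0) {z : ℂ} (hz : z ∈ W) : g z = 0 := by
  have h1 : ∀ᵐ z, z ∈ W → g z = 0 := by
    refine hW.ae_eq_zero_of_integral_contDiff_smul_eq_zero
      (hg.locallyIntegrableOn hW.measurableSet) fun φ hφ hc hs => ?_
    rw [← h φ hφ hc hs]
    refine (setIntegral_eq_integral_of_forall_compl_eq_zero fun z hz => ?_).symm
    rw [image_eq_zero_of_notMem_tsupport hz, zero_smul]
  exact Measure.eqOn_open_of_ae_eq ((ae_restrict_iff' hW.measurableSet).2 h1) hW hg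
    continuousOn_const hz

/-! ### Mean curvature and the pointwise first variation. -/

namespace HermitianSymmetricSpace

variable {n : Type*} [Fintype n] [DecidableEq n] {S : HermitianSymmetricSpace n}
  {ε : Fin 2 → S.𝔤} {α : ℂ → ℂ →ₗ[ℝ] S.𝔤} {U : Set ℂ}

/-- The mean curvature vector of the map with Maurer–Cartan form `α` is determined by `α₂`. -/
theorem meanCurvature_eq (hε : S.IsUnitaryFrame ε) (hα : S.IsSmoothForm α U) (hU : IsOpen U)
    (hflat : IsFlatOn (S.complexForm α) U)
    (hpp : ∀ z ∈ U, S.mPart (α z Complex.I) = -S.dτ (S.mPart (α z 1))) {z : ℂ} (hz : z ∈ U) :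
    S.mPart (S.formDeriv α z 1 1) + S.lieB (S.hPart (α z 1)) (S.mPart (α z 1))
      + S.mPart (S.formDeriv α z Complex.I Complex.I)
      + S.lieB (S.hPart (α z Complex.I)) (S.mPart (α z Complex.I))
    = (2 : ℝ) • (S.yCoord (ε 0) (α z 1) • S.lieB S.Y (S.mPart (α z 1))
      + S.yCoord (ε 0) (α z Complex.I) • S.lieB S.Y (S.mPart (α z Complex.I))) := by
  rw [hα.mPart_formDeriv hU hpp hz, hpp z hz, hε.hPart_eq, hε.hPart_eq]
  simp only [map_add, map_smul, map_neg, LinearMap.add_apply, LinearMap.smul_apply]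
  linear_combination (norm := module) structure_m' hε hα hU hflat hpp hz

theorem IsSmoothForm.fderiv_metric (hα : S.IsSmoothForm α U) (hU : IsOpen U) {z : ℂ} (hz : z ∈ U)
    {V : ℂ → S.𝔤} (hV : DifferentiableAt ℝ V z) (v w : ℂ) :
    fderiv ℝ (fun p => S.metric (S.mPart (α p w)) (V p)) z v =
      S.metric (S.mPart (S.formDeriv α z v w)) (V z)
      + S.metric (S.mPart (α z w)) (fderiv ℝ V z v) := by
  have h1 := ContinuousLinearMap.hasFDerivAt_of_bilinear (S.metricC)
    (S.fderiv_linear_comp S.mPart (hα.differentiableAt hU hz w)) hV.hasFDerivAt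
  rw [add_comm]
  exact congrArg (fun T : ℂ →L[ℝ] ℝ => T v) h1.fderiv

/-- The pointwise form of the first variation formula for the area. -/
theorem firstVariation_eq (hε : S.IsUnitaryFrame ε) (hα : S.IsSmoothForm α U) (hU : IsOpen U)
    (hflat : IsFlatOn (S.complexForm α) U)
    (hpp : ∀ z ∈ U, S.mPart (α z Complex.I) = -S.dτ (S.mPart (α z 1))) {z : ℂ} (hz : z ∈ U)
    {ξ : ℂ → S.𝔤} (hξ : DifferentiableAt ℝ ξ z) :
    S.metric (S.mPart (α z 1)) (S.mPart (fderiv ℝ ξ z 1 + S.lieB (α z 1) (ξ z)))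
      + S.metric (S.mPart (α z Complex.I))
        (S.mPart (fderiv ℝ ξ z Complex.I + S.lieB (α z Complex.I) (ξ z)))
    = fderiv ℝ (fun p => S.metric (S.mPart (α p 1)) (S.mPart (ξ p))) z 1
      + fderiv ℝ (fun p => S.metric (S.mPart (α p Complex.I)) (S.mPart (ξ p))) z Complex.I
      - 2 * (S.yCoord (ε 0) (α z 1) * S.metric (S.lieB S.Y (S.mPart (α z 1))) (S.mPart (ξ z))
        + S.yCoord (ε 0) (α z Complex.I)
          * S.metric (S.lieB S.Y (S.mPart (α z Complex.I))) (S.mPart (ξ z))) := by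
  have hV := S.fderiv_linear_comp S.mPart hξ
  have hV' : ∀ v, fderiv ℝ (fun p => S.mPart (ξ p)) z v = S.mPart (fderiv ℝ ξ z v) := fun v =>
    congrArg (fun T : ℂ →L[ℝ] S.𝔤 => T v) hV.fderiv
  rw [hα.fderiv_metric hU hz hV.differentiableAt, hα.fderiv_metric hU hz hV.differentiableAt,
    hV', hV']
  have h1 := congrArg (fun X => S.metric X (S.mPart (ξ z)))
    (meanCurvature_eq hε hα hU hflat hpp hz)
  -- Skewness of ad on 𝔥 is used twice: k1 moves the bracket with the 𝔥-part of X to the other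
  -- entry, and k2 shows that the 𝔥-part of ξ contributes nothing.
  have key : ∀ X, S.metric (S.mPart X) (S.mPart (S.lieB X (ξ z)))
      = -S.metric (S.lieB (S.hPart X) (S.mPart X)) (S.mPart (ξ z)) := by
    intro X
    have k1 := S.metric_lie (S.dτ_sq_hPart X) (S.dτ_sq_mPart X) (S.dτ_sq_mPart (ξ z))
    have k2 := S.metric_lie (S.dτ_sq_hPart (ξ z)) (S.dτ_sq_mPart X) (S.dτ_sq_mPart X)
    rw [S.metric_symm _ (S.mPart X)
      (S.dτ_sq_lie_of_fixed (S.dτ_sq_hPart _) (S.dτ_sq_mPart _)) (S.dτ_sq_mPart _)] at k2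
    rw [S.mPart_lie, S.lieB_skew (S.mPart X), map_add, map_neg]
    linarith
  simp only [map_add, map_smul, LinearMap.add_apply, LinearMap.smul_apply, smul_eq_mul] at h1 ⊢
  rw [key, key]
  linarith

/-- The derivative of the area density along curves of tangent vectors that start from a conformal
frame. -/
theorem hasDerivAt_sqrt_metric {a b : ℝ → S.𝔤} {a' b' : S.𝔤}
    (ha : HasDerivAt a a' 0) (hb : HasDerivAt b b' 0)
    (ham : S.dτ (S.dτ (a 0)) = -a 0) (hbm : S.dτ (S.dτ (b 0)) = -b 0)
    (ham' : S.dτ (S.dτ a') = -a') (hbm' : S.dτ (S.dτ b') = -b')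
    (hpos : 0 < S.metric (a 0) (a 0)) (hab : S.metric (a 0) (a 0) = S.metric (b 0) (b 0))
    (hab' : S.metric (a 0) (b 0) = 0) :
    HasDerivAt (fun t => √(S.metric (a t) (a t) * S.metric (b t) (b t) - S.metric (a t) (b t) ^ 2))
      (S.metric (a 0) a' + S.metric (b 0) b') 0 := by
  have haa := ContinuousLinearMap.hasDerivAt_of_bilinear (B := S.metricC) (fun _ => ha) (fun _ => ha)
  have hbb := ContinuousLinearMap.hasDerivAt_of_bilinear (B := S.metricC) (fun _ => hb) (fun _ => hb)
  have hab1 := ContinuousLinearMap.hasDerivAt_of_bilinear (B := S.metricC) (fun _ => ha) (fun _ => hb)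
  -- At a conformal frame the Gram determinant is ⟨a, a⟩² > 0, so the root is differentiable, and
  -- the cross term drops out since ⟨a, b⟩ = 0.
  have h1 := ((haa.mul hbb).sub (hab1.pow 2)).sqrt (by
    change S.metric (a 0) (a 0) * S.metric (b 0) (b 0) - S.metric (a 0) (b 0) ^ 2 ≠ 0
    rw [← hab, hab']
    intro h
    linarith [mul_pos hpos hpos])
  refine h1.congr_deriv ?_
  change ((S.metric (a 0) a' + S.metric a' (a 0)) * S.metric (b 0) (b 0)
    + S.metric (a 0) (a 0) * (S.metric (b 0) b' + S.metric b' (b 0))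
    - (2 : ℕ) * S.metric (a 0) (b 0) ^ (2 - 1) * (S.metric (a 0) b' + S.metric a' (b 0)))
    / (2 * √(S.metric (a 0) (a 0) * S.metric (b 0) (b 0) - S.metric (a 0) (b 0) ^ 2)) = _
  rw [← hab, hab', S.metric_symm _ _ ham' ham, S.metric_symm _ _ hbm' hbm,
    show S.metric (a 0) (a 0) * S.metric (a 0) (a 0) - 0 ^ 2 = S.metric (a 0) (a 0) ^ 2 by ring,
    Real.sqrt_sq hpos.le]
  field_simp
  ring

end HermitianSymmetricSpace

/-! ### Maurer–Cartan forms of families of maps. -/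

namespace HermitianSymmetricSpace

variable {n : Type*} [Fintype n] [DecidableEq n] {S : HermitianSymmetricSpace n}
  {E : Type*} [NormedAddCommGroup E] [NormedSpace ℝ E]

theorem contDiffOn_linear_comp {W : Type*} [NormedAddCommGroup W] [NormedSpace ℝ W]
    (T : S.𝔤 →ₗ[ℝ] W) {g : E → S.𝔤} {s : Set E} {k : WithTop ℕ∞} (hg : ContDiffOn ℝ k g s) :
    ContDiffOn ℝ k (fun p => T (g p)) s :=
  (LinearMap.toContinuousLinearMap T).contDiff.comp_contDiffOn hg

theorem contDiffOn_metric {u v : E → S.𝔤} {s : Set E} {k : WithTop ℕ∞} (hu : ContDiffOn ℝ k u s)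
    (hv : ContDiffOn ℝ k v s) : ContDiffOn ℝ k (fun p => S.metric (u p) (v p)) s :=
  (S.metricC.isBoundedBilinearMap.contDiff (n := k)).comp_contDiffOn (hu.prodMk hv)

theorem contDiffOn_mcForm {G : E → S.G} {W : Set E} (hW : IsOpen W)
    (hG : ContDiffOn ℝ ∞ (fun w => S.mat (G w)) W) (v : E) :
    ContDiffOn ℝ ∞ (fun p => S.mcForm G p v) W := by
  have h1 := S.contDiffOn_mat_inv hG
  have h2 : ContDiffOn ℝ ∞ (fun p => fderiv ℝ (fun w => S.mat (G w)) p v) W :=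
    (hG.fderiv_of_isOpen hW (m := ∞) le_rfl).clm_apply contDiffOn_const
  exact S.proj.contDiff.comp_contDiffOn (ContDiffOn.mul h1 h2)

/-- The zero curvature equation for the Maurer–Cartan form of a map into `G`. -/
theorem fderiv_mcForm {G : E → S.G} {W : Set E} (hW : IsOpen W)
    (hG : ContDiffOn ℝ ∞ (fun w => S.mat (G w)) W) {p : E} (hp : p ∈ W) (v w : E) :
    fderiv ℝ (fun p => S.mcForm G p w) p v =
      fderiv ℝ (fun p => S.mcForm G p v) p w + S.lieB (S.mcForm G p w) (S.mcForm G p v) := by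
  have hd : ∀ v, DifferentiableAt ℝ (fun p => S.mcForm G p v) p := fun v =>
    ((contDiffOn_mcForm hW hG v).contDiffAt (hW.mem_nhds hp)).differentiableAt (by simp)
  have hd' := fun v => S.fderiv_linear_comp S.𝔤.subtype (hd v)
  have h1 : fderiv ℝ (fun p => S.coeForm (S.mcForm G) p w) p v
      - fderiv ℝ (fun p => S.coeForm (S.mcForm G) p v) p w
      + (S.coeForm (S.mcForm G) p v * S.coeForm (S.mcForm G) p w
        - S.coeForm (S.mcForm G) p w * S.coeForm (S.mcForm G) p v) = 0 :=
    flat_of_hasLogDerivAt (α := S.coeForm (S.mcForm G)) (F := fun w => S.mat (G w))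
    (Fi := fun w => S.mat (G w)⁻¹) (S.mat_inv_mul (G p))
    (by
      filter_upwards [hW.mem_nhds hp] with p hp using
        S.hasLogDerivAt_mcForm ((hG.contDiffAt (hW.mem_nhds hp)).differentiableAt (by simp)))
    ((hG.contDiffAt (hW.mem_nhds hp)).of_le (WithTop.coe_le_coe.2 le_top))
    (fun v => (hd' v).differentiableAt) v w
  have h2 : ∀ v w, fderiv ℝ (fun p => S.coeForm (S.mcForm G) p w) p v
      = (fderiv ℝ (fun p => S.mcForm G p w) p v : Matrix n n ℂ) := fun v w =>
    congrArg (fun T : E →L[ℝ] Matrix n n ℂ => T v) (hd' w).fderiv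
  rw [h2, h2] at h1
  refine Subtype.ext ?_
  rw [Submodule.coe_add, S.lie_coe, ← sub_eq_zero]
  refine Eq.trans ?_ h1
  change _ = _ + (((S.mcForm G p v : S.𝔤) : Matrix n n ℂ) * (S.mcForm G p w : S.𝔤)
    - (S.mcForm G p w : S.𝔤) * (S.mcForm G p v : S.𝔤))
  abel

section Variation

variable {U : Set ℂ} {Φ : ℝ → ℂ → S.G}

/-- The Maurer–Cartan form of a family of maps. -/
def familyForm (Φ : ℝ → ℂ → S.G) : ℝ × ℂ → ℝ × ℂ →ₗ[ℝ] S.𝔤 := S.mcForm fun p => Φ p.1 p.2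

theorem hasLogDerivAt_family (hU : IsOpen U)
    (hΦ : ContDiffOn ℝ ∞ (fun p : ℝ × ℂ => S.mat (Φ p.1 p.2)) (Set.univ ×ˢ U)) (t : ℝ) {z : ℂ}
    (hz : z ∈ U) :
    HasLogDerivAt (fun p : ℝ × ℂ => S.mat (Φ p.1 p.2)) (S.coeForm (familyForm Φ)) (t, z) :=
  S.hasLogDerivAt_mcForm ((hΦ.contDiffAt
    ((isOpen_univ.prod hU).mem_nhds ⟨Set.mem_univ t, hz⟩)).differentiableAt (by simp))

theorem hasLogDerivAt_slice (hU : IsOpen U)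
    (hΦ : ContDiffOn ℝ ∞ (fun p : ℝ × ℂ => S.mat (Φ p.1 p.2)) (Set.univ ×ˢ U)) (t : ℝ) {z : ℂ}
    (hz : z ∈ U) :
    HasLogDerivAt (fun w => S.mat (Φ t w))
      (S.coeForm fun w => familyForm Φ (t, w) ∘ₗ LinearMap.inr ℝ ℝ ℂ) z := by
  have h := hasLogDerivAt_family hU hΦ t hz
  have h1 : HasFDerivAt (fun w : ℂ => S.mat (Φ t w))
      ((fderiv ℝ (fun p : ℝ × ℂ => S.mat (Φ p.1 p.2)) (t, z)).comp
        (ContinuousLinearMap.inr ℝ ℝ ℂ)) z :=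
    HasFDerivAt.comp z (f := fun w : ℂ => (t, w)) h.1.hasFDerivAt (hasFDerivAt_prodMk_right t z)
  refine S.hasLogDerivAt_mat_iff.2 ⟨h1.differentiableAt, fun v => ?_⟩
  refine (congrArg (fun T : ℂ →L[ℝ] Matrix n n ℂ => T v) h1.fderiv).trans ?_
  exact (S.hasLogDerivAt_mat_iff.1 h).2 (0, v)

theorem tangent_slice (hU : IsOpen U)
    (hΦ : ContDiffOn ℝ ∞ (fun p : ℝ × ℂ => S.mat (Φ p.1 p.2)) (Set.univ ×ˢ U)) (t : ℝ) {z : ℂ}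
    (hz : z ∈ U) (v : ℂ) : S.tangent (Φ t) z v = S.mPart (familyForm Φ (t, z) (0, v)) :=
  S.tangent_eq (hasLogDerivAt_slice hU hΦ t hz) v

theorem hasDerivAt_mat_family (hU : IsOpen U)
    (hΦ : ContDiffOn ℝ ∞ (fun p : ℝ × ℂ => S.mat (Φ p.1 p.2)) (Set.univ ×ˢ U)) {z : ℂ}
    (hz : z ∈ U) : HasDerivAt (fun t => S.mat (Φ t z))
      (S.mat (Φ 0 z) * (familyForm Φ (0, z) (1, 0) : Matrix n n ℂ)) 0 := by
  have h := hasLogDerivAt_family hU hΦ 0 hz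
  have h1 : HasDerivAt (fun t => S.mat (Φ t z))
      (fderiv ℝ (fun p : ℝ × ℂ => S.mat (Φ p.1 p.2)) (0, z) (1, 0)) 0 :=
    HasFDerivAt.comp_hasDerivAt (0 : ℝ) (f := fun t : ℝ => (t, z))
      (l := fun p : ℝ × ℂ => S.mat (Φ p.1 p.2)) h.1.hasFDerivAt
      ((hasDerivAt_id (0 : ℝ)).prodMk (hasDerivAt_const (0 : ℝ) z))
  exact h1.congr_deriv ((S.hasLogDerivAt_mat_iff.1 h).2 (1, 0))

theorem variationField_eq_of_hasDerivAt {z : ℂ} {X : S.𝔤}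
    (h : HasDerivAt (fun t => S.mat (Φ t z)) (S.mat (Φ 0 z) * (X : Matrix n n ℂ)) 0) :
    S.variationField Φ z = S.mPart X := by
  have h1 : S.mat (Φ 0 z)⁻¹ * deriv (fun t => S.mat (Φ t z)) 0 = (X : Matrix n n ℂ) := by
    refine (congrArg (fun X => S.mat (Φ 0 z)⁻¹ * X) h.deriv).trans ?_
    rw [← mul_assoc, S.mat_inv_mul, one_mul]
  rw [variationField, h1, toLie_coe]

theorem variationField_eq (hU : IsOpen U)
    (hΦ : ContDiffOn ℝ ∞ (fun p : ℝ × ℂ => S.mat (Φ p.1 p.2)) (Set.univ ×ˢ U)) {z : ℂ}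
    (hz : z ∈ U) : S.variationField Φ z = S.mPart (familyForm Φ (0, z) (1, 0)) :=
  variationField_eq_of_hasDerivAt (hasDerivAt_mat_family hU hΦ hz)

end Variation

end HermitianSymmetricSpace

/-! ### The first variation of the area. -/

namespace HermitianSymmetricSpace

variable {n : Type*} [Fintype n] [DecidableEq n] {S : HermitianSymmetricSpace n}
  {ε : Fin 2 → S.𝔤} {α : ℂ → ℂ →ₗ[ℝ] S.𝔤} {U K : Set ℂ} {Φ : ℝ → ℂ → S.G}

theorem contDiffOn_familyForm (hU : IsOpen U)
    (hΦ : ContDiffOn ℝ ∞ (fun p : ℝ × ℂ => S.mat (Φ p.1 p.2)) (Set.univ ×ˢ U)) (v : ℝ × ℂ) :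
    ContDiffOn ℝ ∞ (fun p => familyForm Φ p v) (Set.univ ×ˢ U) :=
  contDiffOn_mcForm (isOpen_univ.prod hU) hΦ v

theorem contDiffOn_variation (hU : IsOpen U)
    (hΦ : ContDiffOn ℝ ∞ (fun p : ℝ × ℂ => S.mat (Φ p.1 p.2)) (Set.univ ×ˢ U)) :
    ContDiffOn ℝ ∞ (fun z => familyForm Φ (0, z) (1, 0)) U :=
  (contDiffOn_familyForm hU hΦ (1, 0)).comp (f := fun z : ℂ => ((0 : ℝ), z))
    (contDiff_prodMk_right (0 : ℝ)).contDiffOn fun _ hz => ⟨Set.mem_univ _, hz⟩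

/-- The zero curvature equation in the (t, v)-plane exchanges derivatives: ∂α_t/∂t = dξ + [α, ξ],
with ξ the t-component of the form. -/
theorem hasDerivAt_familyForm (hU : IsOpen U)
    (hΦ : ContDiffOn ℝ ∞ (fun p : ℝ × ℂ => S.mat (Φ p.1 p.2)) (Set.univ ×ˢ U)) {z : ℂ}
    (hz : z ∈ U) (v : ℂ) :
    HasDerivAt (fun t : ℝ => S.mPart (familyForm Φ (t, z) (0, v)))
      (S.mPart (fderiv ℝ (fun z => familyForm Φ (0, z) (1, 0)) z v
        + S.lieB (familyForm Φ (0, z) (0, v)) (familyForm Φ (0, z) (1, 0)))) 0 := by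
  have hW : IsOpen ((Set.univ : Set ℝ) ×ˢ U) := isOpen_univ.prod hU
  have hp : ((0 : ℝ), z) ∈ Set.univ ×ˢ U := ⟨Set.mem_univ _, hz⟩
  have hd : ∀ v, DifferentiableAt ℝ (fun p => familyForm Φ p v) (0, z) := fun v =>
    ((contDiffOn_familyForm hU hΦ v).contDiffAt (hW.mem_nhds hp)).differentiableAt (by simp)
  have h1 : fderiv ℝ (fun z => familyForm Φ (0, z) (1, 0)) z v
      = fderiv ℝ (fun p => familyForm Φ p (1, 0)) (0, z) (0, v) := by
    have h2 := HasFDerivAt.comp z (f := fun w : ℂ => ((0 : ℝ), w))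
      (g := fun p => familyForm Φ p (1, 0)) (hd (1, 0)).hasFDerivAt
      (hasFDerivAt_prodMk_right (0 : ℝ) z)
    exact congrArg (fun T : ℂ →L[ℝ] S.𝔤 => T v) h2.fderiv
  have h3 : fderiv ℝ (fun p => familyForm Φ p (0, v)) (0, z) (1, 0) = _ :=
    fderiv_mcForm hW hΦ hp (1, 0) (0, v)
  have h4 : fderiv ℝ (fun z => familyForm Φ (0, z) (1, 0)) z v
        + S.lieB (familyForm Φ (0, z) (0, v)) (familyForm Φ (0, z) (1, 0))
      = fderiv ℝ (fun p => familyForm Φ p (0, v)) (0, z) (1, 0) := by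
    rw [h1, h3]; rfl
  rw [h4]
  exact HasFDerivAt.comp_hasDerivAt (0 : ℝ) (f := fun t : ℝ => (t, z))
    (l := fun p => S.mPart (familyForm Φ p (0, v))) (S.fderiv_linear_comp S.mPart (hd (0, v)))
    ((hasDerivAt_id (0 : ℝ)).prodMk (hasDerivAt_const (0 : ℝ) z))

/-- The first variation of the area is an integral over the surface. -/
theorem hasDerivAt_area_of_conformal (hU : IsOpen U) (hK : IsCompact K) (hKU : K ⊆ U)
    (hΦ : ContDiffOn ℝ ∞ (fun p : ℝ × ℂ => S.mat (Φ p.1 p.2)) (Set.univ ×ˢ U))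
    (hconf : ∀ z ∈ U, S.tangent (Φ 0) z Complex.I = -S.dτ (S.tangent (Φ 0) z 1))
    (himm : ∀ z ∈ K, S.tangent (Φ 0) z 1 ≠ 0) :
    HasDerivAt (fun t => S.area (Φ t) K) (∫ z in K,
      (S.metric (S.tangent (Φ 0) z 1) (S.mPart (fderiv ℝ (fun z => familyForm Φ (0, z) (1, 0)) z 1
          + S.lieB (familyForm Φ (0, z) (0, 1)) (familyForm Φ (0, z) (1, 0))))
        + S.metric (S.tangent (Φ 0) z Complex.I)
          (S.mPart (fderiv ℝ (fun z => familyForm Φ (0, z) (1, 0)) z Complex.I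
            + S.lieB (familyForm Φ (0, z) (0, Complex.I)) (familyForm Φ (0, z) (1, 0)))))) 0 := by
  have hW : IsOpen ((Set.univ : Set ℝ) ×ˢ U) := isOpen_univ.prod hU
  set A : ℝ × ℂ → S.𝔤 := fun p => S.mPart (familyForm Φ p (0, 1)) with hA
  set B : ℝ × ℂ → S.𝔤 := fun p => S.mPart (familyForm Φ p (0, Complex.I)) with hB
  have hAs : ContDiffOn ℝ ∞ A (Set.univ ×ˢ U) :=
    contDiffOn_linear_comp S.mPart (contDiffOn_familyForm hU hΦ (0, 1))
  have hBs : ContDiffOn ℝ ∞ B (Set.univ ×ˢ U) :=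
    contDiffOn_linear_comp S.mPart (contDiffOn_familyForm hU hΦ (0, Complex.I))
  set D : ℝ × ℂ → ℝ := fun p =>
    S.metric (A p) (A p) * S.metric (B p) (B p) - S.metric (A p) (B p) ^ 2 with hD
  have hDs : ContDiffOn ℝ ∞ D (Set.univ ×ˢ U) :=
    ((contDiffOn_metric hAs hAs).mul (contDiffOn_metric hBs hBs)).sub
      ((contDiffOn_metric hAs hBs).pow 2)
  -- The density is smooth only where the Gram determinant is positive: an open set that contains
  -- {0} × K because f is immersed there.
  have hO : IsOpen ((Set.univ ×ˢ U) ∩ D ⁻¹' Set.Ioi 0) :=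
    hDs.continuousOn.isOpen_inter_preimage hW isOpen_Ioi
  have hg : ContDiffOn ℝ 1 (fun p => √(D p)) ((Set.univ ×ˢ U) ∩ D ⁻¹' Set.Ioi 0) :=
    ((hDs.mono Set.inter_subset_left).sqrt fun p hp => ne_of_gt hp.2).of_le (by simp)
  have hframe : ∀ z ∈ K, 0 < S.metric (A (0, z)) (A (0, z)) ∧
      S.metric (A (0, z)) (A (0, z)) = S.metric (B (0, z)) (B (0, z)) ∧
      S.metric (A (0, z)) (B (0, z)) = 0 := by
    intro z hz
    have h1 := hconf z (hKU hz)
    have h2 := himm z hz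
    rw [tangent_slice hU hΦ 0 (hKU hz), tangent_slice hU hΦ 0 (hKU hz)] at h1
    rw [tangent_slice hU hΦ 0 (hKU hz)] at h2
    have hm := S.dτ_sq_mPart (familyForm Φ (0, z) (0, 1))
    simp only [hA, hB, h1]
    refine ⟨S.metric_pos _ hm h2, (metric_dτ_dτ hm).symm, ?_⟩
    rw [map_neg, S.metric_dτ_self hm, neg_zero]
  have hKO : ∀ z ∈ K, ((0 : ℝ), z) ∈ (Set.univ ×ˢ U) ∩ D ⁻¹' Set.Ioi 0 := by
    intro z hz
    obtain ⟨h1, h2, h3⟩ := hframe z hz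
    refine ⟨⟨Set.mem_univ _, hKU hz⟩, ?_⟩
    rw [Set.mem_preimage, Set.mem_Ioi, hD]
    simp only [h3, ← h2]
    nlinarith
  have hmain := hasDerivAt_setIntegral_of_contDiffOn hO hg hK hKO
  have harea : (fun t => S.area (Φ t) K) = fun t => ∫ z in K, √(D (t, z)) := by
    funext t
    refine setIntegral_congr_fun hK.measurableSet fun z hz => ?_
    simp only [areaDensity, tangent_slice hU hΦ t (hKU hz), hD, hA, hB]
  rw [harea]
  refine hmain.congr_deriv (setIntegral_congr_fun hK.measurableSet fun z hz => ?_)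
  obtain ⟨h1, h2, h3⟩ := hframe z hz
  have k1 := hasDerivAt_sqrt_metric (hasDerivAt_familyForm hU hΦ (hKU hz) 1)
    (hasDerivAt_familyForm hU hΦ (hKU hz) Complex.I) (S.dτ_sq_mPart _) (S.dτ_sq_mPart _)
    (S.dτ_sq_mPart _) (S.dτ_sq_mPart _) h1 h2 h3
  have k2 := ((hg.contDiffAt (hO.mem_nhds (hKO z hz))).differentiableAt
    one_ne_zero).hasFDerivAt.comp_hasDerivAt (0 : ℝ) (f := fun t : ℝ => (t, z))
    ((hasDerivAt_id (0 : ℝ)).prodMk (hasDerivAt_const (0 : ℝ) z))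
  simp only [tangent_slice hU hΦ 0 (hKU hz)]
  exact k2.unique k1

/-- The first variation of the area of a conformal Lagrangian map. -/
theorem hasDerivAt_area (hε : S.IsUnitaryFrame ε) (hα : S.IsSmoothForm α U) (hU : IsOpen U)
    (hflat : IsFlatOn (S.complexForm α) U)
    (hpp : ∀ z ∈ U, S.mPart (α z Complex.I) = -S.dτ (S.mPart (α z 1)))
    (hK : IsCompact K) (hKU : K ⊆ U) (himm : ∀ z ∈ K, S.mPart (α z 1) ≠ 0)
    (hΦ : ContDiffOn ℝ ∞ (fun p : ℝ × ℂ => S.mat (Φ p.1 p.2)) (Set.univ ×ˢ U))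
    (hΦα : ∀ z ∈ U, HasLogDerivAt (fun w => S.mat (Φ 0 w)) (S.coeForm α) z)
    (hV : ∀ z ∈ U \ K, S.variationField Φ z = 0) :
    HasDerivAt (fun t => S.area (Φ t) K) (-2 * ∫ z in K,
      (S.yCoord (ε 0) (α z 1) * S.metric (S.lieB S.Y (S.mPart (α z 1))) (S.variationField Φ z)
        + S.yCoord (ε 0) (α z Complex.I)
          * S.metric (S.lieB S.Y (S.mPart (α z Complex.I))) (S.variationField Φ z))) 0 := by
  have ht : ∀ z ∈ U, ∀ v, S.tangent (Φ 0) z v = S.mPart (α z v) := fun z hz v =>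
    S.tangent_eq (hΦα z hz) v
  have hform : ∀ z ∈ U, ∀ v, familyForm Φ (0, z) (0, v) = α z v := fun z hz v =>
    (S.maurerCartan_eq (hasLogDerivAt_slice hU hΦ 0 hz) v).symm.trans
      (S.maurerCartan_eq (hΦα z hz) v)
  have h1 := hasDerivAt_area_of_conformal hU hK hKU hΦ
    (fun z hz => by rw [ht z hz, ht z hz, hpp z hz])
    (fun z hz => by rw [ht z (hKU hz)]; exact himm z hz)
  refine h1.congr_deriv ?_
  set ξ : ℂ → S.𝔤 := fun z => familyForm Φ (0, z) (1, 0) with hξ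
  have hξs : ContDiffOn ℝ ∞ ξ U := contDiffOn_variation hU hΦ
  have hVξ : ∀ z ∈ U, S.variationField Φ z = S.mPart (ξ z) := fun z hz =>
    variationField_eq hU hΦ hz
  have hVs : ContDiffOn ℝ ∞ (fun z => S.mPart (ξ z)) U := contDiffOn_linear_comp S.mPart hξs
  have hmα : ∀ v, ContDiffOn ℝ ∞ (fun z => S.mPart (α z v)) U := fun v =>
    contDiffOn_linear_comp S.mPart (hα.contDiffOn v)
  have hPs : ∀ v, ContDiffOn ℝ ∞ (fun z => S.metric (S.mPart (α z v)) (S.mPart (ξ z))) U :=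
    fun v => contDiffOn_metric (hmα v) hVs
  have hP0 : ∀ v, ∀ z ∈ U \ K, S.metric (S.mPart (α z v)) (S.mPart (ξ z)) = 0 := by
    intro v z hz
    rw [← hVξ z hz.1, hV z hz, map_zero]
  have hPi : ∀ v w, IntegrableOn
      (fun z => fderiv ℝ (fun p => S.metric (S.mPart (α p v)) (S.mPart (ξ p))) z w) K := fun v w =>
    ((((hPs v).continuousOn_fderiv_of_isOpen hU (by simp)).clm_apply
      continuousOn_const).mono hKU).integrableOn_compact hK
  have hPi2 : IntegrableOn (fun z =>
      fderiv ℝ (fun p => S.metric (S.mPart (α p 1)) (S.mPart (ξ p))) z 1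
      + fderiv ℝ (fun p => S.metric (S.mPart (α p Complex.I)) (S.mPart (ξ p))) z Complex.I) K :=
    (hPi _ _).add (hPi _ _)
  have hN : ∀ v w, ContinuousOn (fun z => S.yCoord (ε 0) (α z w)
      * S.metric (S.lieB S.Y (S.mPart (α z v))) (S.mPart (ξ z))) U := fun v w =>
    ((contDiffOn_linear_comp (S.yCoord (ε 0)) (hα.contDiffOn w)).mul
      (contDiffOn_metric (contDiffOn_linear_comp (S.lieB S.Y) (hmα v)) hVs)).continuousOn
  have hNi : IntegrableOn (fun z => S.yCoord (ε 0) (α z 1)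
        * S.metric (S.lieB S.Y (S.mPart (α z 1))) (S.mPart (ξ z))
      + S.yCoord (ε 0) (α z Complex.I)
        * S.metric (S.lieB S.Y (S.mPart (α z Complex.I))) (S.mPart (ξ z))) K :=
    (((hN 1 1).add (hN Complex.I Complex.I)).mono hKU).integrableOn_compact hK
  have h2 : ∀ z ∈ K, _ = _ := fun z hz => firstVariation_eq hε hα hU hflat hpp (hKU hz)
    ((hξs.contDiffAt (hU.mem_nhds (hKU hz))).differentiableAt (by simp))
  -- The divergence terms integrate to zero because the variation field vanishes off K.
  have h3 : ∀ v w, ∫ z in K,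
      fderiv ℝ (fun p => S.metric (S.mPart (α p v)) (S.mPart (ξ p))) z w = 0 := fun v w =>
    setIntegral_fderiv_eq_zero hU ((hPs v).of_le (by simp)) hK hKU (hP0 v) w
  calc _ = ∫ z in K, (fderiv ℝ (fun p => S.metric (S.mPart (α p 1)) (S.mPart (ξ p))) z 1
      + fderiv ℝ (fun p => S.metric (S.mPart (α p Complex.I)) (S.mPart (ξ p))) z Complex.I
      - 2 * (S.yCoord (ε 0) (α z 1) * S.metric (S.lieB S.Y (S.mPart (α z 1))) (S.mPart (ξ z))
        + S.yCoord (ε 0) (α z Complex.I)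
          * S.metric (S.lieB S.Y (S.mPart (α z Complex.I))) (S.mPart (ξ z)))) := by
        refine setIntegral_congr_fun hK.measurableSet fun z hz => ?_
        simp only [ht z (hKU hz), hform z (hKU hz)]
        exact h2 z hz
    _ = -2 * ∫ z in K, (S.yCoord (ε 0) (α z 1)
          * S.metric (S.lieB S.Y (S.mPart (α z 1))) (S.mPart (ξ z))
        + S.yCoord (ε 0) (α z Complex.I)
          * S.metric (S.lieB S.Y (S.mPart (α z Complex.I))) (S.mPart (ξ z))) := by
        rw [integral_sub hPi2 (hNi.const_mul 2),
          integral_add (hPi _ _) (hPi _ _), h3, h3, integral_const_mul]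
        ring
    _ = _ := by
        congr 1
        refine setIntegral_congr_fun hK.measurableSet fun z hz => ?_
        simp only [hVξ z (hKU hz)]

end HermitianSymmetricSpace

/-! ### Independence of the choice of lifts. -/

namespace HermitianSymmetricSpace

variable {n : Type*} [Fintype n] [DecidableEq n] {S : HermitianSymmetricSpace n}
  {ε : Fin 2 → S.𝔤} {α : ℂ → ℂ →ₗ[ℝ] S.𝔤} {f : ℂ → S.G ⧸ S.H} {F : ℂ → S.G} {U K : Set ℂ}
  {Φ : ℝ → ℂ → S.G}

theorem areaDensity_congr {F' : ℂ → S.G} (hU : IsOpen U) (hF : S.IsLift F f U)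
    (hF' : S.IsLift F' f U) {z : ℂ} (hz : z ∈ U) : S.areaDensity F' z = S.areaDensity F z := by
  obtain ⟨g, hg, hgv⟩ := S.tangent_eq_Ad hU hU hF hF' hz hz
  have hm := S.dτ_sq_tangent F z
  simp only [areaDensity, hgv, S.metric_AdL hg (hm _) (hm _)]

/-- The variation field vanishes where the variation is constant. -/
theorem variationField_eq_zero (hU : IsOpen U) (hΦ : S.IsVariation f U K Φ) {z : ℂ}
    (hz : z ∈ U \ K) : S.variationField Φ z = 0 := by
  rw [variationField_eq hU hΦ.1 hz.1]
  refine S.mPart_of_fixed (S.dτ_sq_of_curve (c := fun t => (Φ 0 z)⁻¹ * Φ t z) (by simp) ?_ ?_)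
  · simp only [S.mat_mul]
    refine ((hasDerivAt_mat_family hU hΦ.1 hz.1).const_mul (S.mat (Φ 0 z)⁻¹)).congr_deriv ?_
    rw [← mul_assoc, S.mat_inv_mul, one_mul]
  · exact Filter.Eventually.of_forall fun t =>
      QuotientGroup.eq.1 ((hΦ.2.1 z hz.1).trans (hΦ.2.2 t z hz).symm)

theorem contDiffOn_family_mul (hΦ : ContDiffOn ℝ ∞ (fun p : ℝ × ℂ => S.mat (Φ p.1 p.2))
    (Set.univ ×ˢ U)) {h : ℂ → S.G} (hh : ContDiffOn ℝ ∞ (fun z => S.mat (h z)) U) :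
    ContDiffOn ℝ ∞ (fun p : ℝ × ℂ => S.mat (Φ p.1 p.2 * h p.2)) (Set.univ ×ˢ U) :=
  S.contDiffOn_mat_mul (F := fun p : ℝ × ℂ => Φ p.1 p.2) (K := fun p : ℝ × ℂ => h p.2) hΦ
    (ContDiffOn.comp (t := U) (f := Prod.snd) (g := fun z => S.mat (h z)) hh
      contDiff_snd.contDiffOn fun _ hp => hp.2)

theorem isLift_of_family (hΦ : ContDiffOn ℝ ∞ (fun p : ℝ × ℂ => S.mat (Φ p.1 p.2))
    (Set.univ ×ˢ U)) (t : ℝ) : S.IsLift (Φ t) (fun z => (Φ t z : S.G ⧸ S.H)) U :=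
  ⟨ContDiffOn.comp (g := fun p : ℝ × ℂ => S.mat (Φ p.1 p.2)) (f := fun z : ℂ => (t, z)) hΦ
    (contDiff_prodMk_right t).contDiffOn fun _ hz => ⟨Set.mem_univ _, hz⟩, fun _ _ => rfl⟩

theorem variationField_mul (hU : IsOpen U)
    (hΦ : ContDiffOn ℝ ∞ (fun p : ℝ × ℂ => S.mat (Φ p.1 p.2)) (Set.univ ×ˢ U)) {h : ℂ → S.G} {z : ℂ}
    (hz : z ∈ U) (hh : h z ∈ S.H) :
    S.variationField (fun t z => Φ t z * (h z)⁻¹) z = S.AdL (h z) (S.variationField Φ z) := by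
  rw [variationField_eq hU hΦ hz, ← S.mPart_Ad hh]
  refine variationField_eq_of_hasDerivAt ?_
  simp only [S.mat_mul]
  refine ((hasDerivAt_mat_family hU hΦ hz).mul_const (S.mat (h z)⁻¹)).congr_deriv ?_
  rw [S.Ad_coe]
  have e : S.mat (h z)⁻¹ * S.mat (h z) = 1 := S.mat_inv_mul _
  calc _ = S.mat (Φ 0 z) * (1 * (familyForm Φ (0, z) (1, 0) : Matrix n n ℂ)) * S.mat (h z)⁻¹ := by
        rw [one_mul]
    _ = _ := by rw [← e]; noncomm_ring

theorem area_mul (hU : IsOpen U)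
    (hΦ : ContDiffOn ℝ ∞ (fun p : ℝ × ℂ => S.mat (Φ p.1 p.2)) (Set.univ ×ˢ U)) {h : ℂ → S.G}
    (hh : ContDiffOn ℝ ∞ (fun z => S.mat (h z)) U) (hH : ∀ z ∈ U, h z ∈ S.H) (hK : IsCompact K)
    (hKU : K ⊆ U) (t : ℝ) : S.area (fun z => Φ t z * (h z)⁻¹) K = S.area (Φ t) K := by
  refine setIntegral_congr_fun hK.measurableSet fun z hz => ?_
  have h1 := (isLift_of_family (Φ := fun t z => Φ t z * (h z)⁻¹) (contDiffOn_family_mul hΦ (S.contDiffOn_mat_inv hh)) t).1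
  refine areaDensity_congr hU (isLift_of_family hΦ t) ⟨h1, fun z hz => ?_⟩ (hKU hz)
  exact QuotientGroup.eq.2 (by simpa using hH z hz)

/-- The first variation of the area of a conformal Lagrangian map, for arbitrary lifts of the
variation. -/
theorem IsLagrangianLift.hasDerivAt_area (hε : S.IsUnitaryFrame ε) (hU : IsOpen U)
    (hαs : S.IsSmoothForm α U) (hF : S.IsLagrangianLift ε F f U) (hα : S.IsMaurerCartanForm α F U)
    (hK : IsCompact K) (hKf : K ⊆ S.immersedSet f U) (hΦ : S.IsVariation f U K Φ) :
    HasDerivAt (fun t => S.area (Φ t) K) (-2 * ∫ z in K,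
      (S.yCoord (ε 0) (α z 1) * S.metric (S.lieB S.Y (S.mPart (α z 1)))
          (S.AdL ((F z)⁻¹ * Φ 0 z) (S.variationField Φ z))
        + S.yCoord (ε 0) (α z Complex.I) * S.metric (S.lieB S.Y (S.mPart (α z Complex.I)))
          (S.AdL ((F z)⁻¹ * Φ 0 z) (S.variationField Φ z)))) 0 := by
  have hKU : K ⊆ {z ∈ U | S.tangent F z 1 ≠ 0} := by
    rw [← hF.1.immersedSet_eq hU (hF.tangent_I hε)]; exact hKf
  have hflat := isFlatOn_of_isMaurerCartanForm hU hF.1.1 hαs hα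
  have hpp : ∀ z ∈ U, S.mPart (α z Complex.I) = -S.dτ (S.mPart (α z 1)) := fun z hz =>
    (S.partiallyPrimitive_iff α z).1 (hF.isPartiallyPrimitive hε hU hα z hz)
  have hΦ0 : S.IsLift (Φ 0) f U := ⟨(isLift_of_family hΦ.1 0).1, hΦ.2.1⟩
  -- The factor h = F⁻¹Φ₀ is valued in H. Passing to Φ_t h⁻¹ makes the family start at F; the maps
  -- f_t and their areas stay the same, and the variation field is transported by Ad h.
  obtain ⟨h, hh⟩ : ∃ h : ℂ → S.G, ∀ z, (F z)⁻¹ * Φ 0 z = h z := ⟨_, fun _ => rfl⟩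
  have hH : ∀ z ∈ U, h z ∈ S.H := fun z hz =>
    hh z ▸ (S.tangent_eq_AdL hU hU hF.1 hΦ0 hz hz).1
  have hhs : ContDiffOn ℝ ∞ (fun z => S.mat (h z)) U := by
    simp only [← hh]
    exact S.contDiffOn_mat_mul (S.contDiffOn_mat_inv hF.1.1) hΦ0.1
  have hΨ0 : (fun z => Φ 0 z * (h z)⁻¹) = F := by
    funext z
    simp [← hh]
  have hΨs : ContDiffOn ℝ ∞ (fun p : ℝ × ℂ => S.mat (Φ p.1 p.2 * (h p.2)⁻¹)) (Set.univ ×ˢ U) :=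
    contDiffOn_family_mul hΦ.1 (S.contDiffOn_mat_inv hhs)
  have hΨα : ∀ z ∈ U, HasLogDerivAt (fun w => S.mat (Φ 0 w * (h w)⁻¹)) (S.coeForm α) z := by
    intro z hz
    have e : (fun w => S.mat (Φ 0 w * (h w)⁻¹)) = fun w => S.mat (F w) :=
      funext fun w => congrArg S.mat (congrFun hΨ0 w)
    rw [e]
    exact hF.1.hasLogDerivAt hU hα hz
  have hΨV : ∀ z ∈ U \ K, S.variationField (fun t z => Φ t z * (h z)⁻¹) z = 0 := fun z hz => by
    rw [variationField_mul hU hΦ.1 hz.1 (hH z hz.1), variationField_eq_zero hU hΦ hz, map_zero]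
  have h1 := HermitianSymmetricSpace.hasDerivAt_area (K := K)
    (Φ := fun t z => Φ t z * (h z)⁻¹) hε hαs hU hflat hpp hK
    (fun z hz => (hKU hz).1)
    (fun z hz => by
      rw [← hF.1.tangent_eq hU hα (hKU hz).1]; exact (hKU hz).2)
    hΨs hΨα hΨV
  simp only [area_mul hU hΦ.1 hhs hH hK fun z hz => (hKU hz).1] at h1
  refine h1.congr_deriv (congrArg _ (setIntegral_congr_fun hK.measurableSet fun z hz => ?_))
  simp only [variationField_mul hU hΦ.1 (hKU hz).1 (hH z (hKU hz).1), hh]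

theorem contDiffOn_mat_expG {V : ℂ → S.𝔤} (hV : ContDiffOn ℝ ∞ V U) :
    ContDiffOn ℝ ∞ (fun p : ℝ × ℂ => S.mat (S.expG (p.1 • V p.2))) (Set.univ ×ˢ U) := by
  have h1 : ContDiffOn ℝ ∞ (fun p : ℝ × ℂ => ((p.1 • V p.2 : S.𝔤) : Matrix n n ℂ))
      (Set.univ ×ˢ U) :=
    contDiffOn_linear_comp S.𝔤.subtype (contDiff_fst.contDiffOn.smul
      (hV.comp (t := U) contDiff_snd.contDiffOn fun _ hp => hp.2))
  have h2 : ContDiff ℝ ∞ (NormedSpace.exp : Matrix n n ℂ → Matrix n n ℂ) :=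
    contDiff_iff_contDiffAt.2 fun X => (NormedSpace.exp_analytic (𝕂 := ℝ) X).contDiffAt
  have h3 := h2.comp_contDiffOn h1
  exact h3.congr fun p _ => S.mat_expG _

/-- Supplies the test variations: any smooth field V that vanishes off K is realised by F exp(tV).
-/
theorem isVariation_expG (hF : S.IsLift F f U) {V : ℂ → S.𝔤} (hV : ContDiffOn ℝ ∞ V U)
    (hV0 : ∀ z ∈ U \ K, V z = 0) :
    S.IsVariation f U K fun t z => F z * S.expG (t • V z) := by
  refine ⟨?_, fun z hz => ?_, fun t z hz => ?_⟩
  · exact S.contDiffOn_mat_mul (F := fun p : ℝ × ℂ => F p.2)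
      (ContDiffOn.comp (t := U) (f := Prod.snd) (g := fun z => S.mat (F z)) hF.1
        contDiff_snd.contDiffOn fun _ hp => hp.2) (contDiffOn_mat_expG hV)
  · beta_reduce
    rw [zero_smul, S.expG_zero, mul_one, hF.2 z hz]
  · beta_reduce
    rw [hV0 z hz, smul_zero, S.expG_zero, mul_one, hF.2 z hz.1]

theorem variationField_expG (F : ℂ → S.G) {V : ℂ → S.𝔤} {z : ℂ}
    (hV : S.dτ (S.dτ (V z)) = -V z) :
    S.variationField (fun t z => F z * S.expG (t • V z)) z = V z := by
  conv_rhs => rw [← S.mPart_of_neg hV]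
  refine variationField_eq_of_hasDerivAt ?_
  simp only [S.mat_mul, zero_smul, S.expG_zero, mul_one]
  exact (S.hasDerivAt_mat_expG_zero (V z)).const_mul _

/-- The first variation of the area in the direction of a vector field. -/
theorem IsLagrangianLift.hasDerivAt_area_expG (hε : S.IsUnitaryFrame ε) (hU : IsOpen U)
    (hαs : S.IsSmoothForm α U) (hF : S.IsLagrangianLift ε F f U) (hα : S.IsMaurerCartanForm α F U)
    (hK : IsCompact K) (hKf : K ⊆ S.immersedSet f U) {V : ℂ → S.𝔤} (hV : ContDiffOn ℝ ∞ V U)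
    (hVm : ∀ z, S.dτ (S.dτ (V z)) = -V z) (hV0 : ∀ z ∈ U \ K, V z = 0) :
    HasDerivAt (fun t : ℝ => S.area (fun z => F z * S.expG (t • V z)) K) (-2 * ∫ z in K,
      (S.yCoord (ε 0) (α z 1) * S.metric (S.lieB S.Y (S.mPart (α z 1))) (V z)
        + S.yCoord (ε 0) (α z Complex.I)
          * S.metric (S.lieB S.Y (S.mPart (α z Complex.I))) (V z))) 0 := by
  have h := hF.hasDerivAt_area hε hU hαs hα hK hKf (isVariation_expG hF.1 hV hV0)
  simpa only [variationField_expG F (hVm _), zero_smul, S.expG_zero, mul_one, inv_mul_cancel,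
    S.Ad_one] using h

end HermitianSymmetricSpace

/-- Integration by parts for a compactly supported function on a plane domain. -/
theorem setIntegral_mul_fderiv {p q η : ℂ → ℝ} {U K : Set ℂ} (hU : IsOpen U)
    (hp : ContDiffOn ℝ 1 p U) (hq : ContDiffOn ℝ 1 q U) (hη : ContDiffOn ℝ 1 η U) (hK : IsCompact K)
    (hKU : K ⊆ U) (h0 : ∀ z ∈ U \ K, η z = 0) :
    ∫ z in K, (p z * fderiv ℝ η z 1 + q z * fderiv ℝ η z Complex.I)
      = -∫ z in K, η z * (fderiv ℝ p z 1 + fderiv ℝ q z Complex.I) := by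
  have hd : ∀ {g : ℂ → ℝ}, ContDiffOn ℝ 1 g U → ∀ z ∈ U, DifferentiableAt ℝ g z := fun hg z hz =>
    (hg.contDiffAt (hU.mem_nhds hz)).differentiableAt one_ne_zero
  have hc : ∀ {g : ℂ → ℝ}, ContDiffOn ℝ 1 g U → ∀ v, ContinuousOn (fun z => fderiv ℝ g z v) U :=
    fun hg v => (hg.continuousOn_fderiv_of_isOpen hU le_rfl).clm_apply continuousOn_const
  have hprod : ∀ {g : ℂ → ℝ}, ContDiffOn ℝ 1 g U → ∀ v,
      ∫ z in K, (g z * fderiv ℝ η z v + η z * fderiv ℝ g z v) = 0 := by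
    intro g hg v
    rw [← setIntegral_fderiv_eq_zero (P := fun z => g z * η z) hU (hg.mul hη) hK hKU
      (fun z hz => by rw [h0 z hz, mul_zero]) v]
    refine setIntegral_congr_fun hK.measurableSet fun z hz => ?_
    have h1 := ((hd hg z (hKU hz)).hasFDerivAt.mul (hd hη z (hKU hz)).hasFDerivAt).fderiv
    exact (congrArg (fun T : ℂ →L[ℝ] ℝ => T v) h1).symm
  have hi : ∀ {g : ℂ → ℝ}, ContDiffOn ℝ 1 g U → ∀ v,
      IntegrableOn (fun z => g z * fderiv ℝ η z v + η z * fderiv ℝ g z v) K := fun hg v =>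
    (((hg.continuousOn.mul (hc hη v)).add (hη.continuousOn.mul (hc hg v))).mono
      hKU).integrableOn_compact hK
  have hi1 : IntegrableOn (fun z => p z * fderiv ℝ η z 1 + q z * fderiv ℝ η z Complex.I) K :=
    (((hp.continuousOn.mul (hc hη 1)).add (hq.continuousOn.mul (hc hη Complex.I))).mono
      hKU).integrableOn_compact hK
  have hi2 : IntegrableOn (fun z => η z * (fderiv ℝ p z 1 + fderiv ℝ q z Complex.I)) K :=
    ((hη.continuousOn.mul ((hc hp 1).add (hc hq Complex.I))).mono hKU).integrableOn_compact hK
  rw [eq_neg_iff_add_eq_zero, ← integral_add hi1 hi2]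
  have h2 := integral_add (hi hp 1) (hi hq Complex.I)
  rw [hprod hp, hprod hq, add_zero] at h2
  rw [← h2]
  refine integral_congr_ae (Filter.Eventually.of_forall fun z => ?_)
  simp only
  ring

/-! ### The variational criteria in terms of θ. -/

namespace HermitianSymmetricSpace

variable {n : Type*} [Fintype n] [DecidableEq n] {S : HermitianSymmetricSpace n}
  {ε : Fin 2 → S.𝔤} {α : ℂ → ℂ →ₗ[ℝ] S.𝔤} {f : ℂ → S.G ⧸ S.H} {F : ℂ → S.G} {U K : Set ℂ}
  {Φ : ℝ → ℂ → S.G}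

theorem IsLagrangianLift.immersedSet_eq (hε : S.IsUnitaryFrame ε) (hU : IsOpen U)
    (hF : S.IsLagrangianLift ε F f U) (hα : S.IsMaurerCartanForm α F U) :
    S.immersedSet f U = {z ∈ U | S.mPart (α z 1) ≠ 0} := by
  rw [hF.1.immersedSet_eq hU (hF.tangent_I hε)]
  exact Set.ext fun z => and_congr_right fun hz => by rw [hF.1.tangent_eq hU hα hz]

theorem IsLagrangianLift.isOpen_immersedSet (hε : S.IsUnitaryFrame ε) (hU : IsOpen U)
    (hαs : S.IsSmoothForm α U) (hF : S.IsLagrangianLift ε F f U)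
    (hα : S.IsMaurerCartanForm α F U) : IsOpen (S.immersedSet f U) := by
  rw [hF.immersedSet_eq hε hU hα]
  have h1 : ContinuousOn (fun z => S.mPart (α z 1)) U :=
    (contDiffOn_linear_comp S.mPart (hαs.contDiffOn 1)).continuousOn
  exact h1.isOpen_inter_preimage hU isOpen_compl_singleton

theorem contDiffOn_yCoord (hαs : S.IsSmoothForm α U) (v : ℂ) :
    ContDiffOn ℝ ∞ (fun z => S.yCoord (ε 0) (α z v)) U :=
  contDiffOn_linear_comp (S.yCoord (ε 0)) (hαs.contDiffOn v)

theorem fderiv_yCoord (hU : IsOpen U) (hαs : S.IsSmoothForm α U) {z : ℂ} (hz : z ∈ U) :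
    fderiv ℝ (fun z => S.yCoord (ε 0) (α z 1)) z 1
      + fderiv ℝ (fun z => S.yCoord (ε 0) (α z Complex.I)) z Complex.I = divTheta ε α z := by
  rw [hαs.fderiv_comp hU hz (S.yCoord (ε 0)), hαs.fderiv_comp hU hz (S.yCoord (ε 0)), divTheta]

theorem continuousOn_divTheta (hU : IsOpen U) (hαs : S.IsSmoothForm α U) :
    ContinuousOn (divTheta ε α) U := by
  have hc : ∀ v, ContinuousOn (fun z => fderiv ℝ (fun z => S.yCoord (ε 0) (α z v)) z v) U :=
    fun v => ((contDiffOn_yCoord hαs v).continuousOn_fderiv_of_isOpen hU (by simp)).clm_apply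
      continuousOn_const
  exact ((hc 1).add (hc Complex.I)).congr fun z hz => (fderiv_yCoord hU hαs hz).symm


/-- A conformal Lagrangian map is minimal if and only if `α₂ = 0`. -/
theorem IsLagrangianLift.isMinimal_iff (hε : S.IsUnitaryFrame ε) (hU : IsOpen U)
    (hαs : S.IsSmoothForm α U) (hF : S.IsLagrangianLift ε F f U)
    (hα : S.IsMaurerCartanForm α F U) (hdense : U ⊆ closure (S.immersedSet f U)) :
    S.IsMinimal f U ↔
      ∀ z ∈ U, S.yCoord (ε 0) (α z 1) = 0 ∧ S.yCoord (ε 0) (α z Complex.I) = 0 := by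
  have himm := hF.immersedSet_eq hε hU hα
  have hfU : S.immersedSet f U ⊆ U := by rw [himm]; exact Set.sep_subset _ _
  have hpp : ∀ z ∈ U, S.mPart (α z Complex.I) = -S.dτ (S.mPart (α z 1)) := fun z hz =>
    (S.partiallyPrimitive_iff α z).1 (hF.isPartiallyPrimitive hε hU hα z hz)
  constructor
  · intro hmin
    have hmα : ∀ v, ContDiffOn ℝ ∞ (fun z => S.mPart (α z v)) U := fun v =>
      contDiffOn_linear_comp S.mPart (hαs.contDiffOn v)
    have hp : ∀ v, ContDiffOn ℝ ∞ (fun z => S.yCoord (ε 0) (α z v)) U := contDiffOn_yCoord hαs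
    -- N is half of the expression in `meanCurvature_eq`. Testing with φ N turns the first variation
    -- into -2 ∫ φ |N|².
    set N : ℂ → S.𝔤 := fun z => S.yCoord (ε 0) (α z 1) • S.lieB S.Y (S.mPart (α z 1))
      + S.yCoord (ε 0) (α z Complex.I) • S.lieB S.Y (S.mPart (α z Complex.I)) with hN
    have hNs : ContDiffOn ℝ ∞ N U :=
      ((hp 1).smul (contDiffOn_linear_comp (S.lieB S.Y) (hmα 1))).add
        ((hp Complex.I).smul (contDiffOn_linear_comp (S.lieB S.Y) (hmα Complex.I)))
    have hNm : ∀ z, S.dτ (S.dτ (N z)) = -N z := by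
      intro z
      simp only [hN, map_add, map_smul, S.dτ_sq_J (S.dτ_sq_mPart _)]
      module
    have hNN : ∀ z ∈ S.immersedSet f U, S.metric (N z) (N z) = 0 := by
      intro z hz
      refine eq_zero_of_setIntegral_contDiff_mul_eq_zero
        (hF.isOpen_immersedSet hε hU hαs hα)
        ((contDiffOn_metric hNs hNs).continuousOn.mono hfU) (fun φ hφ hc hs => ?_) hz
      have hφ0 : ∀ z ∈ U \ tsupport φ, φ z • N z = 0 := fun z hz => by
        rw [image_eq_zero_of_notMem_tsupport hz.2, zero_smul]
      have hVs : ContDiffOn ℝ ∞ (fun z => φ z • N z) U := hφ.contDiffOn.smul hNs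
      have hVm : ∀ z, S.dτ (S.dτ (φ z • N z)) = -(φ z • N z) := fun z => by
        rw [map_smul, map_smul, hNm, smul_neg]
      have h1 := hF.hasDerivAt_area_expG hε hU hαs hα hc hs hVs hVm hφ0
      have h2 := h1.unique (hmin _ hs hc _ (isVariation_expG hF.1 hVs hφ0))
      rw [mul_eq_zero, or_iff_right (by norm_num)] at h2
      rw [← h2]
      refine setIntegral_congr_fun hc.measurableSet fun z hz => ?_
      simp only [hN, map_smul, map_add, LinearMap.add_apply, LinearMap.smul_apply, smul_eq_mul]
      ring
    have hzero : ∀ z ∈ S.immersedSet f U,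
        S.yCoord (ε 0) (α z 1) = 0 ∧ S.yCoord (ε 0) (α z Complex.I) = 0 := by
      intro z hz
      have h1 := hNN z hz
      rw [himm] at hz
      have hm := S.dτ_sq_mPart (α z 1)
      have hm' := S.dτ_sq_dτ hm
      have hpos := S.metric_pos _ hm hz.2
      have e2 := S.metric_dτ_self hm
      have e3 : S.metric (S.dτ (S.mPart (α z 1))) (S.mPart (α z 1)) = 0 := by
        rw [S.metric_symm _ _ hm' hm, e2]
      simp only [hN, hpp z hz.1, map_add, map_smul, map_neg, LinearMap.add_apply,
        LinearMap.smul_apply, LinearMap.neg_apply, S.metric_J_J hm hm, S.metric_J_J hm hm',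
        S.metric_J_J hm' hm, S.metric_J_J hm' hm', S.metric_τ _ _ hm hm, e2, e3,
        smul_eq_mul] at h1
      -- JA and JτA are orthogonal and as long as A, so |N|² = (p² + q²) |A|².
      have h2 : (S.yCoord (ε 0) (α z 1) ^ 2 + S.yCoord (ε 0) (α z Complex.I) ^ 2)
          * S.metric (S.mPart (α z 1)) (S.mPart (α z 1)) = 0 := by
        rw [← h1]; ring
      have h3 := (mul_eq_zero.1 h2).resolve_right hpos.ne'
      constructor <;> nlinarith
    have hext : ∀ v, (∀ z ∈ S.immersedSet f U, S.yCoord (ε 0) (α z v) = 0) →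
        ∀ z ∈ U, S.yCoord (ε 0) (α z v) = 0 := fun v h z hz =>
      Set.EqOn.of_subset_closure (f := fun z => S.yCoord (ε 0) (α z v)) (g := fun _ => 0) h
        (hp v).continuousOn continuousOn_const hfU hdense hz
    exact fun z hz => ⟨hext 1 (fun z hz => (hzero z hz).1) z hz,
      hext Complex.I (fun z hz => (hzero z hz).2) z hz⟩
  · intro h K hKf hK Φ hΦ
    refine (hF.hasDerivAt_area hε hU hαs hα hK hKf hΦ).congr_deriv ?_
    rw [setIntegral_congr_fun (g := fun _ => (0 : ℝ)) hK.measurableSet fun z hz => by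
      simp only [(h z (hfU (hKf hz))).1, (h z (hfU (hKf hz))).2, zero_mul, add_zero]]
    simp

/-- A conformal Lagrangian map is Hamiltonian stationary if and only if the divergence of the form
`θ` with `α₂ = θ Y` vanishes. -/
theorem IsLagrangianLift.isHamiltonianStationary_iff (hε : S.IsUnitaryFrame ε) (hU : IsOpen U)
    (hαs : S.IsSmoothForm α U) (hF : S.IsLagrangianLift ε F f U)
    (hα : S.IsMaurerCartanForm α F U) (hdense : U ⊆ closure (S.immersedSet f U)) :
    S.IsHamiltonianStationary f U ↔ ∀ z ∈ U, divTheta ε α z = 0 := by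
  have himm := hF.immersedSet_eq hε hU hα
  have hfU : S.immersedSet f U ⊆ U := by rw [himm]; exact Set.sep_subset _ _
  have hpp : ∀ z ∈ U, S.mPart (α z Complex.I) = -S.dτ (S.mPart (α z 1)) := fun z hz =>
    (S.partiallyPrimitive_iff α z).1 (hF.isPartiallyPrimitive hε hU hα z hz)
  have hparts : ∀ {η : ℂ → ℝ} {K : Set ℂ}, ContDiffOn ℝ ∞ η U → IsCompact K → K ⊆ U →
      (∀ z ∈ U \ K, η z = 0) →
      ∫ z in K, (S.yCoord (ε 0) (α z 1) * fderiv ℝ η z 1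
        + S.yCoord (ε 0) (α z Complex.I) * fderiv ℝ η z Complex.I)
      = -∫ z in K, η z * divTheta ε α z := by
    intro η K hη hK hKU h0
    rw [setIntegral_mul_fderiv hU ((contDiffOn_yCoord hαs 1).of_le (by simp))
      ((contDiffOn_yCoord hαs Complex.I).of_le (by simp)) (hη.of_le (by simp)) hK hKU h0]
    congr 1
    refine setIntegral_congr_fun hK.measurableSet fun z hz => ?_
    simp only [fderiv_yCoord hU hαs (hKU hz)]
  constructor
  · intro hstat
    have hmα : ∀ v, ContDiffOn ℝ ∞ (fun z => S.mPart (α z v)) U := fun v =>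
      contDiffOn_linear_comp S.mPart (hαs.contDiffOn v)
    have hzero : ∀ z ∈ S.immersedSet f U, divTheta ε α z = 0 := by
      intro z hz
      refine eq_zero_of_setIntegral_contDiff_mul_eq_zero
        (hF.isOpen_immersedSet hε hU hαs hα)
        ((continuousOn_divTheta hU hαs).mono hfU) (fun η hη hc hs => ?_) hz
      have hη0 : ∀ z ∉ tsupport η, η =ᶠ[𝓝 z] fun _ => 0 := fun z hz =>
        notMem_tsupport_iff_eventuallyEq.1 hz
      have hdη0 : ∀ z ∉ tsupport η, fderiv ℝ η z = 0 := fun z hz => by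
        rw [(hη0 z hz).fderiv_eq]; simp
      have hdη : ∀ v, ContDiff ℝ ∞ fun z => fderiv ℝ η z v := fun v =>
        (hη.fderiv_right (m := ∞) le_rfl).clm_apply contDiff_const
      -- JA and JB are orthogonal of length |A|, so this V satisfies ⟨JA, V⟩ = -η_x and ⟨JB, V⟩ =
      -- -η_y, that is, ω(V, df) = dη. The inverse of |A|² is smooth near the support of η, and V
      -- vanishes elsewhere with dη.
      set V : ℂ → S.𝔤 := fun z => -(S.metric (S.mPart (α z 1)) (S.mPart (α z 1)))⁻¹ •
        (fderiv ℝ η z 1 • S.lieB S.Y (S.mPart (α z 1))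
          + fderiv ℝ η z Complex.I • S.lieB S.Y (S.mPart (α z Complex.I))) with hV
      have hV0 : ∀ z ∉ tsupport η, V z = 0 := fun z hz => by
        simp [hV, hdη0 z hz]
      have hVm : ∀ z, S.dτ (S.dτ (V z)) = -V z := by
        intro z
        simp only [hV, map_add, map_smul, S.dτ_sq_J (S.dτ_sq_mPart _)]
        module
      have hVs : ContDiffOn ℝ ∞ V U := by
        intro z hz
        by_cases hzη : z ∈ tsupport η
        · have hn := hU.mem_nhds hz
          have hr : ContDiffAt ℝ ∞ (fun z => S.metric (S.mPart (α z 1)) (S.mPart (α z 1))) z :=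
            (contDiffOn_metric (hmα 1) (hmα 1)).contDiffAt hn
          have hz' := hs hzη
          rw [himm] at hz'
          have hne := (S.metric_pos _ (S.dτ_sq_mPart _) hz'.2).ne'
          have hJ : ∀ v, ContDiffAt ℝ ∞ (fun z => S.lieB S.Y (S.mPart (α z v))) z := fun v =>
            (contDiffOn_linear_comp (S.lieB S.Y) (hmα v)).contDiffAt hn
          exact ((hr.inv hne).neg.smul (((hdη 1).contDiffAt.smul (hJ 1)).add
            ((hdη Complex.I).contDiffAt.smul (hJ Complex.I)))).contDiffWithinAt
        · refine (contDiffAt_const (c := (0 : S.𝔤))).contDiffWithinAt.congr_of_eventuallyEq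
            (mem_nhdsWithin_of_mem_nhds ?_) (hV0 z hzη)
          filter_upwards [(isClosed_tsupport η).isOpen_compl.mem_nhds hzη] with w hw
            using hV0 w hw
      have hVU : ∀ z ∈ U \ tsupport η, V z = 0 := fun z hz => hV0 z hz.2
      have hvar := isVariation_expG hF.1 hVs hVU
      have hJV : ∀ z ∈ tsupport η,
          S.metric (S.lieB S.Y (S.mPart (α z 1))) (V z) = -fderiv ℝ η z 1 ∧
          S.metric (S.lieB S.Y (S.mPart (α z Complex.I))) (V z) = -fderiv ℝ η z Complex.I := by
        intro z hz
        have hz' := hs hz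
        rw [himm] at hz'
        have hm := S.dτ_sq_mPart (α z 1)
        have hm' := S.dτ_sq_dτ hm
        have hne := (S.metric_pos _ hm hz'.2).ne'
        have e2 := S.metric_dτ_self hm
        have e3 : S.metric (S.dτ (S.mPart (α z 1))) (S.mPart (α z 1)) = 0 := by
          rw [S.metric_symm _ _ hm' hm, e2]
        simp only [hV, hpp z hz'.1, map_add, map_smul, map_neg, LinearMap.neg_apply,
          S.metric_J_J hm hm, S.metric_J_J hm hm', S.metric_J_J hm' hm, S.metric_J_J hm' hm',
          S.metric_τ _ _ hm hm, e2, e3, smul_eq_mul]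
        constructor <;> field_simp <;> ring
      clear_value V
      have hV00 : (fun z => F z * S.expG ((0 : ℝ) • V z)) = F := by
        funext z
        rw [zero_smul, S.expG_zero, mul_one]
      have hham : S.IsHamiltonianVariation U fun t z => F z * S.expG (t • V z) := by
        refine ⟨η, hη.contDiffOn, ⟨tsupport η, hs.trans hfU, hc, fun z hz =>
          image_eq_zero_of_notMem_tsupport hz.2⟩, fun z hz v => ?_⟩
        beta_reduce
        rw [variationField_expG F (hVm z), hV00, hF.1.tangent_eq hU hα hz]
        by_cases hzη : z ∈ tsupport η
        · have hk : ∀ w, S.metric (S.lieB S.Y (V z)) (S.mPart (α z w))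
              = -S.metric (S.lieB S.Y (S.mPart (α z w))) (V z) := fun w => by
            rw [S.metric_J_left (hVm z) (S.dτ_sq_mPart _),
              S.metric_symm _ _ (hVm z) (S.dτ_sq_J (S.dτ_sq_mPart _))]
          rw [kahler, J_eq, complex_linearMap_apply (α z) v, map_add, map_smul, map_smul, map_add,
            map_smul, map_smul, hk, hk, (hJV z hzη).1, (hJV z hzη).2, neg_neg, neg_neg]
          exact (complex_linearMap_apply (fderiv ℝ η z : ℂ →ₗ[ℝ] ℝ) v).symm
        · rw [hV0 z hzη, hdη0 z hzη, kahler, J_eq]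
          simp
      have h1 := hF.hasDerivAt_area_expG hε hU hαs hα hc hs hVs hVm hVU
      have h2 := h1.unique (hstat _ hs hc _ hvar hham)
      rw [mul_eq_zero, or_iff_right (by norm_num)] at h2
      have h3 := hparts hη.contDiffOn hc (hs.trans hfU)
        fun z hz => image_eq_zero_of_notMem_tsupport hz.2
      rw [← neg_eq_zero, ← h3, ← neg_eq_zero, ← integral_neg, ← h2]
      refine setIntegral_congr_fun hc.measurableSet fun z hz => ?_
      simp only [(hJV z hz).1, (hJV z hz).2]
      ring
    exact fun z hz => Set.EqOn.of_subset_closure (g := fun _ => 0) hzero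
      (continuousOn_divTheta hU hαs) continuousOn_const hfU hdense hz
  · rintro h K hKf hK Φ hΦ ⟨η, hη, ⟨K', hK'U, hK', hη0⟩, hham⟩
    refine (hF.hasDerivAt_area hε hU hαs hα hK hKf hΦ).congr_deriv ?_
    have hΦ0 : S.IsLift (Φ 0) f U := ⟨(isLift_of_family hΦ.1 0).1, hΦ.2.1⟩
    -- The Hamiltonian condition is expressed through the lift Φ₀; Ad(F⁻¹Φ₀) preserves ω and carries
    -- it over to F.
    have hJV : ∀ z ∈ U, ∀ v, S.metric (S.lieB S.Y (S.mPart (α z v)))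
        (S.AdL ((F z)⁻¹ * Φ 0 z) (S.variationField Φ z)) = -fderiv ℝ η z v := by
      intro z hz v
      obtain ⟨hH, hT⟩ := S.tangent_eq_AdL hU hU hF.1 hΦ0 hz hz
      have hm : S.dτ (S.dτ (S.variationField Φ z)) = -S.variationField Φ z := S.dτ_sq_mPart _
      have hm' : S.dτ (S.dτ (S.AdL ((F z)⁻¹ * Φ 0 z) (S.variationField Φ z)))
          = -S.AdL ((F z)⁻¹ * Φ 0 z) (S.variationField Φ z) := by
        rw [S.dτ_sq_Ad hH, hm, map_neg]
      have h1 := hham z hz v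
      rw [← S.kahler_AdL hH hm (S.dτ_sq_tangent _ _ _), hT, S.Ad_Ad_inv,
        hF.1.tangent_eq hU hα hz, kahler, J_eq, S.metric_J_left hm' (S.dτ_sq_mPart _),
        S.metric_symm _ _ hm' (S.dτ_sq_J (S.dτ_sq_mPart _))] at h1
      linarith
    -- Off K the variation field vanishes, and with it dη, though η may be a nonzero constant on
    -- parts of U \ K.
    have hdη0 : ∀ z ∈ U \ K, ∀ v, fderiv ℝ η z v = 0 := by
      intro z hz v
      rw [← hham z hz.1 v, variationField_eq_zero hU hΦ hz, kahler, J_eq]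
      simp
    have hKU := hKf.trans hfU
    have hL : K ∪ K' ⊆ U := Set.union_subset hKU hK'U
    -- For this reason the integration by parts runs over K ∪ K', off which η vanishes; the integral
    -- of the terms in dη then shrinks back to K.
    have h1 := hparts hη (hK.union hK') hL fun z hz =>
      hη0 z ⟨hz.1, fun h => hz.2 (Or.inr h)⟩
    rw [setIntegral_eq_zero_of_forall_eq_zero (f := fun z => η z * divTheta ε α z)
        (fun z hz => by rw [h z (hL hz), mul_zero]), neg_zero,
      setIntegral_eq_of_subset_of_forall_sdiff_eq_zero (s := K) (hK.union hK').measurableSet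
        Set.subset_union_left (fun z hz => by
          rw [hdη0 z ⟨hL hz.1, hz.2⟩, hdη0 z ⟨hL hz.1, hz.2⟩, mul_zero, mul_zero, add_zero])] at h1
    rw [mul_eq_zero, ← neg_eq_zero (a := ∫ z in K, _), ← integral_neg]
    refine Or.inr (Eq.trans (setIntegral_congr_fun hK.measurableSet fun z hz => ?_) h1)
    simp only [hJV z (hKU hz)]
    ring

end HermitianSymmetricSpace

end

/-! ### The characterisation of lifts and of stationary surfaces. -/

theorem mainTheorem1 {n : Type*} [Fintype n] [DecidableEq n]
    (S : HermitianSymmetricSpace n) (ε : Fin 2 → S.𝔤) (hε : S.IsUnitaryFrame ε)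
    (U : Set ℂ) (hU : IsOpen U) (hU' : SimplyConnectedSpace U)
    (α : ℂ → ℂ →ₗ[ℝ] S.𝔤) (hα : S.IsSmoothForm α U) :
    -- weakly conformal Lagrangian maps
    ((∃ (f : ℂ → S.G ⧸ S.H) (F : ℂ → S.G), S.IsConformalLagrangian f U ∧
        S.IsLagrangianLift ε F f U ∧ S.IsMaurerCartanForm α F U) ↔
      IsFlatOn (S.complexForm α) U ∧ S.IsPartiallyPrimitive α U) ∧
    -- conformal Lagrangian immersions
    ((∃ (f : ℂ → S.G ⧸ S.H) (F : ℂ → S.G), S.IsConformalLagrangian f U ∧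
        S.immersedSet f U = U ∧ S.IsLagrangianLift ε F f U ∧ S.IsMaurerCartanForm α F U) ↔
      IsFlatOn (S.complexForm α) U ∧ S.IsPartiallyPrimitive α U ∧
        ∀ z ∈ U, formPart10 (S.component (-1) α) z ≠ 0) ∧
    -- Hamiltonian stationary and minimal surfaces
    (∀ (f : ℂ → S.G ⧸ S.H) (F : ℂ → S.G), S.IsConformalLagrangian f U →
      U ⊆ closure (S.immersedSet f U) →
      S.IsLagrangianLift ε F f U → S.IsMaurerCartanForm α F U →
      (S.IsHamiltonianStationary f U ↔
        ∀ lam : ℂ, ‖lam‖ = 1 → IsFlatOn (S.extendedForm α lam) U) ∧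
      (S.IsHamiltonianStationary f U ↔
        ∀ lam : ℂ, lam ≠ 0 → IsFlatOn (S.extendedForm α lam) U) ∧
      (S.IsMinimal f U ↔ ∀ z ∈ U, S.component 2 α z = 0)) := by
  refine ⟨⟨?_, ?_⟩, ⟨?_, ?_⟩, ?_⟩
  · rintro ⟨f, F, -, hF, hF'⟩
    exact ⟨HermitianSymmetricSpace.isFlatOn_of_isMaurerCartanForm hU hF.1.1 hα hF',
      hF.isPartiallyPrimitive hε hU hF'⟩
  · rintro ⟨hflat, hpp⟩
    exact HermitianSymmetricSpace.exists_isLagrangianLift hε hU hU' hα hflat hpp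
  · rintro ⟨f, F, -, himm, hF, hF'⟩
    exact ⟨HermitianSymmetricSpace.isFlatOn_of_isMaurerCartanForm hU hF.1.1 hα hF',
      hF.isPartiallyPrimitive hε hU hF', (hF.immersedSet_eq_iff hε hU hF').1 himm⟩
  · rintro ⟨hflat, hpp, hne⟩
    obtain ⟨f, F, hf, hF, hF'⟩ :=
      HermitianSymmetricSpace.exists_isLagrangianLift hε hU hU' hα hflat hpp
    exact ⟨f, F, hf, (hF.immersedSet_eq_iff hε hU hF').2 hne, hF, hF'⟩
  · intro f F _ hdense hF hF'
    have hflat := HermitianSymmetricSpace.isFlatOn_of_isMaurerCartanForm hU hF.1.1 hα hF'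
    have hpp : ∀ z ∈ U, S.mPart (α z Complex.I) = -S.dτ (S.mPart (α z 1)) := fun z hz =>
      (S.partiallyPrimitive_iff α z).1 (hF.isPartiallyPrimitive hε hU hF' z hz)
    have hstat := hF.isHamiltonianStationary_iff hε hU hα hF' hdense
    refine ⟨?_, ?_, ?_⟩
    · rw [hstat, HermitianSymmetricSpace.extendedForm_flat_circle_iff hε hα hU hflat hpp]
    · rw [hstat, HermitianSymmetricSpace.extendedForm_flat_ne_zero_iff hε hα hU hflat hpp]
    · rw [hF.isMinimal_iff hε hU hα hF' hdense]
      exact forall₂_congr fun z _ =>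
        (HermitianSymmetricSpace.component_two_eq_zero_iff hε α z).symm
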